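/- Let $G$ be a locally compact (Hausdorff) group with left Haar measure $dx$, and suppose that $G$ is an $[\mathrm{IN}]$ group, i.e. the identity has a compact neighbourhood invariant under all inner automorphisms. Let $w:G\to(0,\infty)$ be a weight, i.e. a Borel measurable function with $w(xy)\le w(x)w(y)$ for all $x,y\in G$, and assume that $w$ is constant on conjugacy classes or that $w\ge 1$ on $G$. Let $A$ be a complex Banach algebra (not necessarily unital) with centre $\mathcal Z(A)$, and assume that there is a bounded net $(a_\alpha)$ in $A$ with $a_\alpha z\to z$ for every $z\in\mathcal Z(A)$. For a Banach algebra $B$ let $L^1_w(G,B)$ be the Banach algebra of (classes of) Bochner measurable functions $f:G\to B$ with $\|f\|=\int_G\|f(x)\|\,w(x)\,dx<\infty$, with the convolution product $(f*g)(x)=\int_G f(xy)g(y^{-1})\,dy$; write $L^1_w(G)=L^1_w(G,\mathbb C)$. Let $L^1_{w,\mathrm{inv}}(G,B)\subseteq L^1_w(G,B)$ be the subspace of the classes which have a representative that is Bochner measurable with respect to the $\sigma$-algebra of conjugation invariant Borel sets. Let $\otimes^\gamma$ denote the Banach space projective tensor product (the completion of the algebraic tensor product in the projective norm), with the product determined by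 $(f\otimes z)(g\otimes z')=(f*g)\otimes zz'$. Then: (1) $L^1_{w,\mathrm{inv}}(G,\mathcal Z(A))$ consists exactly of the classes in $L^1_w(G,\mathcal Z(A))$ which have a (Bochner measurable) representative that is constant on conjugacy classes of $G$. (2) Regarding $\mathcal Z(A)$-valued functions as $A$-valued functions identifies $L^1_{w,\mathrm{inv}}(G,\mathcal Z(A))$ isometrically with $\mathcal Z\big(L^1_w(G,A)\big)$. (3) There is an isometric isomorphism of Banach algebras $$\mathcal Z\big(L^1_w(G)\big)\otimes^\gamma\mathcal Z(A)\;\cong\;L^1_{w,\mathrm{inv}}(G,\mathcal Z(A))=\mathcal Z\big(L^1_w(G,A)\big)$$ which sends $f\otimes z$ to the function $x\mapsto f(x)z$. -/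

import Mathlib

open MeasureTheory Filter Topology
open scoped ENNReal NNReal Pointwise TensorProduct

namespace Beurling

/-- A weight on `G`: a (Borel) measurable function `w : G → (0, ∞)` with
`w (x y) ≤ w x * w y` for all `x`, `y`. -/
structure Weight (G : Type*) [Group G] [MeasurableSpace G] where
  toFun : G → ℝ≥0
  measurable' : Measurable toFun
  pos' : ∀ x, 0 < toFun x
  mul_le' : ∀ x y, toFun (x * y) ≤ toFun x * toFun y

instance {G : Type*} [Group G] [MeasurableSpace G] : CoeFun (Weight G) (fun _ => G → ℝ≥0) :=
  ⟨Weight.toFun⟩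

/-- The measure `w(x) dx`. -/
noncomputable def wMeasure {G : Type*} [Group G] [MeasurableSpace G] (μ : Measure G)
    (w : Weight G) : Measure G :=
  μ.withDensity (fun x => (w x : ℝ≥0∞))

section Basic

variable {G : Type*} [Group G] [MeasurableSpace G] (μ : Measure G) (w : Weight G)

theorem wMeasure_ac : wMeasure μ w ≪ μ := withDensity_absolutelyContinuous _ _

theorem ac_wMeasure : μ ≪ wMeasure μ w :=
  withDensity_absolutelyContinuous' w.measurable'.coe_nnreal_ennreal.aemeasurable
    (Eventually.of_forall fun x => by simpa using (w.pos' x).ne')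

theorem lintegral_wMeasure (f : G → ℝ≥0∞) :
    ∫⁻ x, f x ∂(wMeasure μ w) = ∫⁻ x, w x * f x ∂μ :=
  lintegral_withDensity_eq_lintegral_mul_non_measurable μ
    w.measurable'.coe_nnreal_ennreal (Eventually.of_forall fun _ => ENNReal.coe_lt_top) f

end Basic

section Measure

variable {G : Type*} [Group G] [TopologicalSpace G] [IsTopologicalGroup G] [T2Space G]
  [LocallyCompactSpace G] [MeasurableSpace G] [BorelSpace G]
  (μ : Measure G) [μ.IsHaarMeasure] [μ.Regular] (w : Weight G)

theorem Weight.exists_nhds_one_bound : ∃ U ∈ 𝓝 (1 : G), ∃ C : ℝ≥0, ∀ x ∈ U, w x ≤ C := by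
  let μ : Measure G := Measure.haar
  obtain ⟨K, hK, hK1⟩ := exists_compact_mem_nhds (1 : G)
  let E : ℕ → Set G := fun n => {x | w x ≤ n ∧ w x⁻¹ ≤ n} ∩ K
  have hE : ∀ n, MeasurableSet (E n) := fun n =>
    ((measurableSet_le w.measurable' measurable_const).inter
      (measurableSet_le (w.measurable'.comp measurable_inv) measurable_const)).inter
        hK.measurableSet
  have hU : ⋃ n, E n = K := by
    apply Set.Subset.antisymm
    · exact Set.iUnion_subset fun n => Set.inter_subset_right
    · intro x hx
      obtain ⟨n, hn⟩ := exists_nat_ge (max (w x) (w x⁻¹))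
      exact Set.mem_iUnion.2 ⟨n, ⟨(le_max_left _ _).trans hn, (le_max_right _ _).trans hn⟩, hx⟩
  have hpos : 0 < μ K := Measure.measure_pos_of_mem_nhds μ hK1
  obtain ⟨n, hn⟩ : ∃ n, 0 < μ (E n) := by
    by_contra! h
    have : μ (⋃ n, E n) = 0 := measure_iUnion_null fun n => le_antisymm (h n) zero_le
    rw [hU] at this
    exact hpos.ne' this
  have hfin : μ (E n) ≠ ∞ :=
    ((measure_mono Set.inter_subset_right).trans_lt hK.measure_lt_top).ne
  refine ⟨E n / E n, Measure.div_mem_nhds_one_of_haar_pos_ne_top μ (E n) (hE n) hn hfin,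
    n * n, ?_⟩
  rintro x ⟨a, ha, b, hb, rfl⟩
  simp only [div_eq_mul_inv]
  exact (w.mul_le' _ _).trans (mul_le_mul' ha.1.1 hb.1.2)

theorem Weight.exists_bound {K : Set G} (hK : IsCompact K) : ∃ C : ℝ≥0, ∀ x ∈ K, w x ≤ C := by
  obtain ⟨U, hU, C, hC⟩ := w.exists_nhds_one_bound
  refine hK.induction_on (p := fun s => ∃ C : ℝ≥0, ∀ x ∈ s, w x ≤ C) ⟨0, by simp⟩ ?_ ?_ ?_
  · rintro s t hst ⟨C, h⟩
    exact ⟨C, fun x hx => h x (hst hx)⟩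
  · rintro s t ⟨C, h⟩ ⟨D, h'⟩
    refine ⟨max C D, ?_⟩
    rintro x (hx | hx)
    · exact (h x hx).trans (le_max_left _ _)
    · exact (h' x hx).trans (le_max_right _ _)
  · intro x _
    refine ⟨x • U, mem_nhdsWithin_of_mem_nhds ?_, w x * C, ?_⟩
    · simpa using smul_mem_nhds_smul x hU
    · rintro _ ⟨u, hu, rfl⟩
      exact (w.mul_le' _ _).trans (mul_le_mul_right (hC u hu) _)

instance : IsFiniteMeasureOnCompacts (wMeasure μ w) where
  lt_top_of_isCompact K hK := by
    obtain ⟨C, hC⟩ := w.exists_bound hK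
    rw [wMeasure, withDensity_apply _ hK.measurableSet]
    calc ∫⁻ x in K, (w x : ℝ≥0∞) ∂μ ≤ ∫⁻ x in K, (C : ℝ≥0∞) ∂μ :=
          setLIntegral_mono measurable_const fun x hx => by exact_mod_cast hC x hx
      _ = C * μ K := by simp
      _ < ∞ := ENNReal.mul_lt_top ENNReal.coe_lt_top hK.measure_lt_top

instance : (wMeasure μ w).InnerRegularCompactLTTop where
  innerRegular := by
    rintro A ⟨hA, hAfin⟩ r hr
    let B : ℕ → Set G := fun n => A ∩ {x | w x ≤ n ∧ (w x)⁻¹ ≤ n}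
    have hB : ∀ n, MeasurableSet (B n) := fun n => hA.inter
      ((measurableSet_le w.measurable' measurable_const).inter
        ((show Measurable fun x => (w x)⁻¹ from w.measurable'.inv)
          (measurableSet_Iic (a := (n : ℝ≥0)))))
    have hmono : Monotone B := fun m n hmn x hx =>
      ⟨hx.1, hx.2.1.trans (by exact_mod_cast hmn), hx.2.2.trans (by exact_mod_cast hmn)⟩
    have hU : ⋃ n, B n = A := by
      apply Set.Subset.antisymm
      · exact Set.iUnion_subset fun n => Set.inter_subset_left
      · intro x hx
        obtain ⟨n, hn⟩ := exists_nat_ge (max (w x) (w x)⁻¹)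
        exact Set.mem_iUnion.2 ⟨n, hx, (le_max_left _ _).trans hn, (le_max_right _ _).trans hn⟩
    have ht := tendsto_measure_iUnion_atTop (μ := wMeasure μ w) hmono
    rw [hU] at ht
    obtain ⟨n, hn⟩ := (ht.eventually (lt_mem_nhds hr)).exists
    have hBle : ∀ s ⊆ B n, MeasurableSet s → wMeasure μ w s ≤ n * μ s := by
      intro s hs hsm
      rw [wMeasure, withDensity_apply _ hsm]
      calc ∫⁻ x in s, (w x : ℝ≥0∞) ∂μ ≤ ∫⁻ x in s, (n : ℝ≥0∞) ∂μ :=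
            setLIntegral_mono measurable_const fun x hx => by exact_mod_cast (hs hx).2.1
        _ = n * μ s := by simp
    have hBge : μ (B n) ≤ n * wMeasure μ w (B n) := by
      rw [wMeasure, withDensity_apply _ (hB n), ← lintegral_const_mul _
        w.measurable'.coe_nnreal_ennreal]
      calc μ (B n) = ∫⁻ x in B n, 1 ∂μ := by simp
        _ ≤ _ := setLIntegral_mono (measurable_const.mul w.measurable'.coe_nnreal_ennreal)
          fun x hx => by
            have := hx.2.2
            have h1 : (1 : ℝ≥0) ≤ n * w x := by
              calc (1 : ℝ≥0) = (w x)⁻¹ * w x := (inv_mul_cancel₀ (w.pos' x).ne').symm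
                _ ≤ n * w x := mul_le_mul_left this _
            show (1 : ℝ≥0∞) ≤ (n : ℝ≥0∞) * (w x : ℝ≥0∞)
            exact_mod_cast h1
    have hfin : wMeasure μ w (B n) ≠ ∞ :=
      ((measure_mono Set.inter_subset_left).trans_lt hAfin.lt_top).ne
    have hfin' : μ (B n) ≠ ∞ :=
      (hBge.trans_lt (ENNReal.mul_lt_top (by simp) hfin.lt_top)).ne
    obtain ⟨δ, hδ, hδ'⟩ : ∃ δ : ℝ≥0∞, δ ≠ 0 ∧ r + n * δ ≤ wMeasure μ w (B n) := by
      refine ⟨(wMeasure μ w (B n) - r) / (n + 1), ?_, ?_⟩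
      · simp [ENNReal.div_eq_zero_iff, tsub_eq_zero_iff_le]
        exact hn
      · have : (n : ℝ≥0∞) * ((wMeasure μ w (B n) - r) / (n + 1)) ≤ wMeasure μ w (B n) - r := by
          rw [mul_comm, ENNReal.mul_comm_div, mul_comm]
          refine mul_le_of_le_one_left zero_le ?_
          exact ENNReal.div_le_of_le_mul (by simp)
        calc r + _ ≤ r + (wMeasure μ w (B n) - r) := by gcongr
          _ = _ := add_tsub_cancel_of_le hn.le
    obtain ⟨K, hKB, hK, hKd⟩ := (hB n).exists_isCompact_sdiff_lt hfin' hδ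
    refine ⟨K, hKB.trans Set.inter_subset_left, hK, ?_⟩
    by_contra! hcon
    have h1 : wMeasure μ w (B n) ≤ wMeasure μ w K + wMeasure μ w (B n \ K) := by
      rw [measure_add_sdiff hK.measurableSet.nullMeasurableSet]
      exact measure_mono Set.subset_union_right
    have h2 : wMeasure μ w (B n \ K) ≤ n * μ (B n \ K) :=
      hBle _ Set.sdiff_subset ((hB n).diff hK.measurableSet)
    rcases eq_or_ne n 0 with h0 | h0
    · subst h0
      simp only [Nat.cast_zero, zero_mul] at h2
      exact absurd (h1.trans (add_le_add hcon h2)) (by simpa using hn)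
    · have h3 : (n : ℝ≥0∞) * μ (B n \ K) < n * δ :=
        ENNReal.mul_lt_mul_right (by simpa using h0) (by simp) hKd
      have hrfin : r ≠ ∞ := hr.ne_top
      have := ENNReal.add_lt_add_of_le_of_lt (hcon.trans_lt hrfin.lt_top).ne hcon (h2.trans_lt h3)
      exact absurd (h1.trans_lt this) (not_lt.2 hδ')

end Measure
end Beurling

namespace Beurling
section Density

variable {G : Type*} [Group G] [TopologicalSpace G] [IsTopologicalGroup G] [T2Space G]
  [LocallyCompactSpace G] [MeasurableSpace G] [BorelSpace G]
  (μ : Measure G) [μ.IsHaarMeasure] [μ.Regular] (w : Weight G)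
  {E : Type*} [NormedAddCommGroup E] [NormedSpace ℝ E]

/-- Compactly supported continuous functions are dense in the weighted `L¹` space. -/
theorem exists_cc_approx {f : G → E} (hf : MemLp f 1 (wMeasure μ w)) {ε : ℝ≥0∞} (hε : ε ≠ 0) :
    ∃ g : G → E, eLpNorm (f - g) 1 (wMeasure μ w) ≤ ε ∧ Continuous g ∧ HasCompactSupport g := by
  refine hf.induction_dense (by simp) (fun g => Continuous g ∧ HasCompactSupport g) ?_ ?_ ?_ hε
  · intro c s hs hsfin ε hε
    obtain ⟨δ, hδ, hδε⟩ : ∃ δ : ℝ≥0∞, δ ≠ 0 ∧ ‖c‖ₑ * (δ + δ) ≤ ε := by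
      refine ⟨ε / (2 * (‖c‖ₑ + 1)), ?_, ?_⟩
      · have h1 : 2 * (‖c‖ₑ + 1) ≠ ∞ :=
          ENNReal.mul_ne_top (by simp) (by simp)
        simpa [ENNReal.div_eq_zero_iff, hε] using h1
      · rw [← two_mul, ← mul_assoc, mul_comm ‖c‖ₑ 2, ← mul_div_assoc, mul_comm, mul_div_assoc]
        refine mul_le_of_le_one_right zero_le (ENNReal.div_le_of_le_mul ?_)
        rw [one_mul]
        gcongr
        exact le_self_add
    obtain ⟨k, hks, hk, hkd⟩ := hs.exists_isCompact_sdiff_lt (μ := wMeasure μ w) hsfin.ne hδ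
    obtain ⟨V, hkV, hV, hVlt⟩ := hk.exists_isOpen_lt_add (μ := wMeasure μ w) hδ
    have hVd : wMeasure μ w (V \ k) ≤ δ := by
      rw [measure_sdiff hkV hk.measurableSet.nullMeasurableSet hk.measure_lt_top.ne]
      exact tsub_le_iff_left.2 hVlt.le
    obtain ⟨φ, h1, h0, hφs, hφ⟩ := exists_continuous_one_zero_of_isCompact hk
      hV.isClosed_compl (Set.disjoint_compl_right_iff_subset.2 hkV)
    refine ⟨fun x => φ x • c, ?_, φ.continuous.smul continuous_const, hφs.smul_right⟩
    rw [eLpNorm_one_eq_lintegral_enorm]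
    have hb : ∀ x, ‖((fun x => φ x • c) - s.indicator fun _ => c) x‖ₑ ≤
        (V \ k).indicator (fun _ => ‖c‖ₑ) x + (s \ k).indicator (fun _ => ‖c‖ₑ) x := by
      intro x
      have hle : ∀ t : ℝ, ‖t‖ ≤ 1 → ‖t • c‖ₑ ≤ ‖c‖ₑ := by
        intro t ht
        rw [enorm_smul]
        refine mul_le_of_le_one_left zero_le ?_
        rw [← ofReal_norm]
        exact ENNReal.ofReal_le_one.2 ht
      have hn1 : ‖φ x‖ ≤ 1 := by
        rw [Real.norm_eq_abs, abs_of_nonneg (hφ x).1]; exact (hφ x).2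
      by_cases hxk : x ∈ k
      · simp [hks hxk, h1 hxk]
      by_cases hxs : x ∈ s
      · have : φ x • c - c = (φ x - 1) • c := by rw [sub_smul, one_smul]
        simp only [Pi.sub_apply, Set.indicator_of_mem hxs, this,
          Set.indicator_of_mem (show x ∈ s \ k from ⟨hxs, hxk⟩)]
        refine (hle _ ?_).trans le_add_self
        rw [Real.norm_eq_abs, abs_le]
        constructor <;> linarith [(hφ x).1, (hφ x).2]
      by_cases hxV : x ∈ V
      · simp only [Pi.sub_apply, Set.indicator_of_notMem hxs, sub_zero,
          Set.indicator_of_mem (show x ∈ V \ k from ⟨hxV, hxk⟩)]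
        exact (hle _ hn1).trans le_self_add
      · have : φ x = 0 := h0 hxV
        simp [hxs, this]
    calc _ ≤ ∫⁻ x, ((V \ k).indicator (fun _ => ‖c‖ₑ) x + (s \ k).indicator (fun _ => ‖c‖ₑ) x)
          ∂(wMeasure μ w) := lintegral_mono hb
      _ = ‖c‖ₑ * wMeasure μ w (V \ k) + ‖c‖ₑ * wMeasure μ w (s \ k) := by
          have m1 := hV.measurableSet.diff hk.measurableSet
          have m2 := hs.diff hk.measurableSet
          rw [lintegral_add_left (measurable_const.indicator m1), lintegral_indicator m1,
            lintegral_indicator m2]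
          simp
      _ ≤ ‖c‖ₑ * (δ + δ) := by rw [← mul_add]; gcongr
      _ ≤ ε := hδε
  · rintro f g ⟨hf, hf'⟩ ⟨hg, hg'⟩
    exact ⟨hf.add hg, hf'.add hg'⟩
  · rintro f ⟨hf, hf'⟩
    exact (hf.stronglyMeasurable_of_hasCompactSupport hf').aestronglyMeasurable

/-- The inverse of a null set is locally null. -/
theorem inv_null_inter {N K : Set G} (hN : μ N = 0) (hK : IsCompact K) : μ.inv (N ∩ K) = 0 := by
  obtain ⟨g, hg1, -, hgs, hg01⟩ := exists_continuous_one_zero_of_isCompact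
    (isCompact_singleton (x := (1 : G))) isClosed_empty (Set.disjoint_empty _)
  have hg1 : g 1 = 1 := hg1 rfl
  have hg0 : 0 ≤ (g : G → ℝ) := fun x => (hg01 x).1
  let D : G → ℝ := fun y => ∫ z, g (z⁻¹ * y) ∂μ.inv
  have Dc : Continuous D := continuous_integral_apply_inv_mul g.continuous hgs
  have Dpos : ∀ y, 0 < D y := by
    intro x
    have C : Continuous (fun y ↦ g (y⁻¹ * x)) := by fun_prop
    apply (integral_pos_iff_support_of_nonneg _ _).2
    · apply C.isOpen_support.measure_pos μ.inv
      exact ⟨x, by simp [hg1]⟩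
    · exact fun y ↦ hg0 (y⁻¹ * x)
    · apply C.integrable_of_hasCompactSupport
      exact hgs.comp_homeomorph ((Homeomorph.inv G).trans (Homeomorph.mulRight x))
  let c : ℝ := ∫ x, g x ∂μ
  have hc : 0 < c := by
    apply (integral_pos_iff_support_of_nonneg hg0 _).2
    · exact g.continuous.isOpen_support.measure_pos μ ⟨1, by simp [hg1]⟩
    · exact g.continuous.integrable_of_hasCompactSupport hgs
  obtain ⟨L, hL, hKL⟩ := exists_compact_superset hK
  obtain ⟨M, hM⟩ : ∃ M, ∀ x ∈ L, D x ≤ M := by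
    obtain ⟨M, hM⟩ := hL.bddAbove_image Dc.continuousOn
    exact ⟨M, fun x hx => hM ⟨x, hx, rfl⟩⟩
  have key : ∀ U : Set G, IsOpen U → U ⊆ L → μ.inv U ≤ ENNReal.ofReal (|M| / c) * μ U := by
    intro U hU hUL
    rw [hU.measure_eq_iSup_isCompact]
    refine iSup₂_le fun k hkU => iSup_le fun hk => ?_
    obtain ⟨φ, h1, h0, hφs, hφ⟩ := exists_continuous_one_zero_of_isCompact hk
      hU.isClosed_compl (Set.disjoint_compl_right_iff_subset.2 hkU)
    have hUfin : μ U ≠ ∞ := ((measure_mono hUL).trans_lt hL.measure_lt_top).ne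
    have hcombo := Measure.integral_isMulLeftInvariant_isMulRightInvariant_combo
      (μ := μ) (ν := μ.inv) φ.continuous hφs g.continuous hgs hg0 (x₀ := 1) (by simp [hg1])
    have I1 : μ.inv.real k ≤ ∫ x, φ x ∂μ.inv := by
      rw [← integral_indicator_one hk.measurableSet]
      refine integral_mono_of_nonneg (Eventually.of_forall fun x => ?_)
        (φ.continuous.integrable_of_hasCompactSupport hφs) (Eventually.of_forall fun x => ?_)
      · exact Set.indicator_nonneg (fun _ _ => zero_le_one) x
      · by_cases hx : x ∈ k
        · simp [hx, h1 hx]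
        · simpa [hx] using (hφ x).1
    have I2 : ∫ x, φ x ∂μ.inv ≤ ∫ x, |M| * (φ x * (D x)⁻¹) ∂μ.inv := by
      refine integral_mono_of_nonneg (Eventually.of_forall fun x => (hφ x).1) ?_
        (Eventually.of_forall fun x => ?_)
      · refine Continuous.integrable_of_hasCompactSupport ?_ ?_
        · exact continuous_const.mul (φ.continuous.mul (Dc.inv₀ fun x => (Dpos x).ne'))
        · exact (hφs.mul_right).mul_left
      · by_cases hx : x ∈ U
        · have hDM : D x ≤ |M| := (hM x (hUL hx)).trans (le_abs_self M)
          have : 1 ≤ |M| * (D x)⁻¹ := by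
            rw [← div_eq_mul_inv, one_le_div (Dpos x)]; exact hDM
          calc φ x = φ x * 1 := (mul_one _).symm
            _ ≤ φ x * (|M| * (D x)⁻¹) := mul_le_mul_of_nonneg_left this (hφ x).1
            _ = _ := by ring
        · have : φ x = 0 := h0 hx
          simp [this]
    have I3 : ∫ x, φ x ∂μ ≤ μ.real U := by
      rw [← integral_indicator_one hU.measurableSet]
      refine integral_mono_of_nonneg (Eventually.of_forall fun x => (hφ x).1)
        ((integrable_indicator_iff hU.measurableSet).2 
          (show IntegrableOn (fun _ => (1 : ℝ)) U μ from integrableOn_const hUfin))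
        (Eventually.of_forall fun x => ?_)
      by_cases hx : x ∈ U
      · simpa [hx] using (hφ x).2
      · have : φ x = 0 := h0 hx
        simp [this, hx]
    have I4 : ∫ x, φ x * (D x)⁻¹ ∂μ.inv = (∫ x, φ x ∂μ) / c := by
      rw [hcombo, mul_div_assoc, div_self hc.ne', mul_one]
    rw [integral_const_mul, I4] at I2
    have I5 : μ.inv.real k ≤ |M| / c * μ.real U := by
      refine I1.trans (I2.trans ?_)
      rw [mul_div_assoc', div_mul_eq_mul_div]
      gcongr
    rw [← ENNReal.ofReal_toReal hUfin, ← ENNReal.ofReal_mul (by positivity),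
      ← ENNReal.ofReal_toReal (a := μ.inv k) hk.measure_lt_top.ne]
    exact ENNReal.ofReal_le_ofReal I5
  refine le_antisymm (ENNReal.le_of_forall_pos_le_add fun ε hε _ => ?_) zero_le
  obtain ⟨δ, hδ, hδε⟩ : ∃ δ : ℝ≥0∞, δ ≠ 0 ∧ ENNReal.ofReal (|M| / c) * δ ≤ ε := by
    refine ⟨ε / (ENNReal.ofReal (|M| / c) + 1), ?_, ?_⟩
    · simp [ENNReal.div_eq_zero_iff, hε.ne']
    · rw [← mul_div_assoc, mul_comm, mul_div_assoc]
      refine mul_le_of_le_one_right zero_le (ENNReal.div_le_of_le_mul ?_)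
      rw [one_mul]
      exact le_self_add
  obtain ⟨U, hNU, hU, hUlt⟩ := Set.exists_isOpen_lt_of_lt (μ := μ) N δ
    (by rw [hN]; exact pos_iff_ne_zero.2 hδ)
  calc μ.inv (N ∩ K) ≤ μ.inv (U ∩ interior L) := measure_mono (Set.inter_subset_inter hNU hKL)
    _ ≤ ENNReal.ofReal (|M| / c) * μ (U ∩ interior L) :=
        key _ (hU.inter isOpen_interior) (Set.inter_subset_right.trans interior_subset)
    _ ≤ ENNReal.ofReal (|M| / c) * δ := by
        gcongr
        exact (measure_mono Set.inter_subset_left).trans hUlt.le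
    _ ≤ ε := hδε
    _ ≤ 0 + ε := by simp

theorem ae_inv_mul_notMem {N K : Set G} (hN : μ N = 0) (hK : IsCompact K) (x : G) :
    ∀ᵐ y ∂μ, y ∈ K → y⁻¹ * x ∉ N := by
  have h := inv_null_inter μ hN ((hK.smul x⁻¹).inv)
  rw [Measure.inv_apply] at h
  rw [← measure_preimage_mul μ x⁻¹] at h
  refine measure_mono_null ?_ h
  intro y hy
  simp only [Set.mem_compl_iff, Set.mem_ofPred_eq, not_forall, not_not] at hy
  obtain ⟨hy1, hy2⟩ := hy
  simp only [Set.mem_preimage, Set.mem_inv, Set.mem_inter_iff, inv_inv, mul_inv_rev]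
  exact ⟨hy2, y, hy1, rfl⟩

end Density
end Beurling

namespace Beurling
section Conv

variable {G : Type*} [Group G] [TopologicalSpace G] [IsTopologicalGroup G] [T2Space G]
  [LocallyCompactSpace G] [MeasurableSpace G] [BorelSpace G]
  (μ : Measure G) [μ.IsHaarMeasure] [μ.Regular] (w : Weight G)
  {A : Type*} [NonUnitalNormedRing A] [NormedSpace ℂ A] [IsScalarTower ℂ A A]
  [SMulCommClass ℂ A A]

/-- Convolution, `(f * g)(x) = ∫ f(x y) g(y⁻¹) dy`. -/
noncomputable def conv {G : Type*} [Group G] [MeasurableSpace G] (μ : Measure G)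
    {A : Type*} [NonUnitalNormedRing A] [NormedSpace ℂ A] (f g : G → A) (x : G) : A :=
  ∫ y, f (x * y) * g y⁻¹ ∂μ

theorem conv_eq (f g : G → A) (x : G) : conv μ f g x = ∫ y, f y * g (y⁻¹ * x) ∂μ := by
  rw [conv, ← integral_mul_left_eq_self (fun y => f y * g (y⁻¹ * x)) x]
  simp [mul_assoc]

/-- The integral of the norms in a convolution. -/
noncomputable def convI {G : Type*} [Group G] [MeasurableSpace G] (μ : Measure G)
    {A : Type*} [NonUnitalNormedRing A] (f g : G → A) (x : G) : ℝ≥0∞ :=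
  ∫⁻ y, ‖f y‖ₑ * ‖g (y⁻¹ * x)‖ₑ ∂μ

theorem enorm_mul_le' (a b : A) : ‖a * b‖ₑ ≤ ‖a‖ₑ * ‖b‖ₑ := by
  rw [← ofReal_norm, ← ofReal_norm, ← ofReal_norm, ← ENNReal.ofReal_mul (norm_nonneg _)]
  exact ENNReal.ofReal_le_ofReal (norm_mul_le a b)

theorem enorm_conv_le (f g : G → A) (x : G) : ‖conv μ f g x‖ₑ ≤ convI μ f g x := by
  rw [conv_eq]
  exact (enorm_integral_le_lintegral_enorm _).trans
    (lintegral_mono fun y => enorm_mul_le' _ _)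

theorem hasCompactSupport_aux {B : Type*} [Zero B] {f g : G → A} (hf : HasCompactSupport f)
    (hg : HasCompactSupport g) (F : G × G → B)
    (hF : ∀ x y, f y = 0 ∨ g (y⁻¹ * x) = 0 → F (x, y) = 0) : HasCompactSupport F := by
  refine HasCompactSupport.intro (K := (tsupport f * tsupport g) ×ˢ tsupport f)
    ((hf.isCompact.mul hg.isCompact).prod hf.isCompact) ?_
  rintro ⟨x, y⟩ hxy
  apply hF
  by_contra! h
  refine hxy ⟨⟨y, subset_tsupport _ h.1, y⁻¹ * x, subset_tsupport _ h.2, by simp⟩,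
    subset_tsupport _ h.1⟩

theorem convI_cc {f g : G → A} (hf : Continuous f) (hf' : HasCompactSupport f)
    (hg : Continuous g) (hg' : HasCompactSupport g) :
    Measurable (convI μ f g) ∧ ∫⁻ x, convI μ f g x ∂(wMeasure μ w) ≤
      eLpNorm f 1 (wMeasure μ w) * eLpNorm g 1 (wMeasure μ w) := by
  set ν := wMeasure μ w with hν
  let F : G × G → ℝ≥0∞ := fun p => ‖f p.2‖ₑ * ‖g (p.2⁻¹ * p.1)‖ₑ
  let F' : G × G → ℝ := fun p => ‖f p.2‖ * ‖g (p.2⁻¹ * p.1)‖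
  have hF' : Continuous F' := by fun_prop
  have hFs : HasCompactSupport F' := hasCompactSupport_aux hf' hg' F' (by
    rintro x y (h | h) <;> simp [F', h])
  have hFm' : Measurable F' := hFs.measurable_of_prod hF'
  have hFF : F = fun p => ENNReal.ofReal (F' p) := by
    funext p
    simp only [F, F']
    rw [ENNReal.ofReal_mul (norm_nonneg _), ofReal_norm, ofReal_norm]
  have hFm : Measurable F := by rw [hFF]; exact hFm'.ennreal_ofReal
  let K := tsupport f
  let L := tsupport f * tsupport g
  have hK : IsCompact K := hf'
  have hL : IsCompact L := hf'.isCompact.mul hg'.isCompact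
  have : IsFiniteMeasure (μ.restrict K) := ⟨by simpa using hK.measure_lt_top⟩
  have : IsFiniteMeasure (ν.restrict L) := ⟨by simpa using hL.measure_lt_top⟩
  have hI : ∀ x, convI μ f g x = ∫⁻ y in K, F (x, y) ∂μ := by
    intro x
    rw [setLIntegral_eq_of_support_subset]
    · rfl
    · intro y hy
      refine subset_tsupport _ (fun h => hy ?_)
      simp [F, h]
  have hIm : Measurable (convI μ f g) := by
    rw [show convI μ f g = fun x => ∫⁻ y in K, F (x, y) ∂μ from funext hI]
    exact hFm.lintegral_prod_right'
  refine ⟨hIm, ?_⟩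
  have hinner : ∀ y, ∫⁻ x, F (x, y) ∂ν ≤ w y * ‖f y‖ₑ * eLpNorm g 1 ν := by
    intro y
    simp only [F]
    rw [lintegral_const_mul' _ _ enorm_ne_top, mul_comm (w y : ℝ≥0∞), mul_assoc]
    gcongr
    rw [hν, lintegral_wMeasure, ← lintegral_mul_left_eq_self _ y, eLpNorm_one_eq_lintegral_enorm,
      lintegral_wMeasure, ← lintegral_const_mul' _ _ ENNReal.coe_ne_top]
    refine lintegral_mono fun x => ?_
    simp only [inv_mul_cancel_left]
    rw [← mul_assoc]
    gcongr
    exact_mod_cast w.mul_le' y x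
  calc ∫⁻ x, convI μ f g x ∂ν = ∫⁻ x in L, convI μ f g x ∂ν := by
        rw [setLIntegral_eq_of_support_subset]
        intro x hx
        by_contra hxL
        apply hx
        rw [convI, lintegral_eq_zero_iff']
        · refine Eventually.of_forall fun y => ?_
          by_contra h
          simp only [Pi.zero_apply, mul_eq_zero, not_or, enorm_eq_zero] at h
          exact hxL ⟨y, subset_tsupport _ h.1, y⁻¹ * x, subset_tsupport _ h.2, by simp⟩
        · exact (show Continuous fun y => ‖f y‖ₑ * ‖g (y⁻¹ * x)‖ₑ by
            have : (fun y => ‖f y‖ₑ * ‖g (y⁻¹ * x)‖ₑ) = fun y => ENNReal.ofReal (F' (x, y)) := by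
              funext y; exact congrFun hFF (x, y)
            rw [this]
            exact ENNReal.continuous_ofReal.comp (hF'.comp (by fun_prop))).measurable.aemeasurable
    _ = ∫⁻ x in L, ∫⁻ y in K, F (x, y) ∂μ ∂ν := by simp_rw [hI]
    _ = ∫⁻ y in K, ∫⁻ x in L, F (x, y) ∂ν ∂μ :=
        lintegral_lintegral_swap hFm.aemeasurable
    _ ≤ ∫⁻ y in K, w y * ‖f y‖ₑ * eLpNorm g 1 ν ∂μ :=
        lintegral_mono fun y => (setLIntegral_le_lintegral _ _).trans (hinner y)
    _ ≤ ∫⁻ y, w y * ‖f y‖ₑ * eLpNorm g 1 ν ∂μ := setLIntegral_le_lintegral _ _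
    _ = eLpNorm f 1 ν * eLpNorm g 1 ν := by
        have hne : eLpNorm g 1 ν ≠ ∞ :=
          (hg.memLp_of_hasCompactSupport (μ := ν) (p := 1) hg').eLpNorm_ne_top
        rw [lintegral_mul_const' _ _ hne, eLpNorm_one_eq_lintegral_enorm (f := f), hν,
          lintegral_wMeasure μ w (fun x => ‖f x‖ₑ)]

/-- Pointwise approximation by compactly supported continuous functions. -/
theorem exists_cc_seq {f : G → A} (hf : MemLp f 1 (wMeasure μ w)) {ε : ℝ≥0} (hε : 0 < ε) :
    ∃ ψ : ℕ → G → A, (∀ n, Continuous (ψ n)) ∧ (∀ n, HasCompactSupport (ψ n)) ∧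
      (∀ n, eLpNorm (f - ψ n) 1 (wMeasure μ w) ≤ ε * 2⁻¹ ^ n) ∧
      (∀ᵐ x ∂μ, Tendsto (fun n => ψ n x) atTop (𝓝 (f x))) := by
  have hpos : ∀ n : ℕ, (ε : ℝ≥0∞) * 2⁻¹ ^ n ≠ 0 := fun n =>
    mul_ne_zero (by exact_mod_cast hε.ne') (pow_ne_zero _ (by simp))
  choose ψ h1 h2 h3 using fun n : ℕ => exists_cc_approx μ w hf (hpos n)
  have ht0 : Tendsto (fun n : ℕ => (ε : ℝ≥0∞) * 2⁻¹ ^ n) atTop (𝓝 0) := by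
    have := ENNReal.Tendsto.const_mul (a := (ε : ℝ≥0∞))
      (ENNReal.tendsto_pow_atTop_nhds_zero_of_lt_one (r := 2⁻¹) (by simp))
      (Or.inr ENNReal.coe_ne_top)
    simpa using this
  have ht : Tendsto (fun n => eLpNorm (ψ n - f) 1 (wMeasure μ w)) atTop (𝓝 0) := by
    refine tendsto_of_tendsto_of_tendsto_of_le_of_le tendsto_const_nhds ht0
      (fun n => zero_le) (fun n => ?_)
    rw [eLpNorm_sub_comm]
    exact h1 n
  obtain ⟨ns, hns, hae⟩ := (tendstoInMeasure_of_tendsto_eLpNorm one_ne_zero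
    (fun n => ((h2 n).stronglyMeasurable_of_hasCompactSupport (h3 n)).aestronglyMeasurable)
    hf.aestronglyMeasurable ht).exists_seq_tendsto_ae
  refine ⟨fun n => ψ (ns n), fun n => h2 _, fun n => h3 _, fun n => (h1 _).trans ?_,
    (ac_wMeasure μ w).ae_le hae⟩
  exact mul_le_mul_right
    (pow_le_pow_right_of_le_one' (show (2⁻¹ : ℝ≥0∞) ≤ 1 by simp) (hns.id_le n)) _

/-- A dominating series of compactly supported continuous functions. -/
theorem exists_cc_series {f : G → A} (hf : MemLp f 1 (wMeasure μ w)) {ε : ℝ≥0} (hε : 0 < ε) :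
    ∃ φ : ℕ → G → A, (∀ n, Continuous (φ n)) ∧ (∀ n, HasCompactSupport (φ n)) ∧
      (∑' n, eLpNorm (φ n) 1 (wMeasure μ w) ≤ eLpNorm f 1 (wMeasure μ w) + ε) ∧
      (∀ᵐ x ∂μ, ‖f x‖ₑ ≤ ∑' n, ‖φ n x‖ₑ) := by
  obtain ⟨ψ, hc, hs, hn, ht⟩ := exists_cc_seq μ w hf (ε := ε / 8) (by positivity)
  have hψ : ∀ n, AEStronglyMeasurable (ψ n) (wMeasure μ w) := fun n =>
    ((hc n).stronglyMeasurable_of_hasCompactSupport (hs n)).aestronglyMeasurable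
  have hfm := hf.aestronglyMeasurable
  let φ : ℕ → G → A := fun n => Nat.casesOn n (ψ 0) (fun n => ψ (n + 1) - ψ n)
  have hsum : ∀ n, ∑ i ∈ Finset.range (n + 1), φ i = ψ n := by
    intro n
    rw [Finset.sum_range_succ']
    simp only [φ]
    rw [Finset.sum_range_sub ψ]
    simp
  refine ⟨φ, ?_, ?_, ?_, ?_⟩
  · rintro (_ | n)
    · exact hc 0
    · exact (hc (n + 1)).sub (hc n)
  · rintro (_ | n)
    · exact hs 0
    · exact (hs (n + 1)).sub (hs n)
  · have e0 : eLpNorm (φ 0) 1 (wMeasure μ w) ≤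
        eLpNorm f 1 (wMeasure μ w) + (ε / 8 : ℝ≥0) := by
      have : φ 0 = f - (f - ψ 0) := by simp [φ]
      rw [this]
      refine (eLpNorm_sub_le hfm (hfm.sub (hψ 0)) le_rfl).trans ?_
      gcongr
      simpa using hn 0
    have e1 : ∀ n, eLpNorm (φ (n + 1)) 1 (wMeasure μ w) ≤ (ε / 4 : ℝ≥0) * 2⁻¹ ^ n := by
      intro n
      have : φ (n + 1) = (f - ψ n) - (f - ψ (n + 1)) := by simp [φ]
      rw [this]
      refine (eLpNorm_sub_le (hfm.sub (hψ _)) (hfm.sub (hψ _)) le_rfl).trans ?_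
      refine (add_le_add (hn n) (hn (n + 1))).trans ?_
      have h2 : (2⁻¹ : ℝ≥0∞) ^ (n + 1) ≤ 2⁻¹ ^ n :=
        pow_le_pow_right_of_le_one' (show (2⁻¹ : ℝ≥0∞) ≤ 1 by simp) (Nat.le_succ n)
      calc _ ≤ ((ε / 8 : ℝ≥0) : ℝ≥0∞) * 2⁻¹ ^ n + (ε / 8 : ℝ≥0) * 2⁻¹ ^ n := by gcongr
        _ = _ := by
          rw [← add_mul, ← ENNReal.coe_add]
          congr 2
          rw [← NNReal.coe_inj]; push_cast; ring
    rw [tsum_eq_zero_add' ENNReal.summable]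
    calc _ ≤ (eLpNorm f 1 (wMeasure μ w) + (ε / 8 : ℝ≥0)) + ∑' n : ℕ, ((ε / 4 : ℝ≥0) : ℝ≥0∞) * 2⁻¹ ^ n :=
          add_le_add e0 (ENNReal.tsum_le_tsum e1)
      _ = eLpNorm f 1 (wMeasure μ w) + (((ε / 8 : ℝ≥0) : ℝ≥0∞) + ((ε / 4 * 2 : ℝ≥0) : ℝ≥0∞)) := by
          rw [ENNReal.tsum_mul_left, ENNReal.tsum_geometric, ENNReal.one_sub_inv_two, inv_inv,
            add_assoc]
          rw [ENNReal.coe_mul]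
          rfl
      _ ≤ _ := by
          rw [← ENNReal.coe_add]
          gcongr
          rw [← NNReal.coe_le_coe]
          push_cast
          have : (0 : ℝ) ≤ ε := ε.2
          linarith
  · filter_upwards [ht] with x hx
    refine le_of_tendsto hx.enorm (Eventually.of_forall fun n => ?_)
    rw [← hsum n, Finset.sum_apply]
    exact (enorm_sum_le _ _).trans (ENNReal.sum_le_tsum _)

end Conv
end Beurling

namespace Beurling
section Conv2

variable {G : Type*} [Group G] [TopologicalSpace G] [IsTopologicalGroup G] [T2Space G]
  [LocallyCompactSpace G] [MeasurableSpace G] [BorelSpace G]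
  (μ : Measure G) [μ.IsHaarMeasure] [μ.Regular] (w : Weight G)
  {A : Type*} [NonUnitalNormedRing A] [NormedSpace ℂ A] [IsScalarTower ℂ A A]
  [SMulCommClass ℂ A A]

theorem ae_ae_comp {φ : ℕ → G → A} (hφ : ∀ n, HasCompactSupport (φ n)) {p : G → Prop}
    (hp : ∀ᵐ x ∂μ, p x) (x : G) :
    ∀ᵐ y ∂μ, (∀ n, φ n y = 0) ∨ p (y⁻¹ * x) := by
  have h : ∀ n, ∀ᵐ y ∂μ, y ∈ tsupport (φ n) → y⁻¹ * x ∉ {z | ¬ p z} :=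
    fun n => ae_inv_mul_notMem μ hp (hφ n) x
  filter_upwards [ae_all_iff.2 h] with y hy
  by_cases h0 : ∀ n, φ n y = 0
  · exact Or.inl h0
  · right
    push Not at h0
    obtain ⟨n, hn⟩ := h0
    have := hy n (subset_tsupport _ hn)
    simpa using this

theorem exists_convI_le {f g : G → A} (hf : MemLp f 1 (wMeasure μ w))
    (hg : MemLp g 1 (wMeasure μ w)) {ε : ℝ≥0} (hε : 0 < ε) :
    ∃ J : G → ℝ≥0∞, Measurable J ∧ (∀ x, convI μ f g x ≤ J x) ∧
      ∫⁻ x, J x ∂(wMeasure μ w) ≤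
        (eLpNorm f 1 (wMeasure μ w) + ε) * (eLpNorm g 1 (wMeasure μ w) + ε) := by
  obtain ⟨φ, φc, φs, φn, hφ⟩ := exists_cc_series μ w hf hε
  obtain ⟨γ, γc, γs, γn, hγ⟩ := exists_cc_series μ w hg hε
  refine ⟨fun x => ∑' n, ∑' m, convI μ (φ n) (γ m) x, ?_, ?_, ?_⟩
  · exact Measurable.tsum fun n => Measurable.tsum fun m =>
      (convI_cc μ w (φc n) (φs n) (γc m) (γs m)).1
  · intro x
    have hm : ∀ n m, Measurable fun y => ‖φ n y‖ₑ * ‖γ m (y⁻¹ * x)‖ₑ := fun n m =>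
      (φc n).enorm.measurable.mul ((γc m).comp (by fun_prop)).enorm.measurable
    calc convI μ f g x ≤ ∫⁻ y, ∑' n, ∑' m, ‖φ n y‖ₑ * ‖γ m (y⁻¹ * x)‖ₑ ∂μ := by
          refine lintegral_mono_ae ?_
          filter_upwards [hφ, ae_ae_comp μ φs hγ x] with y hy1 hy2
          simp_rw [ENNReal.tsum_mul_left, ENNReal.tsum_mul_right]
          rcases hy2 with h0 | h
          · have : ‖f y‖ₑ = 0 := le_antisymm (hy1.trans (by simp [h0])) zero_le
            simp [this]
          · exact mul_le_mul' hy1 h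
      _ = ∑' n, ∑' m, convI μ (φ n) (γ m) x := by
          rw [lintegral_tsum fun n => (Measurable.tsum fun m => hm n m).aemeasurable]
          congr with n
          rw [lintegral_tsum fun m => (hm n m).aemeasurable]
          rfl
  · rw [lintegral_tsum fun n => (Measurable.tsum fun m =>
      (convI_cc μ w (φc n) (φs n) (γc m) (γs m)).1).aemeasurable]
    calc _ ≤ ∑' n, ∑' m, eLpNorm (φ n) 1 (wMeasure μ w) * eLpNorm (γ m) 1 (wMeasure μ w) := by
          refine ENNReal.tsum_le_tsum fun n => ?_
          rw [lintegral_tsum fun m => (convI_cc μ w (φc n) (φs n) (γc m) (γs m)).1.aemeasurable]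
          exact ENNReal.tsum_le_tsum fun m => (convI_cc μ w (φc n) (φs n) (γc m) (γs m)).2
      _ = (∑' n, eLpNorm (φ n) 1 (wMeasure μ w)) * ∑' m, eLpNorm (γ m) 1 (wMeasure μ w) := by
          simp_rw [ENNReal.tsum_mul_left, ENNReal.tsum_mul_right]
      _ ≤ _ := mul_le_mul' φn γn

/-- For almost every `x` the integral defining `(f * g)(x)` converges absolutely. -/
theorem ae_integrable_conv {f g : G → A} (hf : MemLp f 1 (wMeasure μ w))
    (hg : MemLp g 1 (wMeasure μ w)) :
    ∀ᵐ x ∂μ, Integrable (fun y => f y * g (y⁻¹ * x)) μ := by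
  obtain ⟨φ, φc, φs, -, hφ⟩ := exists_cc_seq μ w hf one_pos
  obtain ⟨γ, γc, γs, -, hγ⟩ := exists_cc_seq μ w hg one_pos
  obtain ⟨J, hJm, hJ, hJi⟩ := exists_convI_le μ w hf hg one_pos
  have hfin : ∀ᵐ x ∂(wMeasure μ w), J x < ∞ := by
    refine ae_lt_top hJm (hJi.trans_lt ?_).ne
    exact ENNReal.mul_lt_top (ENNReal.add_lt_top.2 ⟨hf.eLpNorm_lt_top, by simp⟩)
      (ENNReal.add_lt_top.2 ⟨hg.eLpNorm_lt_top, by simp⟩)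
  filter_upwards [(ac_wMeasure μ w).ae_le hfin] with x hx
  refine ⟨?_, ?_⟩
  · refine aestronglyMeasurable_of_tendsto_ae atTop
      (f := fun n y => φ n y * γ n (y⁻¹ * x)) (fun n => ?_) ?_
    · refine (Continuous.stronglyMeasurable_of_hasCompactSupport ?_ ?_).aestronglyMeasurable
      · exact (φc n).mul ((γc n).comp (by fun_prop))
      · exact (φs n).mul_right
    · filter_upwards [hφ, ae_ae_comp μ φs hγ x] with y hy1 hy2
      rcases hy2 with h0 | h
      · have : f y = 0 := tendsto_nhds_unique hy1 (by simp [h0])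
        simp [h0, this]
      · exact hy1.mul h
  · refine lt_of_le_of_lt (lintegral_mono fun y => enorm_mul_le' _ _) ((hJ x).trans_lt hx)

theorem ae_integrable_conv' {f g : G → A} (hf : MemLp f 1 (wMeasure μ w))
    (hg : MemLp g 1 (wMeasure μ w)) :
    ∀ᵐ x ∂μ, Integrable (fun y => f (x * y) * g y⁻¹) μ := by
  filter_upwards [ae_integrable_conv μ w hf hg] with x hx
  simpa using hx.comp_mul_left x

theorem conv_add_ae {f g h : G → A} (hf : MemLp f 1 (wMeasure μ w))
    (hg : MemLp g 1 (wMeasure μ w)) (hh : MemLp h 1 (wMeasure μ w)) :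
    conv μ f (g + h) =ᵐ[μ] conv μ f g + conv μ f h := by
  filter_upwards [ae_integrable_conv' μ w hf hg, ae_integrable_conv' μ w hf hh] with x h1 h2
  simp only [conv, Pi.add_apply, mul_add]
  exact integral_add h1 h2

theorem add_conv_ae {f g h : G → A} (hf : MemLp f 1 (wMeasure μ w))
    (hg : MemLp g 1 (wMeasure μ w)) (hh : MemLp h 1 (wMeasure μ w)) :
    conv μ (f + g) h =ᵐ[μ] conv μ f h + conv μ g h := by
  filter_upwards [ae_integrable_conv' μ w hf hh, ae_integrable_conv' μ w hg hh] with x h1 h2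
  simp only [conv, Pi.add_apply, add_mul]
  exact integral_add h1 h2

theorem smul_conv (c : ℂ) (f g : G → A) : conv μ (c • f) g = c • conv μ f g := by
  funext x
  simp only [conv, Pi.smul_apply, smul_mul_assoc]
  exact integral_smul c _

theorem conv_smul (c : ℂ) (f g : G → A) : conv μ f (c • g) = c • conv μ f g := by
  funext x
  simp only [conv, Pi.smul_apply, mul_smul_comm]
  exact integral_smul c _

theorem continuous_conv {f g : G → A} (hf : Continuous f) (hf' : HasCompactSupport f)
    (hg : Continuous g) (hg' : HasCompactSupport g) :
    Continuous (conv μ f g) ∧ HasCompactSupport (conv μ f g) := by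
  have he : conv μ f g = fun x => ∫ y, f y * g (y⁻¹ * x) ∂μ := funext (conv_eq μ f g)
  constructor
  · rw [he, ← continuousOn_univ]
    refine continuousOn_integral_of_compact_support hf'.isCompact
      (f := fun x y => f y * g (y⁻¹ * x)) ?_ ?_
    · refine Continuous.continuousOn ?_
      simp only [Function.uncurry_def]
      fun_prop
    · intro x y _ hy
      simp [image_eq_zero_of_notMem_tsupport hy]
  · refine HasCompactSupport.intro (hf'.isCompact.mul hg'.isCompact) fun x hx => ?_
    rw [conv_eq]
    refine integral_eq_zero_of_ae (Eventually.of_forall fun y => ?_)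
    by_contra h
    refine hx ⟨y, subset_tsupport _ (left_ne_zero_of_mul h), y⁻¹ * x,
      subset_tsupport _ (right_ne_zero_of_mul h), by simp⟩

/-- The difference of two convolutions. -/
theorem ae_enorm_conv_sub_le {f g f' g' : G → A} (hf : MemLp f 1 (wMeasure μ w))
    (hg : MemLp g 1 (wMeasure μ w)) (hf' : MemLp f' 1 (wMeasure μ w))
    (hg' : MemLp g' 1 (wMeasure μ w)) {ε : ℝ≥0} (hε : 0 < ε) :
    ∃ J : G → ℝ≥0∞, Measurable J ∧ (∀ᵐ x ∂μ, ‖conv μ f g x - conv μ f' g' x‖ₑ ≤ J x) ∧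
      ∫⁻ x, J x ∂(wMeasure μ w) ≤
        (eLpNorm (f - f') 1 (wMeasure μ w) + ε) * (eLpNorm g 1 (wMeasure μ w) + ε) +
        (eLpNorm f' 1 (wMeasure μ w) + ε) * (eLpNorm (g - g') 1 (wMeasure μ w) + ε) := by
  obtain ⟨J1, m1, h1, i1⟩ := exists_convI_le μ w (hf.sub hf') hg hε
  obtain ⟨J2, m2, h2, i2⟩ := exists_convI_le μ w hf' (hg.sub hg') hε
  refine ⟨J1 + J2, m1.add m2, ?_, ?_⟩
  · filter_upwards [add_conv_ae μ w (hf.sub hf') hf' hg, conv_add_ae μ w hf' (hg.sub hg') hg']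
      with x hx1 hx2
    rw [sub_add_cancel] at hx1 hx2
    have : conv μ f g x - conv μ f' g' x = conv μ (f - f') g x + conv μ f' (g - g') x := by
      rw [hx1, Pi.add_apply]
      have := hx2
      rw [Pi.add_apply] at this
      rw [this]
      abel
    rw [this]
    exact (enorm_add_le _ _).trans (add_le_add ((enorm_conv_le μ _ _ x).trans (h1 x))
      ((enorm_conv_le μ _ _ x).trans (h2 x)))
  · simp only [Pi.add_apply]
    rw [lintegral_add_left m1]
    exact add_le_add i1 i2

theorem conv_congr_ae {f g f' g' : G → A} (hf : MemLp f 1 (wMeasure μ w))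
    (hg : MemLp g 1 (wMeasure μ w)) (hff : f =ᵐ[μ] f') (hgg : g =ᵐ[μ] g') :
    conv μ f g =ᵐ[μ] conv μ f' g' := by
  have hff' := (wMeasure_ac μ w).ae_le hff
  have hgg' := (wMeasure_ac μ w).ae_le hgg
  have hf' : MemLp f' 1 (wMeasure μ w) := hf.ae_eq hff'
  have hg' : MemLp g' 1 (wMeasure μ w) := hg.ae_eq hgg'
  obtain ⟨φ, φc, φs, -, hφ⟩ := exists_cc_seq μ w hf one_pos
  filter_upwards [] with x
  rw [conv_eq, conv_eq]
  refine integral_congr_ae ?_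
  filter_upwards [hφ, hff, ae_ae_comp μ φs hgg x] with y h1 h2 h3
  rcases h3 with h0 | h
  · have : f y = 0 := tendsto_nhds_unique h1 (by simp [h0])
    simp [← h2, this]
  · rw [h2, h]

theorem aestronglyMeasurable_conv {f g : G → A} (hf : MemLp f 1 (wMeasure μ w))
    (hg : MemLp g 1 (wMeasure μ w)) : AEStronglyMeasurable (conv μ f g) (wMeasure μ w) := by
  set ν := wMeasure μ w with hν
  obtain ⟨φ, φc, φs, hφ, -⟩ := exists_cc_seq μ w hf one_pos
  obtain ⟨γ, γc, γs, hγ, -⟩ := exists_cc_seq μ w hg one_pos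
  rw [← hν] at hφ hγ
  have φm : ∀ n, MemLp (φ n) 1 ν := fun n => (φc n).memLp_of_hasCompactSupport (φs n)
  have γm : ∀ n, MemLp (γ n) 1 ν := fun n => (γc n).memLp_of_hasCompactSupport (γs n)
  choose J Jm Jle Ji using fun n : ℕ => ae_enorm_conv_sub_le μ w hf hg (φm n) (γm n)
    (ε := 2⁻¹ ^ n) (by positivity)
  have hc : ∀ n : ℕ, (((2⁻¹ : ℝ≥0) ^ n : ℝ≥0) : ℝ≥0∞) = 2⁻¹ ^ n := by
    intro n
    rw [ENNReal.coe_pow, ENNReal.coe_inv two_ne_zero]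
    rfl
  have hp1 : ∀ n : ℕ, (2⁻¹ : ℝ≥0∞) ^ n ≤ 1 := fun n => pow_le_one' (by simp) n
  let C : ℝ≥0∞ := 2 * (eLpNorm g 1 ν + 1) + (eLpNorm f 1 ν + 2) * 2
  have hC : C ≠ ∞ := by
    refine ENNReal.add_ne_top.2 ⟨ENNReal.mul_ne_top (by simp) ?_, ENNReal.mul_ne_top ?_ (by simp)⟩
    · exact ENNReal.add_ne_top.2 ⟨hg.eLpNorm_ne_top, by simp⟩
    · exact ENNReal.add_ne_top.2 ⟨hf.eLpNorm_ne_top, by simp⟩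
  have hJ : ∀ n, ∫⁻ x, J n x ∂ν ≤ 2⁻¹ ^ n * C := by
    intro n
    refine (Ji n).trans ?_
    rw [hc]
    have a1 := hφ n
    have a2 := hγ n
    rw [ENNReal.coe_one, one_mul] at a1 a2
    have a3 : eLpNorm (φ n) 1 ν ≤ eLpNorm f 1 ν + 1 := by
      have : φ n = f - (f - φ n) := by simp
      rw [this]
      refine (eLpNorm_sub_le hf.1 (hf.1.sub (φm n).1) le_rfl).trans ?_
      gcongr
      exact a1.trans (hp1 n)
    calc _ ≤ (2⁻¹ ^ n + 2⁻¹ ^ n) * (eLpNorm g 1 ν + 1) +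
          ((eLpNorm f 1 ν + 1) + 1) * (2⁻¹ ^ n + 2⁻¹ ^ n) := by
            gcongr
            · exact hp1 n
            · exact hp1 n
      _ = 2⁻¹ ^ n * C := by
          simp only [C]
          rw [add_assoc (eLpNorm f 1 ν), one_add_one_eq_two]
          ring
  have hsum : ∫⁻ x, ∑' n, J n x ∂ν ≠ ∞ := by
    rw [lintegral_tsum fun n => (Jm n).aemeasurable]
    refine ((ENNReal.tsum_le_tsum hJ).trans_lt ?_).ne
    rw [ENNReal.tsum_mul_right, ENNReal.tsum_geometric, ENNReal.one_sub_inv_two, inv_inv]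
    exact ENNReal.mul_lt_top (by simp) hC.lt_top
  have hfin := ae_lt_top (Measurable.tsum Jm) hsum
  have hle : ∀ᵐ x ∂ν, ∀ n, ‖conv μ f g x - conv μ (φ n) (γ n) x‖ₑ ≤ J n x :=
    (wMeasure_ac μ w).ae_le (ae_all_iff.2 Jle)
  refine aestronglyMeasurable_of_tendsto_ae atTop (f := fun n => conv μ (φ n) (γ n))
    (fun n => ?_) ?_
  · obtain ⟨h1, h2⟩ := continuous_conv μ (φc n) (φs n) (γc n) (γs n)
    exact (h1.stronglyMeasurable_of_hasCompactSupport h2).aestronglyMeasurable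
  · filter_upwards [hfin, hle] with x hx hxle
    have h0 : Tendsto (fun n => J n x) atTop (𝓝 0) :=
      ENNReal.tendsto_atTop_zero_of_tsum_ne_top hx.ne
    rw [tendsto_iff_edist_tendsto_0]
    refine tendsto_of_tendsto_of_tendsto_of_le_of_le tendsto_const_nhds h0
      (fun n => zero_le) (fun n => ?_)
    rw [edist_comm, edist_eq_enorm_sub]
    exact hxle n

theorem eLpNorm_conv_le {f g : G → A} (hf : MemLp f 1 (wMeasure μ w))
    (hg : MemLp g 1 (wMeasure μ w)) :
    eLpNorm (conv μ f g) 1 (wMeasure μ w) ≤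
      eLpNorm f 1 (wMeasure μ w) * eLpNorm g 1 (wMeasure μ w) := by
  set a := eLpNorm f 1 (wMeasure μ w) with ha
  set b := eLpNorm g 1 (wMeasure μ w) with hb
  have ha' : a ≠ ∞ := hf.eLpNorm_ne_top
  have hb' : b ≠ ∞ := hg.eLpNorm_ne_top
  have key : ∀ n : ℕ, eLpNorm (conv μ f g) 1 (wMeasure μ w) ≤
      (a + ((n + 1 : ℝ≥0)⁻¹ : ℝ≥0)) * (b + ((n + 1 : ℝ≥0)⁻¹ : ℝ≥0)) := by
    intro n
    obtain ⟨J, -, hJ, hi⟩ := exists_convI_le μ w hf hg (ε := (n + 1 : ℝ≥0)⁻¹) (by positivity)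
    rw [eLpNorm_one_eq_lintegral_enorm]
    exact (lintegral_mono fun x => (enorm_conv_le μ f g x).trans (hJ x)).trans hi
  have ht : Tendsto (fun n : ℕ => (((n + 1 : ℝ≥0)⁻¹ : ℝ≥0) : ℝ≥0∞)) atTop (𝓝 0) := by
    rw [← ENNReal.coe_zero, ENNReal.tendsto_coe]
    simpa using (tendsto_one_div_add_atTop_nhds_zero_nat (𝕜 := ℝ≥0))
  have ht2 : Tendsto (fun n : ℕ => (a + ((n + 1 : ℝ≥0)⁻¹ : ℝ≥0)) * (b + ((n + 1 : ℝ≥0)⁻¹ : ℝ≥0)))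
      atTop (𝓝 (a * b)) := by
    have h1 := (tendsto_const_nhds (x := a)).add ht
    have h2 := (tendsto_const_nhds (x := b)).add ht
    rw [add_zero] at h1 h2
    exact ENNReal.Tendsto.mul h1 (Or.inr hb') h2 (Or.inr ha')
  exact ge_of_tendsto' ht2 key

/-- The weighted `L¹` space is closed under convolution. -/
theorem memLp_conv {f g : G → A} (hf : MemLp f 1 (wMeasure μ w))
    (hg : MemLp g 1 (wMeasure μ w)) : MemLp (conv μ f g) 1 (wMeasure μ w) :=
  ⟨aestronglyMeasurable_conv μ w hf hg, (eLpNorm_conv_le μ w hf hg).trans_lt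
    (ENNReal.mul_lt_top hf.eLpNorm_lt_top hg.eLpNorm_lt_top)⟩

theorem conv_assoc_cc [CompleteSpace A] {f g h : G → A}
    (hf : Continuous f) (hf' : HasCompactSupport f)
    (hg : Continuous g) (hg' : HasCompactSupport g)
    (hh : Continuous h) :
    conv μ (conv μ f g) h = conv μ f (conv μ g h) := by
  have hint : ∀ {p q : G → A}, Continuous p → HasCompactSupport p → Continuous q → ∀ x,
      Integrable (fun y => p y * q (y⁻¹ * x)) μ := by
    intro p q hp hp' hq x
    exact Continuous.integrable_of_hasCompactSupport (hp.mul (hq.comp (by fun_prop)))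
      hp'.mul_right
  funext x
  rw [conv_eq, conv_eq]
  calc ∫ y, conv μ f g y * h (y⁻¹ * x) ∂μ
      = ∫ y, ∫ z, f z * g (z⁻¹ * y) * h (y⁻¹ * x) ∂μ ∂μ := by
        congr with y
        rw [conv_eq, integral_mul_const_of_integrable (hint hf hf' hg y)]
    _ = ∫ z, ∫ y, f z * g (z⁻¹ * y) * h (y⁻¹ * x) ∂μ ∂μ := by
        refine integral_integral_swap_of_hasCompactSupport ?_ ?_
        · simp only [Function.uncurry_def]
          fun_prop
        · refine hasCompactSupport_aux hf' hg' _ ?_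
          rintro y z (h | h) <;> simp [Function.uncurry, h]
    _ = ∫ z, f z * conv μ g h (z⁻¹ * x) ∂μ := by
        congr with z
        rw [conv_eq, ← integral_const_mul_of_integrable (hint hg hg' hh _),
          ← integral_mul_left_eq_self _ z]
        simp [mul_assoc]

end Conv2
end Beurling

namespace Beurling

/-- The space `L¹_w(G, E)` of (classes of) Bochner measurable functions `f : G → E` with
`∫ ‖f(x)‖ w(x) dx < ∞`. -/
def L1w {G : Type*} [Group G] [MeasurableSpace G] (μ : Measure G) (w : Weight G)
    (E : Type*) [NormedAddCommGroup E] : Type _ :=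
  Lp E 1 (wMeasure μ w)

section L1w

section Space

variable {G : Type*} [Group G] [MeasurableSpace G] (μ : Measure G) (w : Weight G)
  {E : Type*} [NormedAddCommGroup E]

noncomputable instance : NormedAddCommGroup (L1w μ w E) :=
  inferInstanceAs (NormedAddCommGroup (Lp E 1 (wMeasure μ w)))

noncomputable instance [NormedSpace ℂ E] : NormedSpace ℂ (L1w μ w E) :=
  inferInstanceAs (NormedSpace ℂ (Lp E 1 (wMeasure μ w)))

instance [CompleteSpace E] : CompleteSpace (L1w μ w E) :=
  inferInstanceAs (CompleteSpace (Lp E 1 (wMeasure μ w)))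

variable {μ w}

/-- A representative of a class. -/
noncomputable def L1w.toFun : L1w μ w E → G → E :=
  fun f : Lp E 1 (wMeasure μ w) => (f : G → E)

noncomputable instance : CoeFun (L1w μ w E) (fun _ => G → E) := ⟨L1w.toFun⟩

theorem L1w.memLp (f : L1w μ w E) : MemLp (f : G → E) 1 (wMeasure μ w) := Lp.memLp _

/-- The class of a function. -/
noncomputable def L1w.mk (f : G → E) (hf : MemLp f 1 (wMeasure μ w)) : L1w μ w E := hf.toLp f

theorem L1w.coe_mk (f : G → E) (hf : MemLp f 1 (wMeasure μ w)) :
    (L1w.mk f hf : G → E) =ᵐ[μ] f :=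
  (ac_wMeasure μ w).ae_le hf.coeFn_toLp

theorem L1w.ext {f g : L1w μ w E} (h : (f : G → E) =ᵐ[μ] g) : f = g :=
  Lp.ext ((wMeasure_ac μ w).ae_le h)

theorem L1w.coe_add (f g : L1w μ w E) : ((f + g : L1w μ w E) : G → E) =ᵐ[μ] f + g :=
  (ac_wMeasure μ w).ae_le (Lp.coeFn_add _ _)

theorem L1w.coe_smul [NormedSpace ℂ E] (c : ℂ) (f : L1w μ w E) :
    ((c • f : L1w μ w E) : G → E) =ᵐ[μ] c • (f : G → E) :=
  (ac_wMeasure μ w).ae_le (Lp.coeFn_smul c (show Lp E 1 (wMeasure μ w) from f))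

theorem L1w.norm_eq_eLpNorm (f : L1w μ w E) :
    ‖f‖ = (eLpNorm (f : G → E) 1 (wMeasure μ w)).toReal := Lp.norm_def _

/-- The norm is `∫ ‖f(x)‖ w(x) dx`. -/
theorem L1w.norm_eq (f : L1w μ w E) : ‖f‖ = ∫ x, ‖f x‖ * w x ∂μ := by
  have hm : AEStronglyMeasurable (f : G → E) μ :=
    f.memLp.aestronglyMeasurable.mono_ac (ac_wMeasure μ w)
  have hw : AEStronglyMeasurable (fun x => (w x : ℝ)) μ :=
    w.measurable'.coe_nnreal_real.aestronglyMeasurable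
  rw [L1w.norm_eq_eLpNorm, eLpNorm_one_eq_lintegral_enorm, lintegral_wMeasure,
    integral_eq_lintegral_of_nonneg_ae (f := fun x => ‖f x‖ * w x)
      (Eventually.of_forall fun x => by positivity) (hm.norm.mul hw)]
  congr 2
  funext x
  rw [ENNReal.ofReal_mul (norm_nonneg _), ofReal_norm, ENNReal.ofReal_coe_nnreal, mul_comm]

end Space

section Ring

variable {G : Type*} [Group G] [TopologicalSpace G] [IsTopologicalGroup G] [T2Space G]
  [LocallyCompactSpace G] [MeasurableSpace G] [BorelSpace G]
  {μ : Measure G} [μ.IsHaarMeasure] [μ.Regular] {w : Weight G}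
  {A : Type*} [NonUnitalNormedRing A] [NormedSpace ℂ A] [IsScalarTower ℂ A A]
  [SMulCommClass ℂ A A]

/-- The convolution product on `L¹_w(G, A)`. -/
noncomputable def L1w.mul (f g : L1w μ w A) : L1w μ w A :=
  L1w.mk (conv μ f g) (memLp_conv μ w f.memLp g.memLp)

theorem L1w.coe_mul' (f g : L1w μ w A) : (L1w.mul f g : G → A) =ᵐ[μ] conv μ f g :=
  L1w.coe_mk _ _

theorem L1w.norm_mul_le' (f g : L1w μ w A) : ‖L1w.mul f g‖ ≤ ‖f‖ * ‖g‖ := by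
  rw [L1w.norm_eq_eLpNorm, L1w.norm_eq_eLpNorm f, L1w.norm_eq_eLpNorm g, ← ENNReal.toReal_mul,
    eLpNorm_congr_ae ((wMeasure_ac μ w).ae_le (L1w.coe_mul' f g))]
  exact ENNReal.toReal_mono
    (ENNReal.mul_ne_top f.memLp.eLpNorm_ne_top g.memLp.eLpNorm_ne_top)
    (eLpNorm_conv_le μ w f.memLp g.memLp)

theorem L1w.conv_congr {f g : L1w μ w A} {f' g' : G → A} (hf : (f : G → A) =ᵐ[μ] f')
    (hg : (g : G → A) =ᵐ[μ] g') : (L1w.mul f g : G → A) =ᵐ[μ] conv μ f' g' :=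
  (L1w.coe_mul' f g).trans (conv_congr_ae μ w f.memLp g.memLp hf hg)

theorem L1w.mul_add' (f g h : L1w μ w A) :
    L1w.mul f (g + h) = L1w.mul f g + L1w.mul f h :=
  L1w.ext <| (L1w.conv_congr (ae_eq_refl _) (L1w.coe_add g h)).trans <|
    (conv_add_ae μ w f.memLp g.memLp h.memLp).trans <|
      (((L1w.coe_mul' f g).add (L1w.coe_mul' f h)).symm.trans (L1w.coe_add _ _).symm)

theorem L1w.add_mul' (f g h : L1w μ w A) :
    L1w.mul (f + g) h = L1w.mul f h + L1w.mul g h :=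
  L1w.ext <| (L1w.conv_congr (L1w.coe_add f g) (ae_eq_refl _)).trans <|
    (add_conv_ae μ w f.memLp g.memLp h.memLp).trans <|
      (((L1w.coe_mul' f h).add (L1w.coe_mul' g h)).symm.trans (L1w.coe_add _ _).symm)

theorem L1w.smul_mul' (c : ℂ) (f g : L1w μ w A) : L1w.mul (c • f) g = c • L1w.mul f g := by
  refine L1w.ext <| (L1w.conv_congr (L1w.coe_smul c f) (ae_eq_refl _)).trans ?_
  rw [smul_conv]
  exact ((L1w.coe_mul' f g).const_smul c).symm.trans (L1w.coe_smul c _).symm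

theorem L1w.mul_smul' (c : ℂ) (f g : L1w μ w A) : L1w.mul f (c • g) = c • L1w.mul f g := by
  refine L1w.ext <| (L1w.conv_congr (ae_eq_refl _) (L1w.coe_smul c g)).trans ?_
  rw [conv_smul]
  exact ((L1w.coe_mul' f g).const_smul c).symm.trans (L1w.coe_smul c _).symm

theorem L1w.continuous_mul' :
    Continuous fun p : L1w μ w A × L1w μ w A => L1w.mul p.1 p.2 := by
  let B : L1w μ w A →ₗ[ℂ] L1w μ w A →ₗ[ℂ] L1w μ w A :=
    LinearMap.mk₂ ℂ L1w.mul L1w.add_mul' L1w.smul_mul' L1w.mul_add' L1w.mul_smul'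
  let B' := B.mkContinuous₂ 1 fun f g => by
    rw [one_mul]; exact L1w.norm_mul_le' f g
  exact B'.continuous₂

variable (μ w A) in
theorem L1w.denseRange_cc : DenseRange
    (fun f : {f : G → A // Continuous f ∧ HasCompactSupport f} =>
      (L1w.mk f.1 (f.2.1.memLp_of_hasCompactSupport f.2.2) : L1w μ w A)) := by
  intro f
  rw [Metric.mem_closure_range_iff]
  intro ε hε
  obtain ⟨g, hg, hc, hs⟩ := exists_cc_approx μ w f.memLp (ε := ENNReal.ofReal (ε / 2))
    (by simpa using hε)
  refine ⟨⟨g, hc, hs⟩, ?_⟩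
  have hgm : MemLp g 1 (wMeasure μ w) := hc.memLp_of_hasCompactSupport hs
  have h1 : dist f (L1w.mk g hgm) = (eLpNorm ((f : G → A) - g) 1 (wMeasure μ w)).toReal := by
    have : dist f (L1w.mk g hgm) = ‖f - L1w.mk g hgm‖ := dist_eq_norm _ _
    rw [this, L1w.norm_eq_eLpNorm]
    congr 1
    refine eLpNorm_congr_ae ?_
    exact (Lp.coeFn_sub _ _).trans ((ae_eq_refl _).sub hgm.coeFn_toLp)
  have h2 := ENNReal.toReal_mono (by simp) hg
  rw [ENNReal.toReal_ofReal (by positivity)] at h2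
  change dist f (L1w.mk g hgm) < ε
  rw [h1]
  linarith

theorem L1w.mul_assoc' [CompleteSpace A] (f g h : L1w μ w A) :
    L1w.mul (L1w.mul f g) h = L1w.mul f (L1w.mul g h) := by
  refine (L1w.denseRange_cc μ w A).induction_on₃
    (p := fun f g h => L1w.mul (L1w.mul f g) h = L1w.mul f (L1w.mul g h)) ?_ ?_ f g h
  · have hm := L1w.continuous_mul' (μ := μ) (w := w) (A := A)
    refine isClosed_eq ?_ ?_
    · exact hm.comp ((hm.comp (continuous_fst.prodMk (continuous_fst.comp continuous_snd))).prodMk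
        (continuous_snd.comp continuous_snd))
    · exact hm.comp (continuous_fst.prodMk (hm.comp continuous_snd))
  · rintro ⟨f, hf, hf'⟩ ⟨g, hg, hg'⟩ ⟨h, hh, hh'⟩
    refine L1w.ext ?_
    refine (L1w.conv_congr (L1w.conv_congr (L1w.coe_mk _ _) (L1w.coe_mk _ _))
      (L1w.coe_mk _ _)).trans ?_
    refine EventuallyEq.trans ?_ (L1w.conv_congr (L1w.coe_mk _ _)
      (L1w.conv_congr (L1w.coe_mk _ _) (L1w.coe_mk _ _))).symm
    rw [conv_assoc_cc μ hf hf' hg hg' hh]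

/-- `L¹_w(G, A)` is a Banach algebra under convolution. -/
noncomputable instance [CompleteSpace A] : NonUnitalNormedRing (L1w μ w A) :=
  { (inferInstance : NormedAddCommGroup (L1w μ w A)) with
    mul := L1w.mul
    left_distrib := L1w.mul_add'
    right_distrib := L1w.add_mul'
    zero_mul := fun f => by
      have := L1w.smul_mul' 0 (0 : L1w μ w A) f
      rw [zero_smul, zero_smul] at this
      exact this
    mul_zero := fun f => by
      have := L1w.mul_smul' 0 f (0 : L1w μ w A)
      rw [zero_smul, zero_smul] at this
      exact this
    mul_assoc := L1w.mul_assoc'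
    norm_mul_le := L1w.norm_mul_le' }

/-- The product is convolution. -/
theorem L1w.coe_mul [CompleteSpace A] (f g : L1w μ w A) :
    ((f * g : L1w μ w A) : G → A) =ᵐ[μ] conv μ f g :=
  L1w.coe_mul' f g

instance [CompleteSpace A] : IsScalarTower ℂ (L1w μ w A) (L1w μ w A) :=
  ⟨fun c f g => L1w.smul_mul' c f g⟩

instance [CompleteSpace A] : SMulCommClass ℂ (L1w μ w A) (L1w μ w A) :=
  ⟨fun c f g => (L1w.mul_smul' c f g).symm⟩

end Ring
end L1w
end Beurling

namespace Beurling

/-- The algebraic tensor product `E ⊗ F`, to be endowed with the projective seminorm. -/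
def AlgTensor (E F : Type*) [AddCommGroup E] [Module ℂ E] [AddCommGroup F] [Module ℂ F] : Type _ :=
  E ⊗[ℂ] F

section ProjectiveNorm

variable {E F : Type*} [NormedAddCommGroup E] [NormedSpace ℂ E]
  [NormedAddCommGroup F] [NormedSpace ℂ F]

noncomputable instance : AddCommGroup (AlgTensor E F) := inferInstanceAs (AddCommGroup (E ⊗[ℂ] F))

noncomputable instance : Module ℂ (AlgTensor E F) := inferInstanceAs (Module ℂ (E ⊗[ℂ] F))

/-- The elementary tensor `x ⊗ y`. -/
noncomputable def AlgTensor.tmul (x : E) (y : F) : AlgTensor E F := x ⊗ₜ[ℂ] y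

/-- The costs `∑ ‖xᵢ‖ ‖yᵢ‖` of the representations `u = ∑ xᵢ ⊗ yᵢ`. -/
def AlgTensor.costs (u : AlgTensor E F) : Set ℝ :=
  {r | ∃ l : List (E × F), (l.map fun p => AlgTensor.tmul p.1 p.2).sum = u ∧
    r = (l.map fun p => ‖p.1‖ * ‖p.2‖).sum}

theorem AlgTensor.cost_nonneg (l : List (E × F)) :
    0 ≤ (l.map fun p => ‖p.1‖ * ‖p.2‖).sum := by
  refine List.sum_nonneg fun a ha => ?_
  obtain ⟨p, -, rfl⟩ := List.mem_map.1 ha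
  positivity

theorem AlgTensor.costs_nonneg {u : AlgTensor E F} : ∀ r ∈ u.costs, 0 ≤ r := by
  rintro r ⟨l, -, rfl⟩
  exact AlgTensor.cost_nonneg l

theorem AlgTensor.costs_bddBelow (u : AlgTensor E F) : BddBelow u.costs :=
  ⟨0, AlgTensor.costs_nonneg⟩

theorem AlgTensor.costs_nonempty (u : AlgTensor E F) : u.costs.Nonempty := by
  suffices h : ∃ l : List (E × F), (l.map fun p => AlgTensor.tmul p.1 p.2).sum = u by
    obtain ⟨l, hl⟩ := h
    exact ⟨_, l, hl, rfl⟩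
  induction u using TensorProduct.induction_on with
  | zero => exact ⟨[], rfl⟩
  | tmul x y => exact ⟨[(x, y)], by simp; rfl⟩
  | add u v hu hv =>
    obtain ⟨l, hl⟩ := hu
    obtain ⟨m, hm⟩ := hv
    exact ⟨l ++ m, by rw [List.map_append, List.sum_append, hl, hm]; rfl⟩

/-- The projective seminorm, `‖u‖ = inf {∑ ‖xᵢ‖ ‖yᵢ‖ : u = ∑ xᵢ ⊗ yᵢ}`. -/
noncomputable def AlgTensor.projNorm (u : AlgTensor E F) : ℝ := sInf u.costs

theorem AlgTensor.projNorm_le {u : AlgTensor E F} (l : List (E × F))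
    (hl : (l.map fun p => AlgTensor.tmul p.1 p.2).sum = u) :
    u.projNorm ≤ (l.map fun p => ‖p.1‖ * ‖p.2‖).sum :=
  csInf_le u.costs_bddBelow ⟨l, hl, rfl⟩

theorem AlgTensor.exists_lt (u : AlgTensor E F) {ε : ℝ} (hε : 0 < ε) :
    ∃ l : List (E × F), (l.map fun p => AlgTensor.tmul p.1 p.2).sum = u ∧
      (l.map fun p => ‖p.1‖ * ‖p.2‖).sum < u.projNorm + ε := by
  obtain ⟨r, ⟨l, hl, rfl⟩, hr⟩ := Real.lt_sInf_add_pos u.costs_nonempty hε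
  exact ⟨l, hl, hr⟩

theorem AlgTensor.projNorm_zero : (0 : AlgTensor E F).projNorm = 0 :=
  le_antisymm (AlgTensor.projNorm_le [] rfl) (le_csInf (AlgTensor.costs_nonempty _)
    AlgTensor.costs_nonneg)

theorem AlgTensor.projNorm_add_le (u v : AlgTensor E F) :
    (u + v).projNorm ≤ u.projNorm + v.projNorm := by
  refine le_of_forall_pos_le_add fun ε hε => ?_
  obtain ⟨l, hl, hl'⟩ := u.exists_lt (half_pos hε)
  obtain ⟨m, hm, hm'⟩ := v.exists_lt (half_pos hε)
  refine (AlgTensor.projNorm_le (l ++ m) (by rw [List.map_append, List.sum_append, hl, hm])).trans ?_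
  rw [List.map_append, List.sum_append]
  linarith

theorem AlgTensor.projNorm_smul_le (c : ℂ) (u : AlgTensor E F) :
    (c • u).projNorm ≤ ‖c‖ * u.projNorm := by
  refine le_of_forall_pos_le_add fun ε hε => ?_
  obtain ⟨l, hl, hl'⟩ := u.exists_lt (ε := ε / (‖c‖ + 1)) (by positivity)
  refine (AlgTensor.projNorm_le (l.map fun p => (c • p.1, p.2)) ?_).trans ?_
  · rw [List.map_map, ← hl, List.smul_sum, List.map_map]
    rfl
  · have : (List.map (fun p : E × F => ‖p.1‖ * ‖p.2‖) (l.map fun p => (c • p.1, p.2))).sum =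
        ‖c‖ * (l.map fun p => ‖p.1‖ * ‖p.2‖).sum := by
      rw [List.map_map, ← List.sum_map_mul_left]
      simp [Function.comp_def, norm_smul, mul_assoc]
    rw [this]
    have h1 : ‖c‖ * (ε / (‖c‖ + 1)) ≤ ε := by
      rw [mul_div_assoc', div_le_iff₀ (by positivity)]
      nlinarith [norm_nonneg c]
    nlinarith [norm_nonneg c, mul_le_mul_of_nonneg_left hl'.le (norm_nonneg c)]

noncomputable instance : SeminormedAddCommGroup (AlgTensor E F) :=
  (Seminorm.ofSMulLE (𝕜 := ℂ) AlgTensor.projNorm AlgTensor.projNorm_zero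
    AlgTensor.projNorm_add_le AlgTensor.projNorm_smul_le).toSeminormedAddCommGroup

theorem AlgTensor.norm_eq (u : AlgTensor E F) : ‖u‖ = sInf u.costs := rfl

noncomputable instance : NormedSpace ℂ (AlgTensor E F) :=
  ⟨AlgTensor.projNorm_smul_le⟩

end ProjectiveNorm

/-- The Banach space projective tensor product `E ⊗^γ F`: the completion of `E ⊗ F` in the
projective norm. -/
def ProjTensor (E F : Type*) [NormedAddCommGroup E] [NormedSpace ℂ E]
    [NormedAddCommGroup F] [NormedSpace ℂ F] : Type _ :=
  UniformSpace.Completion (AlgTensor E F)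

section ProjSpace

variable {E F : Type*} [NormedAddCommGroup E] [NormedSpace ℂ E]
  [NormedAddCommGroup F] [NormedSpace ℂ F]

noncomputable instance : NormedAddCommGroup (ProjTensor E F) :=
  inferInstanceAs (NormedAddCommGroup (UniformSpace.Completion (AlgTensor E F)))

noncomputable instance : NormedSpace ℂ (ProjTensor E F) :=
  inferInstanceAs (NormedSpace ℂ (UniformSpace.Completion (AlgTensor E F)))

instance : CompleteSpace (ProjTensor E F) :=
  inferInstanceAs (CompleteSpace (UniformSpace.Completion (AlgTensor E F)))

/-- The canonical isometry of `E ⊗ F` into `E ⊗^γ F`. -/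
noncomputable def ProjTensor.ofAlg : AlgTensor E F →ₗᵢ[ℂ] ProjTensor E F :=
  UniformSpace.Completion.toComplₗᵢ (𝕜 := ℂ) (E := AlgTensor E F)

theorem ProjTensor.denseRange_ofAlg :
    DenseRange (ProjTensor.ofAlg : AlgTensor E F →ₗᵢ[ℂ] ProjTensor E F) :=
  UniformSpace.Completion.denseRange_coe

/-- The elementary tensor `x ⊗ y` in `E ⊗^γ F`. -/
noncomputable def ProjTensor.tmul (x : E) (y : F) : ProjTensor E F :=
  ProjTensor.ofAlg (AlgTensor.tmul x y)

end ProjSpace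

section ProjAlgebra

variable {A B : Type*}
  [NonUnitalNormedRing A] [NormedSpace ℂ A] [IsScalarTower ℂ A A] [SMulCommClass ℂ A A]
  [NonUnitalNormedRing B] [NormedSpace ℂ B] [IsScalarTower ℂ B B] [SMulCommClass ℂ B B]

/-- The algebra structure of `A ⊗ B`, with `(a ⊗ b) (a' ⊗ b') = a a' ⊗ b b'`. -/
noncomputable instance : NonUnitalRing (AlgTensor A B) :=
  inferInstanceAs (NonUnitalRing (A ⊗[ℂ] B))

theorem AlgTensor.tmul_mul_tmul (a a' : A) (b b' : B) :
    AlgTensor.tmul a b * AlgTensor.tmul a' b' = AlgTensor.tmul (a * a') (b * b') :=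
  Algebra.TensorProduct.tmul_mul_tmul a a' b b'

theorem AlgTensor.list_sum_mul (l : List (A × B)) (v : AlgTensor A B) :
    (l.map fun p => AlgTensor.tmul p.1 p.2).sum * v =
      (l.map fun p => AlgTensor.tmul p.1 p.2 * v).sum := by
  rw [← List.sum_map_mul_right]

theorem AlgTensor.projNorm_mul_le (u v : AlgTensor A B) :
    (u * v).projNorm ≤ u.projNorm * v.projNorm := by
  have key : ∀ (l m : List (A × B)),
      ((l.map fun p => AlgTensor.tmul p.1 p.2).sum *
        (m.map fun p => AlgTensor.tmul p.1 p.2).sum).projNorm ≤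
      (l.map fun p => ‖p.1‖ * ‖p.2‖).sum * (m.map fun p => ‖p.1‖ * ‖p.2‖).sum := by
    intro l m
    induction l with
    | nil => simp [AlgTensor.projNorm_zero]
    | cons p l ih =>
      simp only [List.map_cons, List.sum_cons, add_mul]
      refine (AlgTensor.projNorm_add_le _ _).trans (add_le_add ?_ ih)
      refine (AlgTensor.projNorm_le (m.map fun q => (p.1 * q.1, p.2 * q.2)) ?_).trans ?_
      · rw [List.map_map, ← List.sum_map_mul_left]
        simp only [Function.comp_def, AlgTensor.tmul_mul_tmul]
      · rw [List.map_map, ← List.sum_map_mul_left]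
        refine List.sum_le_sum fun q _ => ?_
        simp only [Function.comp_def]
        calc ‖p.1 * q.1‖ * ‖p.2 * q.2‖ ≤ (‖p.1‖ * ‖q.1‖) * (‖p.2‖ * ‖q.2‖) :=
              mul_le_mul (norm_mul_le _ _) (norm_mul_le _ _) (norm_nonneg _) (by positivity)
          _ = _ := by ring
  have hlim : Tendsto (fun ε : ℝ => (u.projNorm + ε) * (v.projNorm + ε)) (𝓝[>] 0)
      (𝓝 (u.projNorm * v.projNorm)) := by
    have : Continuous fun ε : ℝ => (u.projNorm + ε) * (v.projNorm + ε) := by fun_prop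
    have h := this.tendsto 0
    simp only [add_zero] at h
    exact h.mono_left nhdsWithin_le_nhds
  refine ge_of_tendsto hlim ?_
  filter_upwards [self_mem_nhdsWithin] with ε hε
  obtain ⟨l, hl, hl'⟩ := u.exists_lt hε
  obtain ⟨m, hm, hm'⟩ := v.exists_lt hε
  have := key l m
  rw [hl, hm] at this
  exact this.trans (mul_le_mul hl'.le hm'.le (AlgTensor.cost_nonneg m)
    ((AlgTensor.cost_nonneg l).trans hl'.le))

noncomputable instance : NonUnitalSeminormedRing (AlgTensor A B) :=
  { (inferInstance : SeminormedAddCommGroup (AlgTensor A B)),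
    (inferInstance : NonUnitalRing (AlgTensor A B)) with
    norm_mul_le := AlgTensor.projNorm_mul_le }

instance : IsScalarTower ℂ (AlgTensor A B) (AlgTensor A B) :=
  inferInstanceAs (IsScalarTower ℂ (A ⊗[ℂ] B) (A ⊗[ℂ] B))

instance : SMulCommClass ℂ (AlgTensor A B) (AlgTensor A B) :=
  inferInstanceAs (SMulCommClass ℂ (A ⊗[ℂ] B) (A ⊗[ℂ] B))

/-- The continuous extension of the product of `A ⊗ B` to `A ⊗^γ B`. -/
noncomputable def ProjTensor.mul (u v : ProjTensor A B) : ProjTensor A B :=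
  (UniformSpace.Completion.isDenseInducing_coe.prodMap
    UniformSpace.Completion.isDenseInducing_coe).extend
      (fun p : AlgTensor A B × AlgTensor A B => ProjTensor.ofAlg (p.1 * p.2)) (u, v)

theorem ProjTensor.continuous_mul' :
    Continuous fun p : ProjTensor A B × ProjTensor A B => ProjTensor.mul p.1 p.2 := by
  let m : AlgTensor A B →+ AlgTensor A B →+ ProjTensor A B :=
    (AddMonoidHom.mul : AlgTensor A B →+ _).compr₂
      (ProjTensor.ofAlg : AlgTensor A B →ₗᵢ[ℂ] ProjTensor A B).toLinearMap.toAddMonoidHom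
  have hm : Continuous fun p : AlgTensor A B × AlgTensor A B => m p.1 p.2 :=
    ProjTensor.ofAlg.continuous.comp continuous_mul
  have di : IsDenseInducing
      (UniformSpace.Completion.toCompl : AlgTensor A B → UniformSpace.Completion (AlgTensor A B)) :=
    UniformSpace.Completion.isDenseInducing_coe
  exact (di.extend_Z_bilin di hm :)

theorem ProjTensor.ofAlg_mul' (u v : AlgTensor A B) :
    ProjTensor.mul (ProjTensor.ofAlg u) (ProjTensor.ofAlg v) = ProjTensor.ofAlg (u * v) :=
  (UniformSpace.Completion.isDenseInducing_coe.prodMap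
    UniformSpace.Completion.isDenseInducing_coe).extend_eq
      (f := fun p : AlgTensor A B × AlgTensor A B => ProjTensor.ofAlg (p.1 * p.2))
      (ProjTensor.ofAlg.continuous.comp continuous_mul) (u, v)

theorem ProjTensor.induction₃ {p : ProjTensor A B → ProjTensor A B → ProjTensor A B → Prop}
    (hp : IsClosed {q : ProjTensor A B × ProjTensor A B × ProjTensor A B | p q.1 q.2.1 q.2.2})
    (h : ∀ u v w, p (ProjTensor.ofAlg u) (ProjTensor.ofAlg v) (ProjTensor.ofAlg w))
    (u v w : ProjTensor A B) : p u v w :=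
  ProjTensor.denseRange_ofAlg.induction_on₃ hp h u v w

/-- `A ⊗^γ B` is a Banach algebra. -/
noncomputable instance : NonUnitalNormedRing (ProjTensor A B) :=
  { (inferInstance : NormedAddCommGroup (ProjTensor A B)) with
    mul := ProjTensor.mul
    left_distrib := by
      have hm := ProjTensor.continuous_mul' (A := A) (B := B)
      refine ProjTensor.induction₃ (p := fun u v w =>
        ProjTensor.mul u (v + w) = ProjTensor.mul u v + ProjTensor.mul u w) ?_ ?_
      · refine isClosed_eq (hm.comp (f := fun q : _ × _ × _ => (q.1, q.2.1 + q.2.2)) (by fun_prop))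
          ((hm.comp (f := fun q : _ × _ × _ => (q.1, q.2.1)) (by fun_prop)).add
            (hm.comp (f := fun q : _ × _ × _ => (q.1, q.2.2)) (by fun_prop)))
      · intro u v w
        rw [← map_add, ProjTensor.ofAlg_mul', ProjTensor.ofAlg_mul', ProjTensor.ofAlg_mul',
          mul_add, map_add]
    right_distrib := by
      have hm := ProjTensor.continuous_mul' (A := A) (B := B)
      refine ProjTensor.induction₃ (p := fun u v w =>
        ProjTensor.mul (u + v) w = ProjTensor.mul u w + ProjTensor.mul v w) ?_ ?_
      · refine isClosed_eq (hm.comp (f := fun q : _ × _ × _ => (q.1 + q.2.1, q.2.2)) (by fun_prop))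
          ((hm.comp (f := fun q : _ × _ × _ => (q.1, q.2.2)) (by fun_prop)).add
            (hm.comp (f := fun q : _ × _ × _ => (q.2.1, q.2.2)) (by fun_prop)))
      · intro u v w
        rw [← map_add, ProjTensor.ofAlg_mul', ProjTensor.ofAlg_mul', ProjTensor.ofAlg_mul',
          add_mul, map_add]
    zero_mul := fun u => by
      have hm := ProjTensor.continuous_mul' (A := A) (B := B)
      refine ProjTensor.induction₃ (p := fun u _ _ => ProjTensor.mul 0 u = 0) ?_ ?_ u u u
      · exact isClosed_eq (hm.comp (f := fun q : _ × _ × _ => (0, q.1)) (by fun_prop))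
          continuous_const
      · intro u _ _
        rw [← map_zero ProjTensor.ofAlg, ProjTensor.ofAlg_mul', zero_mul]
    mul_zero := fun u => by
      have hm := ProjTensor.continuous_mul' (A := A) (B := B)
      refine ProjTensor.induction₃ (p := fun u _ _ => ProjTensor.mul u 0 = 0) ?_ ?_ u u u
      · exact isClosed_eq (hm.comp (f := fun q : _ × _ × _ => (q.1, 0)) (by fun_prop))
          continuous_const
      · intro u _ _
        rw [← map_zero ProjTensor.ofAlg, ProjTensor.ofAlg_mul', mul_zero]
    mul_assoc := by
      have hm := ProjTensor.continuous_mul' (A := A) (B := B)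
      refine ProjTensor.induction₃ (p := fun u v w =>
        ProjTensor.mul (ProjTensor.mul u v) w = ProjTensor.mul u (ProjTensor.mul v w)) ?_ ?_
      · refine isClosed_eq
          (hm.comp ((hm.comp (f := fun q : _ × _ × _ => (q.1, q.2.1)) (by fun_prop)).prodMk
            (continuous_snd.comp continuous_snd)))
          (hm.comp (continuous_fst.prodMk
            (hm.comp (f := fun q : _ × _ × _ => (q.2.1, q.2.2)) (by fun_prop))))
      · intro u v w
        rw [ProjTensor.ofAlg_mul', ProjTensor.ofAlg_mul', ProjTensor.ofAlg_mul',
          ProjTensor.ofAlg_mul', mul_assoc]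
    norm_mul_le := fun u v => by
      have hm := ProjTensor.continuous_mul' (A := A) (B := B)
      refine ProjTensor.induction₃ (p := fun u v _ => ‖ProjTensor.mul u v‖ ≤ ‖u‖ * ‖v‖) ?_ ?_ u v v
      · exact isClosed_le (hm.comp (f := fun q : _ × _ × _ => (q.1, q.2.1)) (by fun_prop)).norm
          (by fun_prop)
      · intro u v _
        rw [ProjTensor.ofAlg_mul', LinearIsometry.norm_map, LinearIsometry.norm_map,
          LinearIsometry.norm_map]
        exact norm_mul_le u v }

theorem ProjTensor.tmul_mul_tmul (a a' : A) (b b' : B) :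
    ProjTensor.tmul a b * ProjTensor.tmul a' b' = ProjTensor.tmul (a * a') (b * b') := by
  rw [ProjTensor.tmul, ProjTensor.tmul, ProjTensor.tmul, ← AlgTensor.tmul_mul_tmul]
  exact ProjTensor.ofAlg_mul' _ _

end ProjAlgebra
end Beurling

namespace Beurling

/-- The group `G` is an `[IN]` group: the identity has a compact neighbourhood which is invariant
under all inner automorphisms. -/
def IsINGroup (G : Type*) [Group G] [TopologicalSpace G] : Prop :=
  ∃ U : Set G, IsCompact U ∧ U ∈ 𝓝 (1 : G) ∧ ∀ y : G, (fun x => y * x * y⁻¹) '' U = U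

/-- The weight is constant on conjugacy classes. -/
def Weight.IsClassFunction {G : Type*} [Group G] [MeasurableSpace G] (w : Weight G) : Prop :=
  ∀ x y : G, w (y * x * y⁻¹) = w x

/-- The `σ`-algebra of the conjugation invariant measurable sets. -/
@[reducible] def invMeasurableSpace (G : Type*) [Group G] [MeasurableSpace G] : MeasurableSpace G where
  MeasurableSet' s := MeasurableSet s ∧ ∀ y : G, (fun x => y * x * y⁻¹) ⁻¹' s = s
  measurableSet_empty := ⟨MeasurableSet.empty, fun _ => rfl⟩
  measurableSet_compl := fun s hs => ⟨hs.1.compl, fun y => by rw [Set.preimage_compl, hs.2 y]⟩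
  measurableSet_iUnion := fun f hf => ⟨MeasurableSet.iUnion fun i => (hf i).1, fun y => by
    rw [Set.preimage_iUnion]
    exact Set.iUnion_congr fun i => (hf i).2 y⟩

/-- The space `L¹_{w,inv}(G, E)`: the elements of `L¹_w(G, E)` which are represented by a
(Bochner) measurable function for the `σ`-algebra of conjugation invariant measurable sets. -/
noncomputable def L1inv {G : Type*} [Group G] [MeasurableSpace G] (μ : Measure G) (w : Weight G)
    (E : Type*) [NormedAddCommGroup E] [NormedSpace ℂ E] : Submodule ℂ (L1w μ w E) where
  carrier := {f | ∃ g : G → E, StronglyMeasurable[invMeasurableSpace G] g ∧ (f : G → E) =ᵐ[μ] g}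
  zero_mem' := ⟨0, stronglyMeasurable_zero, (ac_wMeasure μ w).ae_le (Lp.coeFn_zero _ _ _)⟩
  add_mem' := by
    rintro f f' ⟨g, hg, hfg⟩ ⟨g', hg', hfg'⟩
    exact ⟨g + g', hg.add hg', (L1w.coe_add f f').trans (hfg.add hfg')⟩
  smul_mem' := by
    rintro c f ⟨g, hg, hfg⟩
    exact ⟨c • g, hg.const_smul c, (L1w.coe_smul c f).trans (hfg.const_smul c)⟩

section Center

variable (A : Type*) [NonUnitalNormedRing A] [NormedSpace ℂ A] [IsScalarTower ℂ A A]
  [SMulCommClass ℂ A A]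

/-- The center `Z(A)` of a Banach algebra. -/
abbrev Z : NonUnitalSubalgebra ℂ A := NonUnitalSubalgebra.center ℂ A

noncomputable instance : NormedSpace ℂ (Z A) :=
  ⟨fun c x => norm_smul_le c (x : A)⟩

theorem mem_Z_iff (z : A) : z ∈ Z A ↔ ∀ a : A, a * z = z * a := by
  change z ∈ Set.center A ↔ _
  rw [Semigroup.mem_center_iff]

instance [CompleteSpace A] : CompleteSpace (Z A) := by
  have h : IsClosed ((Z A : Set A)) := by
    have : (Z A : Set A) = ⋂ a : A, {z | a * z = z * a} := by
      ext z
      simp [mem_Z_iff]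
    rw [this]
    exact isClosed_iInter fun a => isClosed_eq (by fun_prop) (by fun_prop)
  exact h.completeSpace_coe

end Center

/-- A bounded `Z(A)`-approximate identity of `A`: a bounded net `(a_α)` in `A` such that
`a_α z → z` for every `z ∈ Z(A)`. -/
structure IsBoundedCenterApproxIdentity {A : Type*} [NonUnitalNormedRing A] [NormedSpace ℂ A]
    [IsScalarTower ℂ A A] [SMulCommClass ℂ A A] {ι : Type*} [Preorder ι] (a : ι → A) : Prop where
  bounded : ∃ M : ℝ, ∀ i, ‖a i‖ ≤ M
  tendsto : ∀ z ∈ Z A, Tendsto (fun i => a i * z) atTop (𝓝 z)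

end Beurling

namespace Beurling

/-!
An `[IN]` group is unimodular: right translation by `y` multiplies Haar measure by a constant, and
the measure of the compact invariant neighbourhood shows that the constant is `1`.

Convolving with the functions `y ↦ φ(y) a`, where `φ` is continuous with compact support, shows that
`F ∈ L¹_w(G, A)` is central iff `a F(z x z⁻¹) = F(x) a` for all `a`, `z` and almost all `x`. As no
nonzero central element of `A` is annihilated by `A`, this says that `F` takes values in `Z(A)` and
is almost everywhere invariant under each conjugation, with an exceptional set depending on `z`.

To choose one exceptional set for all `z`, average `F` over small conjugation invariant
neighbourhoods `W` of `1`. The averages `x ↦ |W|⁻¹ ∫_W F(y⁻¹ x) dy` are genuine class functions and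
converge to `F` in `L¹_w` when `w` is a class function; if `w ≥ 1`, do this in `L¹`. Hence
`L¹_{w,inv}(G, Z(A)) = Z(L¹_w(G, A))`.

Finally, `L¹_{w,inv}(G, E)` is the space `L¹(ρ, E)` for the restriction `ρ` of `w(x) dx` to the
invariant Borel sets, and `L¹(ρ) ⊗^γ E ≅ L¹(ρ, E)`.
-/

section Unimodular

variable {G : Type*} [Group G] [TopologicalSpace G] [IsTopologicalGroup G] [MeasurableSpace G]
  [BorelSpace G]

theorem measurableEmbedding_conj (y : G) : MeasurableEmbedding (fun x : G => y * x * y⁻¹) :=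
  ((Homeomorph.mulLeft y).trans (Homeomorph.mulRight y⁻¹)).measurableEmbedding

theorem measurableEmbedding_inv_mul (x : G) : MeasurableEmbedding (fun y : G => y⁻¹ * x) :=
  ((Homeomorph.inv G).trans (Homeomorph.mulRight x)).measurableEmbedding

theorem measurePreserving_conj (μ : Measure G) [μ.IsMulLeftInvariant] [μ.IsMulRightInvariant]
    (y : G) :
    MeasurePreserving (fun x => y * x * y⁻¹) μ μ :=
  (measurePreserving_mul_right μ y⁻¹).comp (measurePreserving_mul_left μ y)

variable [LocallyCompactSpace G]

theorem eq_of_isMulLeftInvariant_of_measure_eq {μ μ' : Measure G} [μ.IsHaarMeasure] [μ.Regular]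
    [μ'.IsMulLeftInvariant] [μ'.Regular] {K : Set G}
    (hK : IsCompact K) (hK1 : K ∈ 𝓝 (1 : G)) (h : μ' K = μ K) : μ' = μ := by
  have hc := Measure.isMulLeftInvariant_eq_smul_of_regular μ' μ
  have hmul : (Measure.haarScalarFactor μ' μ : ℝ≥0∞) * μ K = 1 * μ K := by
    rw [one_mul]
    exact (congrArg (· K) hc).symm.trans h
  have hone : Measure.haarScalarFactor μ' μ = 1 := by
    exact_mod_cast (ENNReal.mul_left_inj (Measure.measure_pos_of_mem_nhds μ hK1).ne'
      hK.measure_lt_top.ne).1 hmul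
  rw [hc, hone, one_smul]

variable (μ : Measure G) [μ.IsHaarMeasure] [μ.Regular]

theorem IsINGroup.isMulRightInvariant [T2Space G] (hG : IsINGroup G) : μ.IsMulRightInvariant := by
  obtain ⟨V, hV, hV1, hVi⟩ := hG
  refine ⟨fun y => ?_⟩
  have : (μ.map (· * y)).Regular := Measure.Regular.map (Homeomorph.mulRight y)
  refine eq_of_isMulLeftInvariant_of_measure_eq hV hV1 ?_
  have hVy : (fun x => y⁻¹ * x) ⁻¹' ((· * y) ⁻¹' V) = V := by
    nth_rw 1 [← hVi y⁻¹]
    ext x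
    simp [mul_assoc]
  rw [Measure.map_apply (measurable_mul_const y) hV.measurableSet, ← measure_preimage_mul μ y⁻¹,
    hVy]

theorem isInvInvariant_of_isMulRightInvariant [μ.IsMulRightInvariant] : μ.IsInvInvariant := by
  obtain ⟨K, hK, hK1⟩ := exists_compact_mem_nhds (1 : G)
  refine ⟨eq_of_isMulLeftInvariant_of_measure_eq (hK.union hK.inv)
    (mem_of_superset hK1 Set.subset_union_left) ?_⟩
  rw [Measure.inv_apply, Set.union_inv, inv_inv, Set.union_comm]

theorem measurePreserving_inv_mul [μ.IsMulRightInvariant] (x : G) :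
    MeasurePreserving (fun y => y⁻¹ * x) μ μ :=
  have : μ.IsInvInvariant := isInvInvariant_of_isMulRightInvariant μ
  (measurePreserving_mul_right μ x).comp (Measure.measurePreserving_inv μ)

end Unimodular

section FundamentalLemma

variable {X E : Type*} [TopologicalSpace X] [T2Space X] [MeasurableSpace X] [BorelSpace X]
  [NormedAddCommGroup E] {ρ : Measure X} {f : X → E}

theorem exists_isOpen_setLIntegral_enorm_sdiff_lt [LocallyCompactSpace X] [ρ.Regular]
    (hf : LocallyIntegrable f ρ) {K : Set X} (hK : IsCompact K) {ε : ℝ≥0∞} (hε : ε ≠ 0) :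
    ∃ U, IsOpen U ∧ K ⊆ U ∧ ∫⁻ x in U \ K, ‖f x‖ₑ ∂ρ < ε := by
  obtain ⟨L, hL, hKL⟩ := exists_compact_superset hK
  obtain ⟨δ, hδ, hδ'⟩ := exists_pos_setLIntegral_lt_of_measure_lt
    (hf.integrableOn_isCompact hL).2.ne hε
  obtain ⟨U, hKU, hU, hUδ⟩ := hK.exists_isOpen_lt_add (μ := ρ) hδ.ne'
  have hUL : (U ∩ interior L) \ K ⊆ L :=
    Set.sdiff_subset.trans (Set.inter_subset_right.trans interior_subset)
  have hsmall : ρ.restrict L ((U ∩ interior L) \ K) < δ := by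
    refine (Measure.restrict_apply_le _ _).trans_lt ((measure_mono
      (Set.sdiff_subset_sdiff_left Set.inter_subset_left)).trans_lt ?_)
    rw [measure_sdiff hKU hK.measurableSet.nullMeasurableSet hK.measure_lt_top.ne]
    exact ENNReal.sub_lt_of_lt_add (measure_mono hKU) (by rwa [add_comm] at hUδ)
  refine ⟨U ∩ interior L, hU.inter isOpen_interior, Set.subset_inter hKU hKL, ?_⟩
  have hlt := hδ' _ hsmall
  rwa [Measure.restrict_restrict_of_subset hUL] at hlt

variable [NormedSpace ℝ E]

theorem ae_eq_zero_of_forall_setIntegral_isCompact_eq_zero [ρ.InnerRegularCompactLTTop]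
    [CompleteSpace E] (hf : Integrable f ρ) (h : ∀ K, IsCompact K → ∫ x in K, f x ∂ρ = 0) :
    f =ᵐ[ρ] 0 := by
  refine hf.ae_eq_zero_of_forall_setIntegral_eq_zero fun s hs hsfin =>
    norm_le_zero_iff.1 (le_of_forall_pos_le_add fun ε hε => ?_)
  obtain ⟨δ, hδ, hδ'⟩ := exists_pos_setLIntegral_lt_of_measure_lt (μ := ρ)
    (f := fun x => ‖f x‖ₑ) hf.2.ne (ε := ENNReal.ofReal ε) (by simpa using hε)
  obtain ⟨K, hKs, hK, hKδ⟩ := hs.exists_isCompact_sdiff_lt hsfin.ne hδ.ne'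
  have hsK : ∫ x in s, f x ∂ρ = ∫ x in s \ K, f x ∂ρ := by
    rw [setIntegral_sdiff hK.measurableSet hf.integrableOn hKs, h K hK, sub_zero]
  have hle := (enorm_integral_le_lintegral_enorm (μ := ρ.restrict (s \ K)) f).trans (hδ' _ hKδ).le
  rw [← ofReal_norm] at hle
  rw [hsK, zero_add]
  exact (ENNReal.ofReal_le_ofReal_iff hε.le).1 hle

variable [LocallyCompactSpace X] [ρ.Regular]

theorem exists_cc_norm_integral_smul_sub_setIntegral_le
    (hf : LocallyIntegrable f ρ) {K : Set X} (hK : IsCompact K) {ε : ℝ} (hε : 0 < ε) :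
    ∃ φ : X → ℝ, Continuous φ ∧ HasCompactSupport φ ∧
      ‖∫ x, φ x • f x ∂ρ - ∫ x in K, f x ∂ρ‖ ≤ ε := by
  obtain ⟨U, hU, hKU, hlt⟩ := exists_isOpen_setLIntegral_enorm_sdiff_lt hf hK
    (ε := ENNReal.ofReal ε) (by simpa using hε)
  obtain ⟨φ, h1, h0, hφs, hφ⟩ := exists_continuous_one_zero_of_isCompact hK
    hU.isClosed_compl (Set.disjoint_compl_right_iff_subset.2 hKU)
  refine ⟨φ, φ.continuous, hφs, ?_⟩
  have hpt : ∀ x, ‖φ x • f x - K.indicator f x‖ₑ ≤ (U \ K).indicator (fun x => ‖f x‖ₑ) x := by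
    intro x
    by_cases hxK : x ∈ K
    · simp [hxK, h1 hxK]
    by_cases hxU : x ∈ U
    · have hle : ‖φ x‖ₑ ≤ 1 := by
        rw [Real.enorm_of_nonneg (hφ x).1]
        exact ENNReal.ofReal_le_one.2 (hφ x).2
      simpa [hxK, hxU, enorm_smul] using mul_le_of_le_one_left zero_le hle
    · simp [hxK, hxU, h0 hxU]
  have hle : ‖∫ x, (φ x • f x - K.indicator f x) ∂ρ‖ₑ ≤ ENNReal.ofReal ε :=
    ((enorm_integral_le_lintegral_enorm _).trans (lintegral_mono hpt)).trans <| by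
      rw [lintegral_indicator (hU.measurableSet.diff hK.measurableSet)]
      exact hlt.le
  rw [integral_sub (hf.integrable_smul_left_of_hasCompactSupport φ.continuous hφs)
    ((hf.integrableOn_isCompact hK).integrable_indicator hK.measurableSet),
    integral_indicator hK.measurableSet, ← ofReal_norm] at hle
  exact (ENNReal.ofReal_le_ofReal_iff hε.le).1 hle

theorem ae_eq_zero_restrict_of_forall_integral_smul_eq_zero
    [CompleteSpace E] (hf : LocallyIntegrable f ρ)
    (h : ∀ φ : X → ℝ, Continuous φ → HasCompactSupport φ → ∫ x, φ x • f x ∂ρ = 0)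
    {K : Set X} (hK : IsCompact K) : f =ᵐ[ρ.restrict K] 0 := by
  refine ae_eq_zero_of_forall_setIntegral_isCompact_eq_zero (hf.integrableOn_isCompact hK)
    fun K' hK' => norm_le_zero_iff.1 (le_of_forall_pos_le_add fun ε hε => ?_)
  obtain ⟨φ, hφ, hφs, hle⟩ :=
    exists_cc_norm_integral_smul_sub_setIntegral_le hf (hK'.inter hK) hε
  rw [h φ hφ hφs, zero_sub, norm_neg] at hle
  rwa [Measure.restrict_restrict hK'.measurableSet, zero_add]

end FundamentalLemma

theorem ae_forall_clm_eq_zero {X I E F : Type*} [MeasurableSpace X] {ρ : Measure X}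
    [NormedAddCommGroup E] [NormedSpace ℝ E] [CompleteSpace E]
    [NormedAddCommGroup F] [NormedSpace ℝ F] [CompleteSpace F]
    (T : I → E →L[ℝ] F) {f : X → E} (hf : Integrable f ρ)
    (h : ∀ i, ∀ᵐ x ∂ρ, T i (f x) = 0) : ∀ᵐ x ∂ρ, ∀ i, T i (f x) = 0 := by
  let S : Submodule ℝ E := ⨅ i, (T i).toLinearMap.ker
  have mem_S : ∀ v, v ∈ S ↔ ∀ i, T i v = 0 := fun v => by simp [S]
  have isClosed_S : IsClosed (S : Set E) := by
    have : (S : Set E) = ⋂ i, {v | T i v = 0} := by ext v; simp [mem_S]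
    rw [this]
    exact isClosed_iInter fun i => isClosed_eq (by fun_prop) (by fun_prop)
  -- The index set may be uncountable, so the null sets cannot be collected: all integrals of `f`
  -- lie in `S`, hence `f` vanishes almost everywhere modulo `S`.
  have hmkQ : (fun x => S.mkQL (f x)) =ᵐ[ρ] 0 := by
    refine (S.mkQL.integrable_comp hf).ae_eq_zero_of_forall_setIntegral_eq_zero fun s _ _ => ?_
    rw [S.mkQL.integral_comp_comm hf.integrableOn]
    refine (Submodule.Quotient.mk_eq_zero S).2 ((mem_S _).2 fun i => ?_)
    rw [← (T i).integral_comp_comm hf.integrableOn]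
    exact integral_eq_zero_of_ae (ae_restrict_of_ae (h i))
  filter_upwards [hmkQ] with x hx
  exact (mem_S _).1 ((Submodule.Quotient.mk_eq_zero S).1 hx)

section WeightedLocallyIntegrable

variable {G : Type*} [Group G] [MeasurableSpace G]

theorem Weight.one_le_map_one (w : Weight G) :
    1 ≤ w 1 := by
  have h := w.mul_le' 1 1
  rw [mul_one] at h
  exact le_of_mul_le_mul_right (by simpa using h) (w.pos' 1)

variable {μ : Measure G} {w : Weight G} {E : Type*} [NormedAddCommGroup E] {f : G → E}

theorem setLIntegral_enorm_le_mul_eLpNorm {K : Set G} {C : ℝ≥0} (hC : ∀ x ∈ K, 1 ≤ C * w x)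
    (hK : MeasurableSet K) :
    ∫⁻ x in K, ‖f x‖ₑ ∂μ ≤ C * eLpNorm f 1 (wMeasure μ w) := by
  rw [eLpNorm_one_eq_lintegral_enorm, lintegral_wMeasure,
    ← lintegral_const_mul' _ _ ENNReal.coe_ne_top]
  calc ∫⁻ x in K, ‖f x‖ₑ ∂μ ≤ ∫⁻ x in K, C * (w x * ‖f x‖ₑ) ∂μ := by
        refine setLIntegral_mono' hK fun x hx => ?_
        rw [← mul_assoc]
        exact le_mul_of_one_le_left zero_le (by exact_mod_cast hC x hx)
    _ ≤ ∫⁻ x, C * (w x * ‖f x‖ₑ) ∂μ := setLIntegral_le_lintegral _ _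

variable [TopologicalSpace G] [IsTopologicalGroup G] [LocallyCompactSpace G] [T2Space G]
  [BorelSpace G]

theorem Weight.exists_one_le_mul (w : Weight G) {K : Set G}
    (hK : IsCompact K) : ∃ C : ℝ≥0, ∀ x ∈ K, 1 ≤ C * w x := by
  obtain ⟨C, hC⟩ := w.exists_bound hK.inv
  refine ⟨C, fun x hx => ?_⟩
  calc 1 ≤ w 1 := w.one_le_map_one
    _ = w (x⁻¹ * x) := by rw [inv_mul_cancel]
    _ ≤ w x⁻¹ * w x := w.mul_le' _ _
    _ ≤ C * w x := by gcongr; exact hC _ (Set.inv_mem_inv.2 hx)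

theorem locallyIntegrable_of_memLp_wMeasure (hf : MemLp f 1 (wMeasure μ w)) :
    LocallyIntegrable f μ := by
  refine locallyIntegrable_iff.2 fun K hK => ?_
  obtain ⟨C, hC⟩ := w.exists_one_le_mul hK
  exact ⟨(hf.1.mono_ac (ac_wMeasure μ w)).restrict,
    (setLIntegral_enorm_le_mul_eLpNorm hC hK.measurableSet).trans_lt
      (ENNReal.mul_lt_top ENNReal.coe_lt_top hf.2)⟩

variable [μ.Regular] [NormedSpace ℝ E] [CompleteSpace E]

theorem ae_eq_zero_of_forall_integral_smul_eq_zero (hf : MemLp f 1 (wMeasure μ w))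
    (h : ∀ φ : G → ℝ, Continuous φ → HasCompactSupport φ → ∫ x, φ x • f x ∂μ = 0) :
    f =ᵐ[μ] 0 := by
  refine (ac_wMeasure μ w).ae_le (ae_eq_zero_of_forall_setIntegral_isCompact_eq_zero
    (memLp_one_iff_integrable.1 hf) fun K hK => integral_eq_zero_of_ae ?_)
  exact ((wMeasure_ac μ w).restrict K).ae_le
    (ae_eq_zero_restrict_of_forall_integral_smul_eq_zero
      (locallyIntegrable_of_memLp_wMeasure hf) h hK)

theorem ae_forall_clm_eq_zero_of_forall_integral_smul_eq_zero {I F : Type*}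
    [NormedAddCommGroup F] [NormedSpace ℝ F] [CompleteSpace F] (T : I → E →L[ℝ] F)
    (hf : MemLp f 1 (wMeasure μ w))
    (h : ∀ i, ∀ φ : G → ℝ, Continuous φ → HasCompactSupport φ → ∫ x, φ x • T i (f x) ∂μ = 0) :
    ∀ᵐ x ∂μ, ∀ i, T i (f x) = 0 :=
  (ac_wMeasure μ w).ae_le <| ae_forall_clm_eq_zero T (memLp_one_iff_integrable.1 hf) fun i =>
    (wMeasure_ac μ w).ae_le <|
      ae_eq_zero_of_forall_integral_smul_eq_zero ((T i).comp_memLp' hf) (h i)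

end WeightedLocallyIntegrable

section Convolution

theorem continuous_integral_smul_of_hasCompactSupport_locally {X Y E : Type*} [TopologicalSpace X]
    [LocallyCompactSpace X] [TopologicalSpace Y] [MeasurableSpace Y] [OpensMeasurableSpace Y]
    [NormedAddCommGroup E] [NormedSpace ℝ E] {μ : Measure Y} {h : Y → E}
    (hh : LocallyIntegrable h μ) {κ : X → Y → ℝ} (hκ : Continuous κ.uncurry)
    (hs : ∀ s, IsCompact s → ∃ k, IsCompact k ∧ ∀ x y, x ∈ s → y ∉ k → κ x y = 0) :
    Continuous fun x => ∫ y, κ x y • h y ∂μ := by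
  refine continuous_iff_continuousAt.2 fun x₀ => ?_
  obtain ⟨s, hsc, hs1⟩ := exists_compact_mem_nhds x₀
  obtain ⟨k, hk, hk0⟩ := hs s hsc
  exact (continuousOn_integral_bilinear_of_locally_integrable_of_compact_support
    (ContinuousLinearMap.lsmul ℝ ℝ).flip hk hκ.continuousOn hk0
    (hh.integrableOn_isCompact hk)).continuousAt hs1

variable {G : Type*} [Group G] [TopologicalSpace G] [IsTopologicalGroup G] [MeasurableSpace G]
  [BorelSpace G] {μ : Measure G}
  {A : Type*} [NonUnitalNormedRing A] [NormedSpace ℂ A] [IsScalarTower ℂ A A]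

theorem smul_const_conv [μ.IsInvInvariant] (f : G → A) (φ : G → ℝ) (a : A) :
    conv μ (fun x => φ x • a) f = fun x => ∫ y, φ (x * y⁻¹) • (a * f y) ∂μ := by
  funext x
  rw [conv, ← integral_inv_eq_self]
  simp only [smul_mul_assoc, inv_inv]

variable [LocallyCompactSpace G] [T2Space G] [SMulCommClass ℂ A A] [μ.IsHaarMeasure] [μ.Regular]

theorem conv_smul_const (f : G → A) (φ : G → ℝ) (a : A) :
    conv μ f (fun x => φ x • a) = fun x => ∫ y, φ (y⁻¹ * x) • (f y * a) ∂μ := by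
  funext x
  simp only [conv_eq μ, mul_smul_comm]

end Convolution

/-- A function is almost everywhere invariant under each single conjugation. The null set may
depend on the conjugating element, so this is weaker than agreeing almost everywhere with a class
function. -/
def AEConjInvariant {G E : Type*} [Group G] [MeasurableSpace G] (μ : Measure G) (f : G → E) :
    Prop :=
  ∀ z : G, ∀ᵐ x ∂μ, f (z * x * z⁻¹) = f x

section Conjugation

variable {G : Type*} [Group G] [MeasurableSpace G] {w : Weight G}

theorem Weight.le_mul_map_conj (w : Weight G) (z x : G) :
    w x ≤ w z⁻¹ * w z * w (z * x * z⁻¹) := by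
  calc w x = w (z⁻¹ * (z * x * z⁻¹) * z) := by congr 1; group
    _ ≤ w z⁻¹ * w (z * x * z⁻¹) * w z :=
      (w.mul_le' _ _).trans (mul_le_mul_left (w.mul_le' _ _) _)
    _ = w z⁻¹ * w z * w (z * x * z⁻¹) := by ring

theorem memLp_comp_conj [TopologicalSpace G] [IsTopologicalGroup G] [BorelSpace G]
    {μ : Measure G} [μ.IsMulLeftInvariant] [μ.IsMulRightInvariant] {E : Type*}
    [NormedAddCommGroup E] {f : G → E} (hf : MemLp f 1 (wMeasure μ w)) (z : G) :
    MemLp (fun x => f (z * x * z⁻¹)) 1 (wMeasure μ w) := by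
  have hz := measurePreserving_conj μ z
  refine ⟨((hf.1.mono_ac (ac_wMeasure μ w)).comp_measurePreserving hz).mono_ac
    (wMeasure_ac μ w), ?_⟩
  have hlt := hf.2
  rw [eLpNorm_one_eq_lintegral_enorm, lintegral_wMeasure] at hlt ⊢
  rw [← hz.lintegral_comp_emb (measurableEmbedding_conj z)] at hlt
  calc ∫⁻ x, w x * ‖f (z * x * z⁻¹)‖ₑ ∂μ
      ≤ ∫⁻ x, (w z⁻¹ * w z : ℝ≥0) * (w (z * x * z⁻¹) * ‖f (z * x * z⁻¹)‖ₑ) ∂μ := by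
        refine lintegral_mono fun x => ?_
        rw [← mul_assoc]
        gcongr
        rw [← ENNReal.coe_mul]
        exact ENNReal.coe_le_coe.2 (w.le_mul_map_conj z x)
    _ < ∞ := by
        rw [lintegral_const_mul' _ _ ENNReal.coe_ne_top]
        exact ENNReal.mul_lt_top ENNReal.coe_lt_top hlt

end Conjugation

section Center

variable {G : Type*} [Group G] [TopologicalSpace G] [IsTopologicalGroup G] [T2Space G]
  [LocallyCompactSpace G] [MeasurableSpace G] [BorelSpace G]
  {μ : Measure G} [μ.IsHaarMeasure] [μ.Regular] {w : Weight G}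
  {A : Type*} [NonUnitalNormedRing A] [NormedSpace ℂ A] [IsScalarTower ℂ A A]
  [SMulCommClass ℂ A A]

theorem conv_comm_of_aeConjInvariant [μ.IsMulRightInvariant] {f g : G → A}
    (hg : AEConjInvariant μ g) (hgZ : ∀ᵐ x ∂μ, g x ∈ Z A) : conv μ f g = conv μ g f := by
  have : μ.IsInvInvariant := isInvInvariant_of_isMulRightInvariant μ
  funext x
  rw [conv_eq μ g f, conv, ← integral_inv_eq_self,
    ← (measurePreserving_conj μ x⁻¹).integral_comp (measurableEmbedding_conj x⁻¹)]
  refine integral_congr_ae ?_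
  filter_upwards [hg x⁻¹, hgZ] with y hy hyZ
  rw [inv_inv (x⁻¹ * y * x⁻¹⁻¹), hy, (mem_Z_iff _ _).1 hyZ]
  congr 2
  group

variable [CompleteSpace A]

theorem conv_ae_comm_of_mem_center {F : L1w μ w A} (hF : F ∈ Z (L1w μ w A)) {g : G → A}
    (hg : MemLp g 1 (wMeasure μ w)) : conv μ (F : G → A) g =ᵐ[μ] conv μ g F := by
  have hcomm := (mem_Z_iff _ F).1 hF (L1w.mk g hg)
  calc conv μ (F : G → A) g =ᵐ[μ] (F * L1w.mk g hg : L1w μ w A) :=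
        (L1w.conv_congr (ae_eq_refl _) (L1w.coe_mk g hg)).symm
    _ =ᵐ[μ] (L1w.mk g hg * F : L1w μ w A) := by rw [hcomm]
    _ =ᵐ[μ] conv μ g F := L1w.conv_congr (L1w.coe_mk g hg) (ae_eq_refl _)

variable [μ.IsMulRightInvariant]

theorem integral_smul_mul_comm_of_mem_center {F : L1w μ w A} (hF : F ∈ Z (L1w μ w A))
    {φ : G → ℝ} (hφ : Continuous φ) (hφs : HasCompactSupport φ) (a : A) (x : G) :
    ∫ y, φ (y⁻¹ * x) • (F y * a) ∂μ = ∫ y, φ (x * y⁻¹) • (a * F y) ∂μ := by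
  have : μ.IsInvInvariant := isInvInvariant_of_isMulRightInvariant μ
  have hae : (fun x => ∫ y, φ (y⁻¹ * x) • (F y * a) ∂μ) =ᵐ[μ]
      fun x => ∫ y, φ (x * y⁻¹) • (a * F y) ∂μ := by
    rw [← conv_smul_const, ← smul_const_conv]
    refine conv_ae_comm_of_mem_center hF ?_
    exact Continuous.memLp_of_hasCompactSupport (by fun_prop) hφs.smul_right
  refine congrFun ((Continuous.ae_eq_iff_eq μ ?_ ?_).1 hae) x
  · refine continuous_integral_smul_of_hasCompactSupport_locally (κ := fun x y => φ (y⁻¹ * x))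
      (locallyIntegrable_of_memLp_wMeasure
        (((ContinuousLinearMap.mul ℂ A).flip a).comp_memLp' F.memLp))
      (by simp only [Function.uncurry_def]; fun_prop)
      fun s hs => ⟨s * (tsupport φ)⁻¹, hs.mul hφs.isCompact.inv, fun x y hx hy => ?_⟩
    by_contra hne
    exact hy ⟨x, hx, x⁻¹ * y, by simpa using subset_tsupport _ hne, by simp⟩
  · refine continuous_integral_smul_of_hasCompactSupport_locally (κ := fun x y => φ (x * y⁻¹))
      (locallyIntegrable_of_memLp_wMeasure ((ContinuousLinearMap.mul ℂ A a).comp_memLp' F.memLp))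
      (by simp only [Function.uncurry_def]; fun_prop)
      fun s hs => ⟨(tsupport φ)⁻¹ * s, hφs.isCompact.inv.mul hs, fun x y hx hy => ?_⟩
    by_contra hne
    exact hy ⟨y * x⁻¹, by simpa using subset_tsupport _ hne, x, hx, by simp⟩

theorem integral_smul_mul_conj_of_mem_center {F : L1w μ w A} (hF : F ∈ Z (L1w μ w A))
    {ψ : G → ℝ} (hψ : Continuous ψ) (hψs : HasCompactSupport ψ) (a : A) (z : G) :
    ∫ y, ψ y • (a * F (z * y * z⁻¹)) ∂μ = ∫ y, ψ y • (F y * a) ∂μ := by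
  have hφs : HasCompactSupport fun t => ψ (z⁻¹ * t⁻¹) :=
    hψs.comp_homeomorph ((Homeomorph.inv G).trans (Homeomorph.mulLeft z⁻¹))
  have h := integral_smul_mul_comm_of_mem_center hF (φ := fun t => ψ (z⁻¹ * t⁻¹))
    (by fun_prop) hφs a z⁻¹
  rw [← (measurePreserving_conj μ z).integral_comp (measurableEmbedding_conj z)
    fun y => ψ (z⁻¹ * (z⁻¹ * y⁻¹)⁻¹) • (a * F y)] at h
  have hleft : ∀ y : G, z⁻¹ * (y⁻¹ * z⁻¹)⁻¹ = y := fun y => by group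
  have hright : ∀ y : G, z⁻¹ * (z⁻¹ * (z * y * z⁻¹)⁻¹)⁻¹ = y := fun y => by group
  simp only [hleft, hright] at h
  exact h.symm

theorem ae_mem_center_of_mem_center {F : L1w μ w A} (hF : F ∈ Z (L1w μ w A)) :
    ∀ᵐ x ∂μ, F x ∈ Z A := by
  let L := ContinuousLinearMap.mul ℝ A
  have h := ae_forall_clm_eq_zero_of_forall_integral_smul_eq_zero (fun a => L a - L.flip a)
    F.memLp fun a ψ hψ hψs => by
      have hcomm := integral_smul_mul_conj_of_mem_center hF hψ hψs a 1
      simp only [one_mul, inv_one, mul_one] at hcomm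
      simp only [L, sub_apply, ContinuousLinearMap.mul_apply',
        ContinuousLinearMap.flip_apply, smul_sub]
      rw [integral_sub, hcomm, sub_self]
      · exact (locallyIntegrable_of_memLp_wMeasure
          ((L a).comp_memLp' F.memLp)).integrable_smul_left_of_hasCompactSupport hψ hψs
      · exact (locallyIntegrable_of_memLp_wMeasure
          ((L.flip a).comp_memLp' F.memLp)).integrable_smul_left_of_hasCompactSupport hψ hψs
  filter_upwards [h] with x hx
  exact (mem_Z_iff _ _).2 fun a => sub_eq_zero.1 (hx a)

theorem aeConjInvariant_of_mem_center (hA : ∀ z ∈ Z A, (∀ a, a * z = 0) → z = 0)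
    {F : L1w μ w A} (hF : F ∈ Z (L1w μ w A)) : AEConjInvariant μ F := by
  intro z
  let L := ContinuousLinearMap.mul ℝ A
  have hZ := ae_mem_center_of_mem_center hF
  have hm := memLp_comp_conj F.memLp z
  have h := ae_forall_clm_eq_zero_of_forall_integral_smul_eq_zero L (hm.sub F.memLp)
    fun a ψ hψ hψs => by
      have hcomm : ∫ y, ψ y • (F y * a) ∂μ = ∫ y, ψ y • (a * F y) ∂μ := by
        refine integral_congr_ae ?_
        filter_upwards [hZ] with y hy
        rw [(mem_Z_iff _ _).1 hy a]
      simp only [L, Pi.sub_apply, map_sub, ContinuousLinearMap.mul_apply', smul_sub]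
      rw [integral_sub, integral_smul_mul_conj_of_mem_center hF hψ hψs, hcomm, sub_self]
      · exact (locallyIntegrable_of_memLp_wMeasure
          ((L a).comp_memLp' hm)).integrable_smul_left_of_hasCompactSupport hψ hψs
      · exact (locallyIntegrable_of_memLp_wMeasure
          ((L a).comp_memLp' F.memLp)).integrable_smul_left_of_hasCompactSupport hψ hψs
  filter_upwards [h, hZ, (measurePreserving_conj μ z).quasiMeasurePreserving.ae hZ]
    with x hx hx1 hx2
  exact sub_eq_zero.1 (hA _ (sub_mem hx2 hx1) hx)

theorem mem_center_iff (hA : ∀ z ∈ Z A, (∀ a, a * z = 0) → z = 0) {F : L1w μ w A} :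
    F ∈ Z (L1w μ w A) ↔ AEConjInvariant μ F ∧ ∀ᵐ x ∂μ, F x ∈ Z A := by
  refine ⟨fun hF => ⟨aeConjInvariant_of_mem_center hA hF, ae_mem_center_of_mem_center hF⟩, ?_⟩
  rintro ⟨hF, hFZ⟩
  refine (mem_Z_iff _ _).2 fun f => L1w.ext ?_
  calc (f * F : L1w μ w A) =ᵐ[μ] conv μ f F := L1w.coe_mul f F
    _ = conv μ F f := conv_comm_of_aeConjInvariant hF hFZ
    _ =ᵐ[μ] (F * f : L1w μ w A) := (L1w.coe_mul F f).symm

end Center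

section Translation

variable {G : Type*} [Group G] {E : Type*} [NormedAddCommGroup E]

theorem sub_translate_eq_zero_of_notMem [TopologicalSpace G] {g : G → E} {s : Set G} {x y : G}
    (hy : y ∈ s) (hx : x ∉ s * tsupport g ∪ tsupport g) : g (y⁻¹ * x) - g x = 0 := by
  have hgx : g x = 0 := image_eq_zero_of_notMem_tsupport fun h => hx (Or.inr h)
  have hgyx : g (y⁻¹ * x) = 0 :=
    image_eq_zero_of_notMem_tsupport fun h => hx (Or.inl ⟨y, hy, y⁻¹ * x, h, by simp⟩)
  rw [hgx, hgyx, sub_zero]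

variable [MeasurableSpace G]

/-- The distance in `L¹_w` of `f` and its left translate by `y`. -/
noncomputable def translationDist (μ : Measure G) (w : Weight G) (f : G → E) (y : G) : ℝ≥0∞ :=
  eLpNorm (fun x => f (y⁻¹ * x) - f x) 1 (wMeasure μ w)

variable [TopologicalSpace G] [IsTopologicalGroup G] [BorelSpace G]
  {μ : Measure G} [μ.IsMulLeftInvariant] {w : Weight G} {f g : G → E}

theorem eLpNorm_translate_le (f : G → E) (y : G) :
    eLpNorm (fun x => f (y⁻¹ * x)) 1 (wMeasure μ w) ≤ w y * eLpNorm f 1 (wMeasure μ w) := by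
  simp only [eLpNorm_one_eq_lintegral_enorm, lintegral_wMeasure]
  rw [← lintegral_mul_left_eq_self _ y, ← lintegral_const_mul' _ _ ENNReal.coe_ne_top]
  refine lintegral_mono fun x => ?_
  simp only [inv_mul_cancel_left]
  rw [← mul_assoc, ← ENNReal.coe_mul]
  gcongr
  exact w.mul_le' y x

theorem aestronglyMeasurable_translate (hf : AEStronglyMeasurable f (wMeasure μ w)) (y : G) :
    AEStronglyMeasurable (fun x => f (y⁻¹ * x)) (wMeasure μ w) :=
  ((hf.mono_ac (ac_wMeasure μ w)).comp_measurePreserving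
    (measurePreserving_mul_left μ y⁻¹)).mono_ac (wMeasure_ac μ w)

theorem translationDist_le_add (hf : AEStronglyMeasurable f (wMeasure μ w))
    (hg : AEStronglyMeasurable g (wMeasure μ w)) (y : G) :
    translationDist μ w f y ≤
      translationDist μ w g y + (w y + 1) * eLpNorm (f - g) 1 (wMeasure μ w) := by
  have hsplit : (fun x => f (y⁻¹ * x) - f x) =
      (fun x => g (y⁻¹ * x) - g x) + ((fun x => (f - g) (y⁻¹ * x)) - (f - g)) := by
    funext x
    simp only [Pi.add_apply, Pi.sub_apply]
    abel
  have hg_sub := (aestronglyMeasurable_translate hg y).sub hg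
  have hfg := aestronglyMeasurable_translate (hf.sub hg) y
  calc translationDist μ w f y
      ≤ translationDist μ w g y +
          eLpNorm ((fun x => (f - g) (y⁻¹ * x)) - (f - g)) 1 (wMeasure μ w) := by
        rw [translationDist, hsplit]
        exact eLpNorm_add_le hg_sub (hfg.sub (hf.sub hg)) le_rfl
    _ ≤ _ := by
        rw [add_mul, one_mul]
        gcongr
        refine (eLpNorm_sub_le hfg (hf.sub hg) le_rfl).trans ?_
        gcongr
        exact eLpNorm_translate_le (f - g) y

theorem measurePreserving_conj_wMeasure [μ.IsMulRightInvariant] (hw : w.IsClassFunction) (z : G) :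
    MeasurePreserving (fun x => z * x * z⁻¹) (wMeasure μ w) (wMeasure μ w) := by
  have hz := measurableEmbedding_conj z
  refine ⟨hz.measurable, ?_⟩
  ext s hs
  rw [hz.map_apply, wMeasure, withDensity_apply _ hs, withDensity_apply _ (hz.measurable hs),
    ← (measurePreserving_conj μ z).setLIntegral_comp_preimage_emb hz (fun x => (w x : ℝ≥0∞)) s]
  simp only [hw _ z]

theorem translationDist_conj [μ.IsMulRightInvariant] (hw : w.IsClassFunction)
    (hfm : AEStronglyMeasurable f (wMeasure μ w)) (hf : AEConjInvariant μ f) (z y : G) :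
    translationDist μ w f (z * y * z⁻¹) = translationDist μ w f y := by
  refine (eLpNorm_comp_measurePreserving (p := 1)
    ((aestronglyMeasurable_translate hfm (z * y * z⁻¹)).sub hfm)
    (measurePreserving_conj_wMeasure (μ := μ) hw z)).symm.trans ?_
  refine eLpNorm_congr_ae ((wMeasure_ac μ w).ae_le ?_)
  filter_upwards [hf z, (measurePreserving_mul_left μ y⁻¹).quasiMeasurePreserving.ae (hf z)]
    with x hx hyx
  simp only [Function.comp_apply, Pi.sub_apply]
  rw [hx, ← hyx]
  congr 2
  group

end Translation

section TranslationContinuity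

variable {G : Type*} [Group G] [TopologicalSpace G] [IsTopologicalGroup G] [T2Space G]
  [LocallyCompactSpace G] [MeasurableSpace G] [BorelSpace G]
  {μ : Measure G} [μ.IsHaarMeasure] {w : Weight G} {E : Type*} [NormedAddCommGroup E]

theorem eventually_translationDist_le_of_hasCompactSupport {g : G → E} (hg : Continuous g)
    (hgs : HasCompactSupport g) {ε : ℝ≥0∞} (hε : ε ≠ 0) :
    ∀ᶠ y in 𝓝 (1 : G), translationDist μ w g y ≤ ε := by
  rcases eq_or_ne ε ∞ with rfl | hε'
  · simp
  obtain ⟨s, hs, hs1⟩ := exists_compact_mem_nhds (1 : G)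
  have hk : IsCompact (s * tsupport g ∪ tsupport g) := (hs.mul hgs.isCompact).union hgs.isCompact
  have hcont : ContinuousOn (fun y => ∫ x, ‖g (y⁻¹ * x) - g x‖ ∂(wMeasure μ w)) s :=
    continuousOn_integral_of_compact_support hk (f := fun y x => ‖g (y⁻¹ * x) - g x‖)
      (Continuous.continuousOn (by simp only [Function.uncurry_def]; fun_prop))
      fun y x hy hx => by rw [sub_translate_eq_zero_of_notMem hy hx, norm_zero]
  have hlim := (hcont.continuousAt hs1).tendsto
  simp only [inv_one, one_mul, sub_self, norm_zero, integral_zero] at hlim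
  filter_upwards [hs1, hlim.eventually (gt_mem_nhds (ENNReal.toReal_pos hε hε'))] with y hy hlt
  have hint : Integrable (fun x => g (y⁻¹ * x) - g x) (wMeasure μ w) :=
    Continuous.integrable_of_hasCompactSupport (by fun_prop)
      (HasCompactSupport.intro hk fun x hx => sub_translate_eq_zero_of_notMem hy hx)
  rw [translationDist, eLpNorm_one_eq_lintegral_enorm,
    ← ofReal_integral_norm_eq_lintegral_enorm hint]
  exact ENNReal.ofReal_le_of_le_toReal hlt.le

theorem eventually_translationDist_le [μ.Regular] [NormedSpace ℝ E] {f : G → E}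
    (hf : MemLp f 1 (wMeasure μ w)) {ε : ℝ≥0∞} (hε : ε ≠ 0) :
    ∀ᶠ y in 𝓝 (1 : G), translationDist μ w f y ≤ ε := by
  obtain ⟨U, hU, C, hC⟩ := w.exists_nhds_one_bound
  obtain ⟨g, hfg, hg, hgs⟩ := exists_cc_approx μ w hf (ε := ε / 2 / (C + 1))
    (by simp [ENNReal.div_eq_zero_iff, hε])
  filter_upwards [hU, eventually_translationDist_le_of_hasCompactSupport (μ := μ) (w := w) hg hgs
    (ENNReal.half_pos hε).ne'] with y hy hgy
  calc translationDist μ w f y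
      ≤ translationDist μ w g y + (w y + 1) * eLpNorm (f - g) 1 (wMeasure μ w) :=
        translationDist_le_add hf.1
          (hg.stronglyMeasurable_of_hasCompactSupport hgs).aestronglyMeasurable y
    _ ≤ ε / 2 + (C + 1) * (ε / 2 / (C + 1)) := by
        gcongr
        exact hC y hy
    _ ≤ ε / 2 + ε / 2 := by
        gcongr
        exact ENNReal.mul_div_le
    _ = ε := ENNReal.add_halves ε

end TranslationContinuity

section TranslateIntegrable

variable {G : Type*} [Group G] [TopologicalSpace G] [IsTopologicalGroup G] [T2Space G]
  [LocallyCompactSpace G] [MeasurableSpace G] [BorelSpace G]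
  {μ : Measure G} [μ.IsHaarMeasure] [μ.Regular] [μ.IsMulRightInvariant] {w : Weight G}
  {E : Type*} [NormedAddCommGroup E] {W : Set G}

theorem integrableOn_inv_mul (hW : IsCompact (closure W)) {f : G → E}
    (hf : MemLp f 1 (wMeasure μ w)) (x : G) : IntegrableOn (fun y => f (y⁻¹ * x)) W μ := by
  have hK : IsCompact ((fun y => y⁻¹ * x) '' closure W) := hW.image (by fun_prop)
  refine IntegrableOn.mono_set (((measurePreserving_inv_mul μ x).integrableOn_comp_preimage
    (measurableEmbedding_inv_mul x)).2 ((locallyIntegrable_of_memLp_wMeasure hf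
      ).integrableOn_isCompact hK)) ?_
  exact fun y hy => Set.mem_image_of_mem _ (subset_closure hy)

end TranslateIntegrable

section Average

theorem eLpNorm_integral_le_lintegral_eLpNorm {X Y E : Type*} [TopologicalSpace X]
    [TopologicalSpace Y] [MeasurableSpace X] [MeasurableSpace Y] [BorelSpace X] [BorelSpace Y]
    [NormedAddCommGroup E] [NormedSpace ℝ E]
    (ν : Measure X) [IsFiniteMeasureOnCompacts ν] (ρ : Measure Y) [IsFiniteMeasureOnCompacts ρ]
    {F : X → Y → E} (hF : Continuous F.uncurry) (hFs : HasCompactSupport F.uncurry) :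
    eLpNorm (fun x => ∫ y, F x y ∂ρ) 1 ν ≤ ∫⁻ y, eLpNorm (F · y) 1 ν ∂ρ := by
  set K := Prod.fst '' tsupport F.uncurry
  set L := Prod.snd '' tsupport F.uncurry
  have hK : IsCompact K := hFs.isCompact.image continuous_fst
  have hL : IsCompact L := hFs.isCompact.image continuous_snd
  have hF0 : ∀ x y, F x y ≠ 0 → x ∈ K ∧ y ∈ L := fun x y h =>
    have hxy : (x, y) ∈ tsupport F.uncurry := subset_tsupport _ h
    ⟨⟨_, hxy, rfl⟩, ⟨_, hxy, rfl⟩⟩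
  have hFm : Measurable fun p : X × Y => ‖F p.1 p.2‖ₑ := by
    have h : Measurable fun p : X × Y => ‖F p.1 p.2‖ := hFs.norm.measurable_of_prod hF.norm
    simpa only [ofReal_norm] using h.ennreal_ofReal
  have : IsFiniteMeasure (ν.restrict K) := ⟨by simpa using hK.measure_lt_top⟩
  have : IsFiniteMeasure (ρ.restrict L) := ⟨by simpa using hL.measure_lt_top⟩
  simp only [eLpNorm_one_eq_lintegral_enorm]
  calc ∫⁻ x, ‖∫ y, F x y ∂ρ‖ₑ ∂ν
      ≤ ∫⁻ x, ∫⁻ y, ‖F x y‖ₑ ∂ρ ∂ν := lintegral_mono fun x => enorm_integral_le_lintegral_enorm _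
    _ = ∫⁻ x, ∫⁻ y in L, ‖F x y‖ₑ ∂ρ ∂ν := lintegral_congr fun x =>
        (setLIntegral_eq_of_support_subset fun y hy => (hF0 x y (by simpa using hy)).2).symm
    _ = ∫⁻ x in K, ∫⁻ y in L, ‖F x y‖ₑ ∂ρ ∂ν := by
        refine (setLIntegral_eq_of_support_subset fun x hx => ?_).symm
        by_contra hxK
        have h0 : ∀ y, F x y = 0 := fun y => by_contra fun h => hxK (hF0 x y h).1
        exact hx (by simp [h0])
    _ = ∫⁻ y in L, ∫⁻ x in K, ‖F x y‖ₑ ∂ν ∂ρ := lintegral_lintegral_swap hFm.aemeasurable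
    _ ≤ ∫⁻ y, ∫⁻ x, ‖F x y‖ₑ ∂ν ∂ρ :=
        (setLIntegral_le_lintegral _ _).trans
          (lintegral_mono fun y => setLIntegral_le_lintegral _ _)

variable {G : Type*} [Group G] [MeasurableSpace G] {E : Type*} [NormedAddCommGroup E]
  [NormedSpace ℝ E]

/-- The average of the left translates of `f` by the elements of `W`. -/
noncomputable def translationAverage (μ : Measure G) (W : Set G) (f : G → E) (x : G) : E :=
  ⨍ y in W, f (y⁻¹ * x) ∂μ

theorem translationAverage_sub [CompleteSpace E] {μ : Measure G} {W : Set G} (hW0 : μ W ≠ 0)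
    (hW : μ W ≠ ∞) {f : G → E} {x : G} (hf : IntegrableOn (fun y => f (y⁻¹ * x)) W μ) :
    translationAverage μ W f x - f x = ⨍ y in W, (f (y⁻¹ * x) - f x) ∂μ := by
  have hW' : μ.real W ≠ 0 := (ENNReal.toReal_pos hW0 hW).ne'
  rw [translationAverage, setAverage_eq, setAverage_eq, integral_sub hf (integrableOn_const hW),
    smul_sub, setIntegral_const, inv_smul_smul₀ hW']

variable [TopologicalSpace G] [IsTopologicalGroup G] {μ : Measure G} {W : Set G}

theorem hasCompactSupport_translationAverage (hW : IsCompact (closure W)) {g : G → E}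
    (hg : HasCompactSupport g) : HasCompactSupport (translationAverage μ W g) := by
  refine HasCompactSupport.intro (hW.mul hg.isCompact) fun x hx => ?_
  rw [translationAverage, setAverage_eq, setIntegral_eq_zero_of_forall_eq_zero, smul_zero]
  refine fun y hy => image_eq_zero_of_notMem_tsupport fun h => hx ?_
  exact ⟨y, subset_closure hy, y⁻¹ * x, h, by simp⟩

variable [LocallyCompactSpace G] [BorelSpace G]

theorem continuous_translationAverage [IsFiniteMeasureOnCompacts μ] {g : G → E} (hg : Continuous g)
    (hgs : HasCompactSupport g) : Continuous (translationAverage μ W g) := by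
  have heq : translationAverage μ W g = fun x => (μ.real W)⁻¹ • ∫ y in W, g (y⁻¹ * x) ∂μ :=
    funext fun x => setAverage_eq _ _ _
  rw [heq]
  refine Continuous.const_smul (continuous_iff_continuousAt.2 fun x₀ => ?_) _
  obtain ⟨s, hs, hs1⟩ := exists_compact_mem_nhds x₀
  refine (continuousOn_integral_of_compact_support (hs.mul hgs.isCompact.inv)
    (f := fun x y => g (y⁻¹ * x)) (Continuous.continuousOn ?_) ?_).continuousAt hs1
  · simp only [Function.uncurry_def]
    fun_prop
  · refine fun x y hx hy => image_eq_zero_of_notMem_tsupport fun h => hy ?_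
    exact ⟨x, hx, x⁻¹ * y, by simpa using h, by simp⟩

variable [μ.IsHaarMeasure] [μ.Regular] [μ.IsMulRightInvariant] {w : Weight G}

theorem translationAverage_conj
    (hW : ∀ z : G, (fun x => z * x * z⁻¹) ⁻¹' W = W) {f : G → E} (hf : AEConjInvariant μ f)
    (x z : G) : translationAverage μ W f (z * x * z⁻¹) = translationAverage μ W f x := by
  rw [translationAverage, translationAverage, setAverage_eq, setAverage_eq,
    ← (measurePreserving_conj μ z).setIntegral_preimage_emb (measurableEmbedding_conj z), hW]
  congr 1
  refine integral_congr_ae (ae_restrict_of_ae ?_)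
  filter_upwards [(measurePreserving_inv_mul μ x).quasiMeasurePreserving.ae (hf z)] with y hy
  rw [← hy]
  congr 1
  group

theorem tendsto_translationAverage [T2Space G] (hW : IsCompact (closure W)) {f : G → E}
    {g : ℕ → G → E} (hf : MemLp f 1 (wMeasure μ w)) (hg : ∀ n, MemLp (g n) 1 (wMeasure μ w))
    (hlim : Tendsto (fun n => eLpNorm (f - g n) 1 (wMeasure μ w)) atTop (𝓝 0)) (x : G) :
    Tendsto (fun n => translationAverage μ W (g n) x) atTop (𝓝 (translationAverage μ W f x)) := by
  simp only [translationAverage, setAverage_eq]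
  refine Tendsto.const_smul ?_ _
  set K : Set G := (fun y : G => y⁻¹ * x) '' closure W
  have hK : IsCompact K := hW.image (by fun_prop)
  have hWK : W ⊆ (fun y : G => y⁻¹ * x) ⁻¹' K := fun y hy =>
    Set.mem_image_of_mem _ (subset_closure hy)
  obtain ⟨C, hC⟩ := w.exists_one_le_mul hK
  refine tendsto_integral_of_L1' _ (integrableOn_inv_mul hW hf x).1
    (Eventually.of_forall fun n => integrableOn_inv_mul hW (hg n) x) ?_
  have hbound : Tendsto (fun n => C * eLpNorm (f - g n) 1 (wMeasure μ w)) atTop (𝓝 0) := by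
    simpa using ENNReal.Tendsto.const_mul hlim (Or.inr ENNReal.coe_ne_top)
  refine tendsto_of_tendsto_of_tendsto_of_le_of_le tendsto_const_nhds hbound (fun _ => zero_le)
    fun n => ?_
  calc eLpNorm (fun y => g n (y⁻¹ * x) - f (y⁻¹ * x)) 1 (μ.restrict W)
      = ∫⁻ y in W, ‖(f - g n) (y⁻¹ * x)‖ₑ ∂μ := by
        simp only [eLpNorm_one_eq_lintegral_enorm, Pi.sub_apply, enorm_sub_rev]
    _ ≤ ∫⁻ y in (fun y => y⁻¹ * x) ⁻¹' K, ‖(f - g n) (y⁻¹ * x)‖ₑ ∂μ := lintegral_mono_set hWK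
    _ = ∫⁻ y in K, ‖(f - g n) y‖ₑ ∂μ :=
        (measurePreserving_inv_mul μ x).setLIntegral_comp_preimage_emb
          (measurableEmbedding_inv_mul x) (fun y => ‖(f - g n) y‖ₑ) K
    _ ≤ C * eLpNorm (f - g n) 1 (wMeasure μ w) :=
        setLIntegral_enorm_le_mul_eLpNorm hC hK.measurableSet

end Average

section AverageApproximation

variable {G : Type*} [Group G] [TopologicalSpace G] [IsTopologicalGroup G] [T2Space G]
  [LocallyCompactSpace G] [MeasurableSpace G] [BorelSpace G]
  {μ : Measure G} [μ.IsHaarMeasure] {w : Weight G} {E : Type*} [NormedAddCommGroup E]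
  [NormedSpace ℝ E] {W : Set G}

theorem exists_seq_hasCompactSupport_tendsto [μ.Regular] {f : G → E}
    (hf : MemLp f 1 (wMeasure μ w)) :
    ∃ g : ℕ → G → E, (∀ n, Continuous (g n)) ∧ (∀ n, HasCompactSupport (g n)) ∧
      Tendsto (fun n => eLpNorm (f - g n) 1 (wMeasure μ w)) atTop (𝓝 0) := by
  choose g hfg hg hgs using fun n : ℕ => exists_cc_approx μ w hf (ε := (2⁻¹ : ℝ≥0∞) ^ n)
    (pow_ne_zero n (by simp))
  exact ⟨g, hg, hgs, tendsto_of_tendsto_of_tendsto_of_le_of_le tendsto_const_nhds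
    (ENNReal.tendsto_pow_atTop_nhds_zero_of_lt_one (by simp)) (fun _ => zero_le) hfg⟩

theorem stronglyMeasurable_translationAverage [μ.Regular] [μ.IsMulRightInvariant]
    (hW : IsCompact (closure W)) {f : G → E} (hf : MemLp f 1 (wMeasure μ w)) :
    StronglyMeasurable (translationAverage μ W f) := by
  obtain ⟨g, hg, hgs, hlim⟩ := exists_seq_hasCompactSupport_tendsto hf
  refine stronglyMeasurable_of_tendsto atTop (fun n => ?_) (tendsto_pi_nhds.2
    (tendsto_translationAverage hW hf (fun n => (hg n).memLp_of_hasCompactSupport (hgs n)) hlim))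
  exact (continuous_translationAverage (hg n) (hgs n)).stronglyMeasurable_of_hasCompactSupport
    (hasCompactSupport_translationAverage hW (hgs n))

variable [CompleteSpace E]

theorem eLpNorm_translationAverage_sub_le_of_hasCompactSupport (hW : IsCompact (closure W))
    (hWm : MeasurableSet W) (hW0 : μ W ≠ 0) {g : G → E} (hg : Continuous g)
    (hgs : HasCompactSupport g) {c : ℝ≥0∞} (hc : ∀ y ∈ W, translationDist μ w g y ≤ c) :
    eLpNorm (translationAverage μ W g - g) 1 (wMeasure μ w) ≤ c := by
  obtain ⟨χ, hχ1, -, hχs, -⟩ := exists_continuous_one_zero_of_isCompact hW isClosed_empty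
    (Set.disjoint_empty _)
  have hWfin : μ W ≠ ∞ := ((measure_mono subset_closure).trans_lt hW.measure_lt_top).ne
  have : IsFiniteMeasure (μ.restrict W) := ⟨by simpa using hWfin.lt_top⟩
  have : NeZero (μ.restrict W) := ⟨by simpa [Measure.restrict_eq_zero] using hW0⟩
  set ρ := (μ.restrict W Set.univ)⁻¹ • μ.restrict W
  have hρW : ∀ᵐ y ∂ρ, y ∈ W := Measure.ae_smul_measure (ae_restrict_mem hWm) _
  have havg : ∀ x, translationAverage μ W g x - g x = ∫ y, χ y • (g (y⁻¹ * x) - g x) ∂ρ := by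
    intro x
    have hint : Integrable (fun y => g (y⁻¹ * x)) μ :=
      Continuous.integrable_of_hasCompactSupport (by fun_prop)
        (hgs.comp_homeomorph ((Homeomorph.inv G).trans (Homeomorph.mulRight x)))
    rw [translationAverage_sub hW0 hWfin hint.integrableOn]
    refine integral_congr_ae ?_
    filter_upwards [hρW] with y hy
    rw [hχ1 (subset_closure hy), Pi.one_apply, one_smul]
  have hFs : HasCompactSupport fun p : G × G => χ p.2 • (g (p.2⁻¹ * p.1) - g p.1) := by
    refine HasCompactSupport.intro
      (((hχs.isCompact.mul hgs.isCompact).union hgs.isCompact).prod hχs.isCompact) fun p hp => ?_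
    by_cases hy : p.2 ∈ tsupport χ
    · rw [sub_translate_eq_zero_of_notMem hy fun hx => hp ⟨hx, hy⟩, smul_zero]
    · rw [image_eq_zero_of_notMem_tsupport hy, zero_smul]
  calc eLpNorm (translationAverage μ W g - g) 1 (wMeasure μ w)
      = eLpNorm (fun x => ∫ y, χ y • (g (y⁻¹ * x) - g x) ∂ρ) 1 (wMeasure μ w) :=
        congrArg (eLpNorm · 1 _) (funext havg)
    _ ≤ ∫⁻ y, eLpNorm (fun x => χ y • (g (y⁻¹ * x) - g x)) 1 (wMeasure μ w) ∂ρ :=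
        eLpNorm_integral_le_lintegral_eLpNorm _ _
          (F := fun x y => χ y • (g (y⁻¹ * x) - g x))
          (by simp only [Function.uncurry_def]; fun_prop) hFs
    _ ≤ ∫⁻ _, c ∂ρ := by
        refine lintegral_mono_ae ?_
        filter_upwards [hρW] with y hy
        simpa only [hχ1 (subset_closure hy), Pi.one_apply, one_smul] using! hc y hy
    _ = c := by simp

variable [μ.Regular] [μ.IsMulRightInvariant]

theorem eLpNorm_translationAverage_sub_le_add (hW : IsCompact (closure W)) (hWm : MeasurableSet W)
    (hW0 : μ W ≠ 0) {f g : G → E} (hf : MemLp f 1 (wMeasure μ w)) (hg : Continuous g)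
    (hgs : HasCompactSupport g) {c : ℝ≥0∞} {C : ℝ≥0} (hC : ∀ y ∈ W, w y ≤ C)
    (hc : ∀ y ∈ W, translationDist μ w f y ≤ c) :
    eLpNorm (translationAverage μ W g - f) 1 (wMeasure μ w) ≤
      c + (C + 2) * eLpNorm (f - g) 1 (wMeasure μ w) := by
  have hgm : MemLp g 1 (wMeasure μ w) := hg.memLp_of_hasCompactSupport hgs
  have hdist : ∀ y ∈ W, translationDist μ w g y ≤
      c + (C + 1) * eLpNorm (f - g) 1 (wMeasure μ w) := fun y hy => by
    rw [eLpNorm_sub_comm]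
    refine (translationDist_le_add hgm.1 hf.1 y).trans ?_
    gcongr
    exacts [hc y hy, hC y hy]
  calc eLpNorm (translationAverage μ W g - f) 1 (wMeasure μ w)
      ≤ eLpNorm (translationAverage μ W g - g) 1 (wMeasure μ w) +
          eLpNorm (f - g) 1 (wMeasure μ w) := by
        rw [← sub_sub_sub_cancel_right _ f g]
        exact eLpNorm_sub_le ((stronglyMeasurable_translationAverage hW hgm
          ).aestronglyMeasurable.sub hgm.1) (hf.1.sub hgm.1) le_rfl
    _ ≤ c + (C + 1) * eLpNorm (f - g) 1 (wMeasure μ w) + eLpNorm (f - g) 1 (wMeasure μ w) := by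
        gcongr
        exact eLpNorm_translationAverage_sub_le_of_hasCompactSupport hW hWm hW0 hg hgs hdist
    _ = c + (C + 2) * eLpNorm (f - g) 1 (wMeasure μ w) := by ring

theorem eLpNorm_translationAverage_sub_le (hW : IsCompact (closure W)) (hWm : MeasurableSet W)
    (hW0 : μ W ≠ 0) {f : G → E} (hf : MemLp f 1 (wMeasure μ w)) {c : ℝ≥0∞}
    (hc : ∀ y ∈ W, translationDist μ w f y ≤ c) :
    eLpNorm (translationAverage μ W f - f) 1 (wMeasure μ w) ≤ c := by
  obtain ⟨g, hg, hgs, hlim⟩ := exists_seq_hasCompactSupport_tendsto hf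
  obtain ⟨C, hC⟩ := w.exists_bound hW
  have hgm : ∀ n, MemLp (g n) 1 (wMeasure μ w) := fun n => (hg n).memLp_of_hasCompactSupport (hgs n)
  have hbound : Tendsto (fun n => c + (C + 2) * eLpNorm (f - g n) 1 (wMeasure μ w)) atTop
      (𝓝 c) := by
    simpa using tendsto_const_nhds.add
      (ENNReal.Tendsto.const_mul (a := (C : ℝ≥0∞) + 2) hlim (Or.inr (by simp)))
  calc eLpNorm (translationAverage μ W f - f) 1 (wMeasure μ w)
      ≤ liminf (fun n => eLpNorm (translationAverage μ W (g n) - f) 1 (wMeasure μ w)) atTop :=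
        Lp.eLpNorm_lim_le_liminf_eLpNorm
          (fun n => (stronglyMeasurable_translationAverage hW (hgm n)).aestronglyMeasurable.sub
            hf.1) _
          (Eventually.of_forall fun x => (tendsto_translationAverage hW hf hgm hlim x).sub_const _)
    _ ≤ liminf (fun n => c + (C + 2) * eLpNorm (f - g n) 1 (wMeasure μ w)) atTop :=
        liminf_le_liminf (Eventually.of_forall fun n => eLpNorm_translationAverage_sub_le_add hW hWm
          hW0 hf (hg n) (hgs n) (fun y hy => hC y (subset_closure hy)) hc)
    _ = c := hbound.liminf_eq

end AverageApproximation

section InvariantRepresentative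

theorem invMeasurableSpace_le {G : Type*} [Group G] [m : MeasurableSpace G] :
    invMeasurableSpace G ≤ m :=
  fun _ hs => hs.1

theorem stronglyMeasurable_inv_iff {G E : Type*} [Group G] [MeasurableSpace G]
    [TopologicalSpace E] [TopologicalSpace.PseudoMetrizableSpace E] [T1Space E] {h : G → E} :
    StronglyMeasurable[invMeasurableSpace G] h ↔
      StronglyMeasurable h ∧ ∀ x y : G, h (y * x * y⁻¹) = h x := by
  borelize E
  constructor
  · refine fun hh => ⟨hh.mono invMeasurableSpace_le, fun x y => ?_⟩
    have hinv := (hh.measurable (measurableSet_singleton (h x))).2 y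
    exact hinv.ge (Set.mem_singleton (h x))
  · rintro ⟨hh, hinv⟩
    refine stronglyMeasurable_iff_measurable_separable.2 ⟨fun s hs => ⟨hh.measurable hs,
      fun y => ?_⟩, hh.isSeparable_range⟩
    ext x
    simp only [Set.mem_preimage, hinv]

theorem preimage_conj_interior {G : Type*} [Group G] [TopologicalSpace G] [ContinuousMul G]
    {S : Set G} (hS : ∀ z : G, (fun x => z * x * z⁻¹) ⁻¹' S = S) (z : G) :
    (fun x => z * x * z⁻¹) ⁻¹' interior S = interior S := by
  conv_rhs => rw [← hS z]
  exact ((Homeomorph.mulLeft z).trans (Homeomorph.mulRight z⁻¹)).preimage_interior S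

theorem IsINGroup.exists_isOpen_conj_invariant_subset {G : Type*} [Group G] [TopologicalSpace G]
    [ContinuousMul G] [R1Space G] (hG : IsINGroup G) {P : Set G} (hP1 : P ∈ 𝓝 (1 : G))
    (hP : ∀ z : G, (fun x => z * x * z⁻¹) ⁻¹' P = P) :
    ∃ W ⊆ P, IsOpen W ∧ (1 : G) ∈ W ∧ IsCompact (closure W) ∧
      ∀ z : G, (fun x => z * x * z⁻¹) ⁻¹' W = W := by
  obtain ⟨V, hV, hV1, hVinv⟩ := hG
  have hVpre : ∀ z : G, (fun x => z * x * z⁻¹) ⁻¹' V = V := fun z => by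
    conv_lhs => rw [← hVinv z]
    exact Set.preimage_image_eq _ (MulAut.conj z).injective
  refine ⟨interior (P ∩ V), interior_subset.trans Set.inter_subset_left, isOpen_interior,
    mem_interior_iff_mem_nhds.2 (inter_mem hP1 hV1),
    hV.closure_of_subset (interior_subset.trans Set.inter_subset_right),
    preimage_conj_interior fun z => ?_⟩
  rw [Set.preimage_inter, hP, hVpre]

variable {G : Type*} [Group G] [TopologicalSpace G] [IsTopologicalGroup G] [T2Space G]
  [LocallyCompactSpace G] [MeasurableSpace G] [BorelSpace G]
  {μ : Measure G} [μ.IsHaarMeasure] [μ.Regular] {v w : Weight G}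
  {E : Type*} [NormedAddCommGroup E] [NormedSpace ℝ E]

theorem IsINGroup.exists_translationDist_le [μ.IsMulRightInvariant] (hG : IsINGroup G)
    (hw : w.IsClassFunction) {f : G → E} (hf : MemLp f 1 (wMeasure μ w))
    (hfinv : AEConjInvariant μ f) {ε : ℝ≥0∞} (hε : ε ≠ 0) :
    ∃ W : Set G, IsOpen W ∧ (1 : G) ∈ W ∧ IsCompact (closure W) ∧
      (∀ z : G, (fun x => z * x * z⁻¹) ⁻¹' W = W) ∧ ∀ y ∈ W, translationDist μ w f y ≤ ε := by
  obtain ⟨W, hWd, hWo, hW1, hWc, hWinv⟩ := hG.exists_isOpen_conj_invariant_subset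
    (eventually_translationDist_le hf hε) fun z => by
      ext y
      simp only [Set.mem_preimage, Set.mem_ofPred_eq, translationDist_conj hw hf.1 hfinv]
  exact ⟨W, hWo, hW1, hWc, hWinv, fun y hy => hWd hy⟩

/-- Averaging over small conjugation invariant neighbourhoods of `1` approximates `f` by class
functions, and functions with an invariant representative form a closed subspace of `L¹_w`. -/
theorem IsINGroup.exists_stronglyMeasurable_inv [CompleteSpace E] (hG : IsINGroup G)
    (hw : w.IsClassFunction) {f : G → E} (hf : MemLp f 1 (wMeasure μ w))
    (hfinv : AEConjInvariant μ f) :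
    ∃ g : G → E, StronglyMeasurable[invMeasurableSpace G] g ∧ f =ᵐ[μ] g := by
  have := hG.isMulRightInvariant μ
  have hmem : hf.toLp f ∈ closure {f : Lp E 1 (wMeasure μ w) |
      AEStronglyMeasurable[invMeasurableSpace G] f (wMeasure μ w)} := by
    refine EMetric.mem_closure_iff.2 fun ε hε => ?_
    obtain ⟨δ, hδ, hδε⟩ := exists_between hε
    obtain ⟨W, hWo, hW1, hWc, hWinv, hWd⟩ := hG.exists_translationDist_le hw hf hfinv hδ.ne'
    have hdist := eLpNorm_translationAverage_sub_le hWc hWo.measurableSet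
      (hWo.measure_pos μ ⟨1, hW1⟩).ne' hf hWd
    have hm := stronglyMeasurable_translationAverage hWc hf
    have hminv : StronglyMeasurable[invMeasurableSpace G] (translationAverage μ W f) :=
      stronglyMeasurable_inv_iff.2 ⟨hm, translationAverage_conj hWinv hfinv⟩
    have havg : MemLp (translationAverage μ W f) 1 (wMeasure μ w) := by
      have hsub : MemLp (translationAverage μ W f - f) 1 (wMeasure μ w) :=
        ⟨hm.aestronglyMeasurable.sub hf.1, hdist.trans_lt (hδε.trans_le le_top)⟩
      simpa using hsub.add hf
    refine ⟨havg.toLp _, ⟨_, hminv, havg.coeFn_toLp⟩, ?_⟩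
    rw [Lp.edist_toLp_toLp, eLpNorm_sub_comm]
    exact hdist.trans_lt hδε
  rw [(isClosed_aestronglyMeasurable invMeasurableSpace_le).closure_eq] at hmem
  obtain ⟨g, hg, hfg⟩ := hmem
  exact ⟨g, hg, (ac_wMeasure μ w).ae_le (hf.coeFn_toLp.symm.trans hfg)⟩

/-- Some weight that is constant on conjugacy classes is dominated by a multiple of `w`; then
`L¹_w` embeds into the weighted space of a class function, where averaging is available. -/
def Weight.HasInvariantMinorant {G : Type*} [Group G] [MeasurableSpace G] (w : Weight G) : Prop :=
  ∃ v : Weight G, v.IsClassFunction ∧ ∃ C : ℝ≥0, ∀ x, v x ≤ C * w x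

theorem Weight.IsClassFunction.hasInvariantMinorant {G : Type*} [Group G] [MeasurableSpace G]
    {w : Weight G} (hw : w.IsClassFunction) : w.HasInvariantMinorant :=
  ⟨w, hw, 1, fun _ => (one_mul _).ge⟩

/-- The constant weight `1`. -/
def Weight.one (G : Type*) [Group G] [MeasurableSpace G] : Weight G where
  toFun _ := 1
  measurable' := measurable_const
  pos' _ := one_pos
  mul_le' _ _ := by simp

theorem Weight.hasInvariantMinorant_of_one_le {G : Type*} [Group G] [MeasurableSpace G]
    {w : Weight G} (hw : ∀ x, 1 ≤ w x) : w.HasInvariantMinorant :=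
  ⟨Weight.one G, fun _ _ => rfl, 1, fun x => (hw x).trans (one_mul _).ge⟩

theorem memLp_wMeasure_of_le_mul {G E : Type*} [Group G] [MeasurableSpace G] {μ : Measure G}
    {v w : Weight G} [NormedAddCommGroup E] {C : ℝ≥0} (hvw : ∀ x, v x ≤ C * w x) {f : G → E}
    (hf : MemLp f 1 (wMeasure μ w)) : MemLp f 1 (wMeasure μ v) := by
  refine ⟨(hf.1.mono_ac (ac_wMeasure μ w)).mono_ac (wMeasure_ac μ v), ?_⟩
  have hlt := hf.2
  rw [eLpNorm_one_eq_lintegral_enorm, lintegral_wMeasure] at hlt ⊢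
  calc ∫⁻ x, v x * ‖f x‖ₑ ∂μ ≤ ∫⁻ x, C * (w x * ‖f x‖ₑ) ∂μ := by
        refine lintegral_mono fun x => ?_
        rw [← mul_assoc, ← ENNReal.coe_mul]
        gcongr
        exact hvw x
    _ < ∞ := by
        rw [lintegral_const_mul' _ _ ENNReal.coe_ne_top]
        exact ENNReal.mul_lt_top ENNReal.coe_lt_top hlt

theorem IsINGroup.mem_L1inv_iff_aeConjInvariant {E : Type*} [NormedAddCommGroup E]
    [NormedSpace ℂ E] [CompleteSpace E] (hG : IsINGroup G) (hw : w.HasInvariantMinorant)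
    {f : L1w μ w E} : f ∈ L1inv μ w E ↔ AEConjInvariant μ f := by
  have := hG.isMulRightInvariant μ
  constructor
  · rintro ⟨g, hg, hfg⟩ z
    filter_upwards [hfg, (measurePreserving_conj μ z).quasiMeasurePreserving.ae hfg] with x hx hzx
    rw [hx, hzx, (stronglyMeasurable_inv_iff.1 hg).2]
  · obtain ⟨v, hv, C, hvw⟩ := hw
    exact hG.exists_stronglyMeasurable_inv hv (memLp_wMeasure_of_le_mul hvw f.memLp)

end InvariantRepresentative

section ProjectiveTensor

variable {E E' F K : Type*} [NormedAddCommGroup E] [NormedSpace ℂ E]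
  [NormedAddCommGroup E'] [NormedSpace ℂ E'] [NormedAddCommGroup F] [NormedSpace ℂ F]
  [NormedAddCommGroup K] [NormedSpace ℂ K]

theorem ProjTensor.norm_tmul_le (x : E) (y : F) : ‖ProjTensor.tmul x y‖ ≤ ‖x‖ * ‖y‖ := by
  have h : (AlgTensor.tmul x y).projNorm ≤ ‖x‖ * ‖y‖ := by
    simpa using AlgTensor.projNorm_le (u := AlgTensor.tmul x y) [(x, y)] (by simp)
  exact (ProjTensor.ofAlg.norm_map _).trans_le h

/-- The canonical contractive bilinear map `E × F → E ⊗^γ F`. -/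
noncomputable def ProjTensor.mk : E →L[ℂ] F →L[ℂ] ProjTensor E F :=
  LinearMap.mkContinuous₂ ((TensorProduct.mk ℂ E F).compr₂ ProjTensor.ofAlg.toLinearMap) 1
    fun x y => by
      rw [one_mul]
      exact ProjTensor.norm_tmul_le x y

theorem ProjTensor.mk_apply (x : E) (y : F) : ProjTensor.mk x y = ProjTensor.tmul x y := rfl

theorem ProjTensor.norm_mk_le : ‖(ProjTensor.mk : E →L[ℂ] F →L[ℂ] ProjTensor E F)‖ ≤ 1 :=
  LinearMap.mkContinuous₂_norm_le _ zero_le_one _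

theorem ProjTensor.induction_on {p : ProjTensor E F → Prop} (hp : IsClosed {u | p u})
    (zero : p 0) (tmul : ∀ x y, p (ProjTensor.tmul x y)) (add : ∀ u v, p u → p v → p (u + v))
    (u : ProjTensor E F) : p u := by
  refine ProjTensor.denseRange_ofAlg.induction_on u hp fun v => ?_
  induction v using TensorProduct.induction_on with
  | zero => exact (congrArg p (map_zero ProjTensor.ofAlg)).mpr zero
  | tmul x y => exact tmul x y
  | add u v hu hv => exact (congrArg p (map_add ProjTensor.ofAlg u v)).mpr (add _ _ hu hv)

/-- The linear map on the algebraic tensor product induced by a bounded bilinear map. -/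
noncomputable def AlgTensor.lift (B : E →L[ℂ] F →L[ℂ] K) : AlgTensor E F →ₗ[ℂ] K :=
  TensorProduct.lift B.toLinearMap₁₂

theorem AlgTensor.lift_tmul (B : E →L[ℂ] F →L[ℂ] K) (x : E) (y : F) :
    AlgTensor.lift B (AlgTensor.tmul x y) = B x y :=
  TensorProduct.lift.tmul x y

theorem AlgTensor.norm_lift_sum_le (B : E →L[ℂ] F →L[ℂ] K) (l : List (E × F)) :
    ‖AlgTensor.lift B (l.map fun p => AlgTensor.tmul p.1 p.2).sum‖ ≤
      ‖B‖ * (l.map fun p => ‖p.1‖ * ‖p.2‖).sum := by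
  induction l with
  | nil => simp
  | cons p l ih =>
    simp only [List.map_cons, List.sum_cons, map_add, AlgTensor.lift_tmul, mul_add, ← mul_assoc]
    exact (norm_add_le _ _).trans (add_le_add (B.le_opNorm₂ _ _) ih)

theorem AlgTensor.norm_lift_apply_le (B : E →L[ℂ] F →L[ℂ] K) (u : AlgTensor E F) :
    ‖AlgTensor.lift B u‖ ≤ ‖B‖ * ‖u‖ := by
  refine le_mul_of_forall_lt₀ fun b hb r hr => ?_
  obtain ⟨l, rfl, hl⟩ := u.exists_lt (sub_pos.2 hr)
  have hlr : (l.map fun p => ‖p.1‖ * ‖p.2‖).sum ≤ r := (hl.trans_eq (add_sub_cancel _ _)).le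
  have hb0 : 0 ≤ b := (norm_nonneg B).trans hb.le
  exact (AlgTensor.norm_lift_sum_le B l).trans
    (mul_le_mul hb.le hlr (AlgTensor.cost_nonneg l) hb0)

theorem ProjTensor.norm_algLift_le (B : E →L[ℂ] F →L[ℂ] K) (u : AlgTensor E F) :
    ‖AlgTensor.lift B u‖ ≤ ‖B‖ * ‖ProjTensor.ofAlg.toLinearMap u‖ :=
  (AlgTensor.norm_lift_apply_le B u).trans_eq
    (congrArg (‖B‖ * ·) (ProjTensor.ofAlg.norm_map u).symm)

section Lift

variable [CompleteSpace K]

/-- The universal property of the projective tensor product: the bounded linear map on `E ⊗^γ F`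
induced by a bounded bilinear map. -/
noncomputable def ProjTensor.lift (B : E →L[ℂ] F →L[ℂ] K) : ProjTensor E F →L[ℂ] K :=
  (AlgTensor.lift B).extendOfNorm ProjTensor.ofAlg.toLinearMap

theorem ProjTensor.lift_tmul (B : E →L[ℂ] F →L[ℂ] K) (x : E) (y : F) :
    ProjTensor.lift B (ProjTensor.tmul x y) = B x y :=
  (LinearMap.extendOfNorm_eq ProjTensor.denseRange_ofAlg ⟨_, ProjTensor.norm_algLift_le B⟩ _).trans
    (AlgTensor.lift_tmul B x y)

theorem ProjTensor.norm_lift_apply_le (B : E →L[ℂ] F →L[ℂ] K) (u : ProjTensor E F) :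
    ‖ProjTensor.lift B u‖ ≤ ‖B‖ * ‖u‖ :=
  LinearMap.norm_extendOfNorm_apply_le ProjTensor.denseRange_ofAlg _
    (ProjTensor.norm_algLift_le B) u

end Lift

/-- The contraction `E ⊗^γ F → E' ⊗^γ F` induced by an isometry `E → E'`. -/
noncomputable def ProjTensor.mapLeft (e : E →ₗᵢ[ℂ] E') : ProjTensor E F →L[ℂ] ProjTensor E' F :=
  ProjTensor.lift (ProjTensor.mk.comp e.toContinuousLinearMap)

theorem ProjTensor.mapLeft_tmul (e : E →ₗᵢ[ℂ] E') (x : E) (y : F) :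
    ProjTensor.mapLeft e (ProjTensor.tmul x y) = ProjTensor.tmul (e x) y :=
  ProjTensor.lift_tmul _ x y

theorem ProjTensor.norm_mapLeft_apply_le (e : E →ₗᵢ[ℂ] E') (u : ProjTensor E F) :
    ‖ProjTensor.mapLeft e u‖ ≤ ‖u‖ := by
  have h : ‖(ProjTensor.mk : E' →L[ℂ] F →L[ℂ] ProjTensor E' F).comp e.toContinuousLinearMap‖ ≤ 1 :=
    (ContinuousLinearMap.opNorm_comp_le _ _).trans
      (mul_le_one₀ ProjTensor.norm_mk_le (norm_nonneg _) e.norm_toContinuousLinearMap_le)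
  exact (ProjTensor.norm_lift_apply_le _ u).trans (mul_le_of_le_one_left (norm_nonneg u) h)

theorem ProjTensor.mapLeft_mapLeft_of_leftInverse {e : E →ₗᵢ[ℂ] E'} {e' : E' →ₗᵢ[ℂ] E}
    (h : Function.LeftInverse e' e) (u : ProjTensor E F) :
    ProjTensor.mapLeft e' (ProjTensor.mapLeft e u) = u := by
  induction u using ProjTensor.induction_on with
  | hp => exact isClosed_eq (by fun_prop) (by fun_prop)
  | zero => rw [map_zero, map_zero]
  | tmul x y => rw [ProjTensor.mapLeft_tmul, ProjTensor.mapLeft_tmul, h]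
  | add u v hu hv => rw [map_add, map_add, hu, hv]

variable (F) in
/-- The isometry `E ⊗^γ F ≅ E' ⊗^γ F` induced by an isometry `E ≅ E'`. -/
noncomputable def ProjTensor.congrLeft (e : E ≃ₗᵢ[ℂ] E') :
    ProjTensor E F ≃ₗᵢ[ℂ] ProjTensor E' F :=
  LinearIsometryEquiv.ofBounds
    { (ProjTensor.mapLeft e.toLinearIsometry).toLinearMap with
      invFun := ProjTensor.mapLeft e.symm.toLinearIsometry
      left_inv := ProjTensor.mapLeft_mapLeft_of_leftInverse e.symm_apply_apply
      right_inv := ProjTensor.mapLeft_mapLeft_of_leftInverse e.apply_symm_apply }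
    (ProjTensor.norm_mapLeft_apply_le _) (ProjTensor.norm_mapLeft_apply_le _)

theorem ProjTensor.congrLeft_tmul (e : E ≃ₗᵢ[ℂ] E') (x : E) (y : F) :
    ProjTensor.congrLeft F e (ProjTensor.tmul x y) = ProjTensor.tmul (e x) y :=
  ProjTensor.mapLeft_tmul _ x y

end ProjectiveTensor

section ProjectiveTensorAlgebra

variable {B C K : Type*}
  [NonUnitalNormedRing B] [NormedSpace ℂ B] [IsScalarTower ℂ B B] [SMulCommClass ℂ B B]
  [NonUnitalNormedRing C] [NormedSpace ℂ C] [IsScalarTower ℂ C C] [SMulCommClass ℂ C C]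
  [NonUnitalNormedRing K] [NormedSpace ℂ K]

theorem ProjTensor.map_mul_of_map_tmul_mul_tmul (T : ProjTensor B C →L[ℂ] K)
    (hT : ∀ b b' c c', T (ProjTensor.tmul (b * b') (c * c')) =
      T (ProjTensor.tmul b c) * T (ProjTensor.tmul b' c')) (u v : ProjTensor B C) :
    T (u * v) = T u * T v := by
  induction u using ProjTensor.induction_on with
  | hp => exact isClosed_eq (by fun_prop) (by fun_prop)
  | zero => rw [zero_mul, map_zero, zero_mul]
  | add u u' hu hu' => rw [add_mul, map_add, map_add, hu, hu', add_mul]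
  | tmul b c =>
    induction v using ProjTensor.induction_on with
    | hp => exact isClosed_eq (by fun_prop) (by fun_prop)
    | zero => rw [mul_zero, map_zero, mul_zero]
    | add v v' hv hv' => rw [mul_add, map_add, map_add, hv, hv', mul_add]
    | tmul b' c' => rw [ProjTensor.tmul_mul_tmul, hT]

end ProjectiveTensorAlgebra

section ProjectiveTensorLp

variable {X : Type*} {_ : MeasurableSpace X} {ρ : Measure X} {p : ℝ≥0∞} {s : Set X} {E : Type*}
  [NormedAddCommGroup E] [NormedSpace ℂ E]

theorem indicatorConstLp_smul (hs : MeasurableSet s) (hρs : ρ s ≠ ∞) (c : ℂ) (z : E) :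
    indicatorConstLp p hs hρs (c • z) = c • indicatorConstLp p hs hρs z := by
  rw [indicatorConstLp, indicatorConstLp, ← MemLp.toLp_const_smul]
  exact MemLp.toLp_congr _ _ (.of_forall fun x => Set.indicator_const_smul_apply s c (fun _ => z) x)

variable (ρ E) in
/-- The bilinear map sending `f ∈ L^p(ρ)` and `z ∈ E` to the function `x ↦ f(x) z`. -/
noncomputable def smulLp (p : ℝ≥0∞) [Fact (1 ≤ p)] : Lp ℂ p ρ →L[ℂ] E →L[ℂ] Lp E p ρ :=
  ((ContinuousLinearMap.lsmul ℂ ℂ).flip.compLpL₂ p ρ).flip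

theorem coeFn_smulLp [Fact (1 ≤ p)] (f : Lp ℂ p ρ) (z : E) :
    smulLp ρ E p f z =ᵐ[ρ] fun x => f x • z :=
  ContinuousLinearMap.coeFn_compLp' _ f

theorem smulLp_indicatorConstLp [Fact (1 ≤ p)] (hs : MeasurableSet s) (hρs : ρ s ≠ ∞) (c : ℂ)
    (z : E) :
    smulLp ρ E p (indicatorConstLp p hs hρs c) z = indicatorConstLp p hs hρs (c • z) := by
  refine Lp.ext ((coeFn_smulLp _ z).trans ?_)
  filter_upwards [indicatorConstLp_coeFn (p := p) (hs := hs) (hμs := hρs) (c := c),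
    indicatorConstLp_coeFn (p := p) (hs := hs) (hμs := hρs) (c := c • z)] with x h₁ h₂
  rw [h₁, h₂]
  exact (Set.indicator_smul_const_apply s (fun _ => c) z x).symm

theorem norm_smulLp_le [Fact (1 ≤ p)] : ‖smulLp ρ E p‖ ≤ 1 := by
  rw [smulLp, ContinuousLinearMap.opNorm_flip]
  refine (ContinuousLinearMap.norm_compLpL₂_le _).trans ?_
  rw [ContinuousLinearMap.opNorm_flip]
  exact ContinuousLinearMap.opNorm_lsmul_le

open Classical in
/-- The vector measure `s ↦ (z ↦ 1_s ⊗ z)` with values in `L¹(ρ) ⊗^γ E`; integration against it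
inverts the canonical map `L¹(ρ) ⊗^γ E → L¹(ρ, E)`. It is real linear in `z` because so is
`L1.setToL1`, and has the junk value `0` at sets which are not measurable of finite measure. -/
noncomputable def indicatorTensor (ρ : Measure X) (s : Set X) :
    E →L[ℝ] ProjTensor (Lp ℂ 1 ρ) E :=
  if h : MeasurableSet s ∧ ρ s ≠ ∞ then
    (ProjTensor.mk (indicatorConstLp 1 h.1 h.2 (1 : ℂ))).restrictScalars ℝ else 0

theorem indicatorTensor_apply (hs : MeasurableSet s) (hρs : ρ s ≠ ∞) (z : E) :
    indicatorTensor ρ s z = ProjTensor.tmul (indicatorConstLp 1 hs hρs (1 : ℂ)) z := by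
  rw [indicatorTensor, dif_pos ⟨hs, hρs⟩]
  rfl

theorem dominatedFinMeasAdditive_indicatorTensor : DominatedFinMeasAdditive ρ
    (indicatorTensor ρ : Set X → E →L[ℝ] ProjTensor (Lp ℂ 1 ρ) E) 1 := by
  refine ⟨fun s t hs ht hρs hρt hst => ?_, fun s hs hρs => ?_⟩
  · ext z
    rw [_root_.add_apply, indicatorTensor_apply hs hρs, indicatorTensor_apply ht hρt,
      indicatorTensor_apply (hs.union ht) (measure_union_ne_top hρs hρt),
      indicatorConstLp_disjoint_union hs ht hρs hρt hst, ← ProjTensor.mk_apply, map_add]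
    rfl
  · refine ContinuousLinearMap.opNorm_le_bound _ (by positivity) fun z => ?_
    rw [indicatorTensor_apply hs hρs.ne]
    refine (ProjTensor.norm_tmul_le _ _).trans_eq ?_
    rw [norm_indicatorConstLp one_ne_zero ENNReal.one_ne_top]
    simp

/-- The inverse of the canonical map `L¹(ρ) ⊗^γ E → L¹(ρ, E)`, determined by `1_s z ↦ 1_s ⊗ z`. -/
noncomputable def l1ToProjTensor (ρ : Measure X) (E : Type*) [NormedAddCommGroup E]
    [NormedSpace ℂ E] : Lp E 1 ρ →L[ℝ] ProjTensor (Lp ℂ 1 ρ) E :=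
  L1.setToL1 dominatedFinMeasAdditive_indicatorTensor

theorem norm_l1ToProjTensor_apply_le (f : Lp E 1 ρ) : ‖l1ToProjTensor ρ E f‖ ≤ ‖f‖ := by
  simpa using! L1.norm_setToL1_le_mul_norm dominatedFinMeasAdditive_indicatorTensor zero_le_one f

theorem l1ToProjTensor_indicatorConstLp (hs : MeasurableSet s) (hρs : ρ s ≠ ∞) (z : E) :
    l1ToProjTensor ρ E (indicatorConstLp 1 hs hρs z) =
      ProjTensor.tmul (indicatorConstLp 1 hs hρs (1 : ℂ)) z :=
  (L1.setToL1_indicatorConstLp _ hs hρs z).trans (indicatorTensor_apply hs hρs z)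

variable [CompleteSpace E]

/-- The canonical map `L¹(ρ) ⊗^γ E → L¹(ρ, E)`. -/
noncomputable def projTensorToL1 (ρ : Measure X) (E : Type*) [NormedAddCommGroup E]
    [NormedSpace ℂ E] [CompleteSpace E] : ProjTensor (Lp ℂ 1 ρ) E →L[ℂ] Lp E 1 ρ :=
  ProjTensor.lift (smulLp ρ E 1)

theorem norm_projTensorToL1_apply_le (u : ProjTensor (Lp ℂ 1 ρ) E) :
    ‖projTensorToL1 ρ E u‖ ≤ ‖u‖ :=
  (ProjTensor.norm_lift_apply_le _ u).trans (mul_le_of_le_one_left (norm_nonneg u) norm_smulLp_le)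

theorem projTensorToL1_tmul_indicatorConstLp (hs : MeasurableSet s) (hρs : ρ s ≠ ∞) (c : ℂ)
    (z : E) : projTensorToL1 ρ E (ProjTensor.tmul (indicatorConstLp 1 hs hρs c) z) =
      indicatorConstLp 1 hs hρs (c • z) :=
  (ProjTensor.lift_tmul _ _ _).trans (smulLp_indicatorConstLp hs hρs c z)

theorem projTensorToL1_l1ToProjTensor (f : Lp E 1 ρ) :
    projTensorToL1 ρ E (l1ToProjTensor ρ E f) = f := by
  refine Lp.induction ENNReal.one_ne_top
    (fun f : Lp E 1 ρ => projTensorToL1 ρ E (l1ToProjTensor ρ E f) = f) (fun z s hs hρs => ?_)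
    (fun f g hf hg _ h₁ h₂ => ?_) (isClosed_eq (by fun_prop) (by fun_prop)) f
  · rw [Lp.simpleFunc.coe_indicatorConst, l1ToProjTensor_indicatorConstLp,
      projTensorToL1_tmul_indicatorConstLp, one_smul]
  · rw [map_add, map_add, h₁, h₂]

theorem l1ToProjTensor_projTensorToL1_tmul (f : Lp ℂ 1 ρ) (z : E) :
    l1ToProjTensor ρ E (projTensorToL1 ρ E (ProjTensor.tmul f z)) = ProjTensor.tmul f z := by
  simp only [← ProjTensor.mk_apply]
  refine Lp.induction ENNReal.one_ne_top
    (fun f : Lp ℂ 1 ρ =>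
      l1ToProjTensor ρ E (projTensorToL1 ρ E (ProjTensor.mk f z)) = ProjTensor.mk f z)
    (fun c s hs hρs => ?_) (fun f g hf hg _ h₁ h₂ => ?_)
    (isClosed_eq (by fun_prop) (by fun_prop)) f
  · rw [Lp.simpleFunc.coe_indicatorConst, ProjTensor.mk_apply,
      projTensorToL1_tmul_indicatorConstLp, l1ToProjTensor_indicatorConstLp,
      ← ProjTensor.mk_apply, ← ProjTensor.mk_apply, map_smul, ← ContinuousLinearMap.map_smul₂,
      ← indicatorConstLp_smul, smul_eq_mul, mul_one]
  · simp only [map_add, _root_.add_apply, h₁, h₂]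

theorem l1ToProjTensor_projTensorToL1 (u : ProjTensor (Lp ℂ 1 ρ) E) :
    l1ToProjTensor ρ E (projTensorToL1 ρ E u) = u := by
  induction u using ProjTensor.induction_on with
  | hp => exact isClosed_eq (by fun_prop) (by fun_prop)
  | zero => rw [map_zero, map_zero]
  | tmul f z => exact l1ToProjTensor_projTensorToL1_tmul f z
  | add u v hu hv => rw [map_add, map_add, hu, hv]

/-- The isometry `L¹(ρ) ⊗^γ E ≅ L¹(ρ, E)`. -/
noncomputable def projTensorL1Equiv (ρ : Measure X) (E : Type*) [NormedAddCommGroup E]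
    [NormedSpace ℂ E] [CompleteSpace E] : ProjTensor (Lp ℂ 1 ρ) E ≃ₗᵢ[ℂ] Lp E 1 ρ :=
  LinearIsometryEquiv.ofBounds
    { (projTensorToL1 ρ E).toLinearMap with
      invFun := l1ToProjTensor ρ E
      left_inv := l1ToProjTensor_projTensorToL1
      right_inv := projTensorToL1_l1ToProjTensor }
    norm_projTensorToL1_apply_le norm_l1ToProjTensor_apply_le

theorem coeFn_projTensorL1Equiv_tmul (f : Lp ℂ 1 ρ) (z : E) :
    projTensorL1Equiv ρ E (ProjTensor.tmul f z) =ᵐ[ρ] fun x => f x • z :=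
  (Lp.ext_iff.1 (ProjTensor.lift_tmul (smulLp ρ E 1) f z)).trans (coeFn_smulLp f z)

end ProjectiveTensorLp

section InvariantSubspace

variable {G : Type*} [Group G] [MeasurableSpace G]

theorem mem_L1inv_iff {μ : Measure G} {w : Weight G} {E : Type*} [NormedAddCommGroup E]
    [NormedSpace ℂ E] {g : L1w μ w E} :
    g ∈ L1inv μ w E ↔ ∃ h : G → E, StronglyMeasurable h ∧ (∀ x y : G, h (y * x * y⁻¹) = h x) ∧
      ∀ᵐ x ∂μ, g x = h x := by
  simp only [← and_assoc, ← stronglyMeasurable_inv_iff]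
  rfl

/-- `L¹_{w,inv}(G, E)` is the `L¹` space of the restriction of `w(x) dx` to the conjugation
invariant Borel sets. -/
noncomputable def L1inv.equivLpTrim (μ : Measure G) (w : Weight G) (E : Type*)
    [NormedAddCommGroup E] [NormedSpace ℂ E] :
    L1inv μ w E ≃ₗᵢ[ℂ] Lp E 1 ((wMeasure μ w).trim (invMeasurableSpace_le (G := G))) :=
  LinearIsometryEquiv.trans
    { toFun := fun f => (⟨f.1, f.2.imp fun _ hg => ⟨hg.1, (wMeasure_ac μ w).ae_le hg.2⟩⟩ :
        lpMeas E ℂ (invMeasurableSpace G) 1 (wMeasure μ w))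
      invFun := fun f => ⟨f.1, f.2.imp fun _ hg => ⟨hg.1, (ac_wMeasure μ w).ae_le hg.2⟩⟩
      left_inv := fun _ => rfl
      right_inv := fun _ => rfl
      map_add' := fun _ _ => rfl
      map_smul' := fun _ _ => rfl
      norm_map' := fun _ => rfl }
    (lpMeasToLpTrimLie E ℂ 1 (wMeasure μ w) invMeasurableSpace_le)

theorem L1inv.coeFn_equivLpTrim {μ : Measure G} {w : Weight G} {E : Type*} [NormedAddCommGroup E]
    [NormedSpace ℂ E] (f : L1inv μ w E) : (L1inv.equivLpTrim μ w E f : G → E) =ᵐ[μ] f.1 :=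
  (ac_wMeasure μ w).ae_le (lpMeasToLpTrim_ae_eq invMeasurableSpace_le _)

end InvariantSubspace

section CenterInclusion

/-- Composition of the elements of `L¹_w(G, E)` with an isometry `E → F`. -/
noncomputable def L1w.compIsometry {G : Type*} [Group G] [MeasurableSpace G] (μ : Measure G)
    (w : Weight G) {E F : Type*} [NormedAddCommGroup E] [NormedSpace ℂ E] [NormedAddCommGroup F]
    [NormedSpace ℂ F] (L : E →ₗᵢ[ℂ] F) : L1w μ w E →ₗᵢ[ℂ] L1w μ w F where
  toLinearMap := L.toContinuousLinearMap.compLpₗ 1 (wMeasure μ w)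
  norm_map' f := by
    change ‖L.toContinuousLinearMap.compLp (show Lp E 1 (wMeasure μ w) from f)‖ =
      ‖(show Lp E 1 (wMeasure μ w) from f)‖
    rw [Lp.norm_def, Lp.norm_def, eLpNorm_congr_ae (ContinuousLinearMap.coeFn_compLp _ _)]
    exact congrArg _ (eLpNorm_congr_norm_ae (Eventually.of_forall fun _ => L.norm_map _))

theorem L1w.coe_compIsometry {G : Type*} [Group G] [MeasurableSpace G] {μ : Measure G}
    {w : Weight G} {E F : Type*} [NormedAddCommGroup E] [NormedSpace ℂ E] [NormedAddCommGroup F]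
    [NormedSpace ℂ F] (L : E →ₗᵢ[ℂ] F) (f : L1w μ w E) :
    (L1w.compIsometry μ w L f : G → F) =ᵐ[μ] fun x => L (f x) :=
  (ac_wMeasure μ w).ae_le (ContinuousLinearMap.coeFn_compLp _ _)

variable {G : Type*} [Group G] [MeasurableSpace G] {μ : Measure G} {w : Weight G}
  {A : Type*} [NonUnitalNormedRing A] [NormedSpace ℂ A] [IsScalarTower ℂ A A]
  [SMulCommClass ℂ A A]

variable (A) in
/-- The inclusion of the centre of `A` into `A` as a linear isometry. -/
noncomputable def centerIncl : Z A →ₗᵢ[ℂ] A where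
  toFun z := z
  map_add' _ _ := rfl
  map_smul' _ _ := rfl
  norm_map' _ := rfl

theorem centerIncl_apply (z : Z A) : centerIncl A z = z := rfl

variable (μ w A) in
/-- The inclusion of the `Z(A)`-valued functions into the `A`-valued ones. -/
noncomputable def L1w.centerIncl : L1w μ w (Z A) →ₗᵢ[ℂ] L1w μ w A :=
  L1w.compIsometry μ w (Beurling.centerIncl A)

theorem L1w.coe_centerIncl (f : L1w μ w (Z A)) :
    (L1w.centerIncl μ w A f : G → A) =ᵐ[μ] fun x => (f x : A) :=
  L1w.coe_compIsometry (Beurling.centerIncl A) f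

theorem L1w.exists_centerIncl_eq {F : L1w μ w A} (hF : ∀ᵐ x ∂μ, F x ∈ Z A) :
    ∃ f : L1w μ w (Z A), L1w.centerIncl μ w A f = F := by
  classical
  let f : G → Z A := fun x => if h : F x ∈ Z A then ⟨F x, h⟩ else 0
  have hf : (fun x => (f x : A)) =ᵐ[wMeasure μ w] F := by
    filter_upwards [(wMeasure_ac μ w).ae_le hF] with x hx
    simp [f, hx]
  have hm : MemLp (fun x => (f x : A)) 1 (wMeasure μ w) := (memLp_congr_ae hf).2 F.memLp
  have hfm : MemLp f 1 (wMeasure μ w) :=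
    ⟨(Topology.IsEmbedding.subtypeVal.aestronglyMeasurable_comp_iff).1 hm.1, hm.2⟩
  refine ⟨L1w.mk f hfm, L1w.ext ?_⟩
  filter_upwards [L1w.coe_centerIncl (L1w.mk f hfm), L1w.coe_mk f hfm, (ac_wMeasure μ w).ae_le hf]
    with x hincl hmk hfx
  rw [hincl, hmk, hfx]

variable [TopologicalSpace G] [IsTopologicalGroup G] [BorelSpace G]

theorem L1w.aeConjInvariant_centerIncl_iff [μ.IsMulLeftInvariant] [μ.IsMulRightInvariant]
    {f : L1w μ w (Z A)} : AEConjInvariant μ (L1w.centerIncl μ w A f) ↔ AEConjInvariant μ f := by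
  refine forall_congr' fun z => eventually_congr ?_
  have hf := L1w.coe_centerIncl f
  filter_upwards [hf, (measurePreserving_conj μ z).quasiMeasurePreserving.ae hf] with x hx hzx
  rw [hx, hzx, Subtype.coe_inj]

variable [T2Space G] [LocallyCompactSpace G] [μ.IsHaarMeasure] [μ.Regular] [CompleteSpace A]

theorem L1w.centerIncl_mul (f g : L1w μ w (Z A)) :
    L1w.centerIncl μ w A (f * g) = L1w.centerIncl μ w A f * L1w.centerIncl μ w A g := by
  refine L1w.ext ?_
  refine EventuallyEq.trans ?_ (L1w.conv_congr (L1w.coe_centerIncl f) (L1w.coe_centerIncl g)).symm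
  filter_upwards [L1w.coe_centerIncl (f * g), L1w.coe_mul f g] with x hincl hmul
  rw [hincl, hmul, conv, ← centerIncl_apply, ← (Beurling.centerIncl A).integral_comp_comm]
  rfl

theorem IsINGroup.mem_L1inv_iff_centerIncl_mem_center (hG : IsINGroup G)
    (hw : w.HasInvariantMinorant) (hA : ∀ z ∈ Z A, (∀ a, a * z = 0) → z = 0)
    {f : L1w μ w (Z A)} :
    f ∈ L1inv μ w (Z A) ↔ L1w.centerIncl μ w A f ∈ Z (L1w μ w A) := by
  have := hG.isMulRightInvariant μ
  have hcenter : ∀ᵐ x ∂μ, L1w.centerIncl μ w A f x ∈ Z A :=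
    (L1w.coe_centerIncl f).mono fun x hx => hx ▸ (f x).2
  rw [hG.mem_L1inv_iff_aeConjInvariant hw, mem_center_iff hA, and_iff_left hcenter,
    L1w.aeConjInvariant_centerIncl_iff]

variable (μ) in
/-- The isometry `L¹_{w,inv}(G, Z(A)) ≅ Z(L¹_w(G, A))` which regards `Z(A)`-valued functions as
`A`-valued ones. -/
noncomputable def IsINGroup.centerEquiv (hG : IsINGroup G) (hw : w.HasInvariantMinorant)
    (hA : ∀ z ∈ Z A, (∀ a, a * z = 0) → z = 0) : L1inv μ w (Z A) ≃ₗᵢ[ℂ] Z (L1w μ w A) :=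
  LinearIsometryEquiv.ofSurjective
    { toFun := fun f =>
        ⟨L1w.centerIncl μ w A f.1, (hG.mem_L1inv_iff_centerIncl_mem_center hw hA).1 f.2⟩
      map_add' := fun f g => Subtype.ext ((L1w.centerIncl μ w A).map_add f.1 g.1)
      map_smul' := fun c f => Subtype.ext ((L1w.centerIncl μ w A).map_smul c f.1)
      norm_map' := fun f => (L1w.centerIncl μ w A).norm_map f.1 } <| by
    have := hG.isMulRightInvariant μ
    rintro ⟨F, hF⟩
    obtain ⟨f, rfl⟩ := L1w.exists_centerIncl_eq ((mem_center_iff hA).1 hF).2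
    exact ⟨⟨f, (hG.mem_L1inv_iff_centerIncl_mem_center hw hA).2 hF⟩, rfl⟩

theorem IsINGroup.coeFn_centerEquiv (hG : IsINGroup G) (hw : w.HasInvariantMinorant)
    (hA : ∀ z ∈ Z A, (∀ a, a * z = 0) → z = 0) (f : L1inv μ w (Z A)) :
    ((hG.centerEquiv μ hw hA f : L1w μ w A) : G → A) =ᵐ[μ] fun x => (f.1 x : A) :=
  L1w.coe_centerIncl f.1

theorem IsINGroup.centerEquiv_eq_mul (hG : IsINGroup G) (hw : w.HasInvariantMinorant)
    (hA : ∀ z ∈ Z A, (∀ a, a * z = 0) → z = 0) {f g h : L1inv μ w (Z A)} (hfg : h.1 = f.1 * g.1) :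
    hG.centerEquiv μ hw hA h = hG.centerEquiv μ hw hA f * hG.centerEquiv μ hw hA g :=
  Subtype.ext ((congrArg (L1w.centerIncl μ w A) hfg).trans (L1w.centerIncl_mul f.1 g.1))

end CenterInclusion

section TensorEquiv

variable {G : Type*} [Group G] [TopologicalSpace G] [IsTopologicalGroup G] [T2Space G]
  [LocallyCompactSpace G] [MeasurableSpace G] [BorelSpace G]
  {μ : Measure G} [μ.IsHaarMeasure] [μ.Regular] {w : Weight G}

theorem IsINGroup.mem_L1inv_iff_mem_center (hG : IsINGroup G) (hw : w.HasInvariantMinorant)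
    {f : L1w μ w ℂ} : f ∈ L1inv μ w ℂ ↔ f ∈ Z (L1w μ w ℂ) := by
  have := hG.isMulRightInvariant μ
  rw [hG.mem_L1inv_iff_aeConjInvariant hw, mem_center_iff fun z _ hz => by simpa using hz 1,
    and_iff_left (Eventually.of_forall fun x => (mem_Z_iff _ _).2 fun _ => mul_comm _ _)]

variable (μ) in
/-- `L¹_{w,inv}(G)` and `Z(L¹_w(G))` are the same subspace of `L¹_w(G)`. -/
noncomputable def IsINGroup.scalarCenterEquiv (hG : IsINGroup G) (hw : w.HasInvariantMinorant) :
    L1inv μ w ℂ ≃ₗᵢ[ℂ] Z (L1w μ w ℂ) where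
  toFun f := ⟨f.1, (hG.mem_L1inv_iff_mem_center hw).1 f.2⟩
  invFun f := ⟨f.1, (hG.mem_L1inv_iff_mem_center hw).2 f.2⟩
  left_inv _ := rfl
  right_inv _ := rfl
  map_add' _ _ := rfl
  map_smul' _ _ := rfl
  norm_map' _ := rfl

variable (μ) in
/-- The isometry `Z(L¹_w(G)) ⊗^γ E ≅ L¹_{w,inv}(G, E)` which sends `f ⊗ z` to `x ↦ f(x) z`: both
sides are the `E`-valued `L¹` space of the conjugation invariant sets. -/
noncomputable def IsINGroup.tensorEquiv (hG : IsINGroup G) (hw : w.HasInvariantMinorant)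
    (E : Type*) [NormedAddCommGroup E] [NormedSpace ℂ E] [CompleteSpace E] :
    ProjTensor (Z (L1w μ w ℂ)) E ≃ₗᵢ[ℂ] L1inv μ w E :=
  (ProjTensor.congrLeft E ((hG.scalarCenterEquiv μ hw).symm.trans (L1inv.equivLpTrim μ w ℂ))).trans
    ((projTensorL1Equiv _ E).trans (L1inv.equivLpTrim μ w E).symm)

theorem IsINGroup.tensorEquiv_tmul (hG : IsINGroup G) (hw : w.HasInvariantMinorant)
    {E : Type*} [NormedAddCommGroup E] [NormedSpace ℂ E] [CompleteSpace E]
    (f : Z (L1w μ w ℂ)) (z : E) :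
    ((hG.tensorEquiv μ hw E (ProjTensor.tmul f z) : L1w μ w E) : G → E) =ᵐ[μ]
      fun x => (f : L1w μ w ℂ) x • z := by
  set g := (hG.scalarCenterEquiv μ hw).symm f
  have htensor : L1inv.equivLpTrim μ w E (hG.tensorEquiv μ hw E (ProjTensor.tmul f z)) =
      projTensorL1Equiv _ E (ProjTensor.tmul (L1inv.equivLpTrim μ w ℂ g) z) := by
    simp only [IsINGroup.tensorEquiv, LinearIsometryEquiv.trans_apply,
      LinearIsometryEquiv.apply_symm_apply, ProjTensor.congrLeft_tmul, g]
  have htmul : (projTensorL1Equiv _ E (ProjTensor.tmul (L1inv.equivLpTrim μ w ℂ g) z) : G → E)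
      =ᵐ[μ] fun x => L1inv.equivLpTrim μ w ℂ g x • z :=
    (ac_wMeasure μ w).ae_le (ae_eq_of_ae_eq_trim (coeFn_projTensorL1Equiv_tmul _ z))
  have hΘ := L1inv.coeFn_equivLpTrim (hG.tensorEquiv μ hw E (ProjTensor.tmul f z))
  rw [htensor] at hΘ
  refine hΘ.symm.trans (htmul.trans ?_)
  exact (L1inv.coeFn_equivLpTrim g).mono fun x hx => congrArg (· • z) hx

variable {A : Type*} [NonUnitalNormedRing A] [NormedSpace ℂ A] [IsScalarTower ℂ A A]
  [SMulCommClass ℂ A A] [CompleteSpace A]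

theorem L1w.eq_mul_of_ae_eq_smul {f g : L1w μ w ℂ} {z z' : A} {F F' H : L1w μ w A}
    (hF : (F : G → A) =ᵐ[μ] fun x => f x • z) (hF' : (F' : G → A) =ᵐ[μ] fun x => g x • z')
    (hH : (H : G → A) =ᵐ[μ] fun x => (f * g) x • (z * z')) : H = F * F' := by
  refine L1w.ext (hH.trans (EventuallyEq.trans ?_ (L1w.conv_congr hF hF').symm))
  filter_upwards [L1w.coe_mul f g] with x hx
  simp only [hx, conv, smul_mul_smul_comm]
  exact (integral_smul_const _ _).symm

theorem IsINGroup.tensorEquiv_mul (hG : IsINGroup G) (hw : w.HasInvariantMinorant)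
    (u v : ProjTensor (Z (L1w μ w ℂ)) A) :
    (hG.tensorEquiv μ hw A (u * v) : L1w μ w A) =
      hG.tensorEquiv μ hw A u * hG.tensorEquiv μ hw A v :=
  ProjTensor.map_mul_of_map_tmul_mul_tmul (B := Z (L1w μ w ℂ)) (C := A)
    ((L1inv μ w A).subtypeL.comp
      (hG.tensorEquiv μ hw A).toContinuousLinearEquiv.toContinuousLinearMap)
    (fun f f' z z' => L1w.eq_mul_of_ae_eq_smul (hG.tensorEquiv_tmul hw f z)
      (hG.tensorEquiv_tmul hw f' z') (hG.tensorEquiv_tmul hw (f * f') (z * z'))) u v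

end TensorEquiv

theorem IsBoundedCenterApproxIdentity.eq_zero {A : Type*} [NonUnitalNormedRing A] [NormedSpace ℂ A]
    [IsScalarTower ℂ A A] [SMulCommClass ℂ A A] {ι : Type*} [Preorder ι] [IsDirectedOrder ι]
    [Nonempty ι] {a : ι → A} (ha : IsBoundedCenterApproxIdentity a) :
    ∀ z ∈ Z A, (∀ b, b * z = 0) → z = 0 := fun z hz hzero => by
  have hlim := ha.tendsto z hz
  simp only [hzero] at hlim
  exact (tendsto_nhds_unique tendsto_const_nhds hlim).symm

end Beurling

theorem mainTheorem1_general
    {G : Type*} [Group G] [TopologicalSpace G] [IsTopologicalGroup G] [T2Space G]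
    [LocallyCompactSpace G] [MeasurableSpace G] [BorelSpace G]
    (μ : Measure G) [μ.IsHaarMeasure] [μ.Regular]
    (hG : Beurling.IsINGroup G)
    (w : Beurling.Weight G) (hw : w.HasInvariantMinorant)
    {A : Type*} [NonUnitalNormedRing A] [NormedSpace ℂ A] [IsScalarTower ℂ A A]
    [SMulCommClass ℂ A A] [CompleteSpace A]
    (hA : ∀ z ∈ Beurling.Z A, (∀ b, b * z = 0) → z = 0) :
    ∃ (Θ : Beurling.ProjTensor (Beurling.Z (Beurling.L1w μ w ℂ)) (Beurling.Z A) ≃ₗᵢ[ℂ]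
          Beurling.L1inv μ w (Beurling.Z A))
      (Ψ : Beurling.L1inv μ w (Beurling.Z A) ≃ₗᵢ[ℂ] Beurling.Z (Beurling.L1w μ w A)),
      (∀ (f : Beurling.Z (Beurling.L1w μ w ℂ)) (z : Beurling.Z A),
        ∀ᵐ x ∂μ, (Θ (Beurling.ProjTensor.tmul f z)).1 x = f.1 x • z) ∧
      (∀ g : Beurling.L1inv μ w (Beurling.Z A), ∀ᵐ x ∂μ, (Ψ g).1 x = (g.1 x : A)) ∧
      (∀ u v, (Θ (u * v)).1 = (Θ u).1 * (Θ v).1) ∧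
      (∀ u v, Ψ (Θ (u * v)) = Ψ (Θ u) * Ψ (Θ v)) ∧
      (∀ g : Beurling.L1w μ w (Beurling.Z A), g ∈ Beurling.L1inv μ w (Beurling.Z A) ↔
        ∃ h : G → Beurling.Z A, StronglyMeasurable h ∧ (∀ x y : G, h (y * x * y⁻¹) = h x) ∧
          ∀ᵐ x ∂μ, g x = h x) := by
  have hmul := hG.tensorEquiv_mul (μ := μ) (A := Beurling.Z A) hw
  exact ⟨hG.tensorEquiv μ hw (Beurling.Z A), hG.centerEquiv μ hw hA, hG.tensorEquiv_tmul hw,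
    hG.coeFn_centerEquiv hw hA, hmul, fun u v => hG.centerEquiv_eq_mul hw hA (hmul u v),
    fun _ => Beurling.mem_L1inv_iff⟩

theorem mainTheorem1
    {G : Type*} [Group G] [TopologicalSpace G] [IsTopologicalGroup G] [T2Space G]
    [LocallyCompactSpace G] [MeasurableSpace G] [BorelSpace G]
    (μ : Measure G) [μ.IsHaarMeasure] [μ.Regular]
    (hG : Beurling.IsINGroup G)
    (w : Beurling.Weight G) (hw : w.IsClassFunction ∨ ∀ x : G, 1 ≤ w x)
    {A : Type*} [NonUnitalNormedRing A] [NormedSpace ℂ A] [IsScalarTower ℂ A A]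
    [SMulCommClass ℂ A A] [CompleteSpace A]
    {ι : Type*} [Preorder ι] [IsDirectedOrder ι] [Nonempty ι] (a : ι → A)
    (ha : Beurling.IsBoundedCenterApproxIdentity a) :
    ∃ (Θ : Beurling.ProjTensor (Beurling.Z (Beurling.L1w μ w ℂ)) (Beurling.Z A) ≃ₗᵢ[ℂ]
          Beurling.L1inv μ w (Beurling.Z A))
      (Ψ : Beurling.L1inv μ w (Beurling.Z A) ≃ₗᵢ[ℂ] Beurling.Z (Beurling.L1w μ w A)),
      -- `Θ (f ⊗ z)` is the function `x ↦ f(x) z`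
      (∀ (f : Beurling.Z (Beurling.L1w μ w ℂ)) (z : Beurling.Z A),
        ∀ᵐ x ∂μ, (Θ (Beurling.ProjTensor.tmul f z)).1 x = f.1 x • z) ∧
      -- `Ψ` is the inclusion of the `Z(A)`-valued functions into the `A`-valued ones
      (∀ g : Beurling.L1inv μ w (Beurling.Z A), ∀ᵐ x ∂μ, (Ψ g).1 x = (g.1 x : A)) ∧
      -- both maps are multiplicative
      (∀ u v, (Θ (u * v)).1 = (Θ u).1 * (Θ v).1) ∧
      (∀ u v, Ψ (Θ (u * v)) = Ψ (Θ u) * Ψ (Θ v)) ∧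
      -- `L¹_{w,inv}(G, Z(A))` consists of the functions constant on conjugacy classes
      (∀ g : Beurling.L1w μ w (Beurling.Z A), g ∈ Beurling.L1inv μ w (Beurling.Z A) ↔
        ∃ h : G → Beurling.Z A, StronglyMeasurable h ∧ (∀ x y : G, h (y * x * y⁻¹) = h x) ∧
          ∀ᵐ x ∂μ, g x = h x) :=
  mainTheorem1_general μ hG w (hw.elim Beurling.Weight.IsClassFunction.hasInvariantMinorant
    Beurling.Weight.hasInvariantMinorant_of_one_le) ha.eq_zero
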